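/- Let $A$ be a finite alphabet and let $w=w_0w_1w_2\cdots\in A^{\mathbb N}$ be an infinite word. A finite word $u$ (possibly empty) is a \emph{factor} of $w$ if $u=w_i\cdots w_{i+|u|-1}$ for some $i$. The word $w$ is \emph{recurrent} if each of its factors occurs in $w$ infinitely many times, \emph{periodic} if for some $T\ge 1$ one has $w_{n+T}=w_n$ for all $n$, \emph{ultimately periodic} if for some $T\ge 1$ this holds for all sufficiently large $n$, and \emph{aperiodic} if it is not ultimately periodic. It is \emph{Sturmian} if it has exactly $n+1$ distinct factors of length $n$ for every $n\ge 0$. Two finite words are \emph{abelian equivalent} if they are permutations of each other. For a factor $u$ of a recurrent word $w$ let $n_1<n_2<\cdots$ be all positions at which a word abelian equivalent to $u$ occurs in $w$. The \emph{semi-abelian returns} to $u$ in $w$ are the distinct words $w_{n_i}\cdots w_{n_{i+1}-1}$ $(i\ge 1)$, and the \emph{abelian returns} to $u$ in $w$ are the abelian equivalence classes of these words. Let $w$ be a recurrent infinite word over a finite alphabet. 1. If $w$ is aperiodic, then $w$ is Sturmian if and only if each factor of $w$ has two or three abelian returns in $w$. 2. If exactly $k$ distinct letters occur in $w$ and each factor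 of $w$ has at most $k$ abelian returns in $w$, then $w$ is periodic. 3. If $w$ is aperiodic, then $w$ is Sturmian if and only if each factor of $w$ has two or three semi-abelian returns in $w$. -/

import Mathlib

namespace AbelianReturns

variable {A : Type*}

/-- The finite word `w i, w (i + 1), …, w (i + n - 1)` read in the infinite word `w`. -/
def factorAt (w : ℕ → A) (i n : ℕ) : List A :=
  List.ofFn (fun j : Fin n => w (i + j))

/-- The finite word `u` (possibly empty) is a factor of the infinite word `w`. -/
def IsFactor (w : ℕ → A) (u : List A) : Prop :=
  ∃ i, factorAt w i u.length = u

/-- The factor complexity: the number of distinct factors of length `n`. -/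
noncomputable def complexity (w : ℕ → A) (n : ℕ) : ℕ :=
  {u : List A | u.length = n ∧ IsFactor w u}.ncard

/-- Sturmian words: the infinite words with exactly `n + 1` factors of each length `n`. -/
def IsSturmian (w : ℕ → A) : Prop :=
  ∀ n, complexity w n = n + 1

/-- Each factor occurs infinitely many times. -/
def IsRecurrent (w : ℕ → A) : Prop :=
  ∀ u, IsFactor w u → {i | factorAt w i u.length = u}.Infinite

def IsPeriodic (w : ℕ → A) : Prop :=
  ∃ T, 0 < T ∧ ∀ n, w (n + T) = w n

def IsUltimatelyPeriodic (w : ℕ → A) : Prop :=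
  ∃ T, 0 < T ∧ ∃ n₀, ∀ n, n₀ ≤ n → w (n + T) = w n

def IsAperiodic (w : ℕ → A) : Prop :=
  ¬ IsUltimatelyPeriodic w

/-- A word abelian equivalent to `u` (a permutation of `u`) occurs in `w` at position `i`. -/
def AbelianOccurs (w : ℕ → A) (u : List A) (i : ℕ) : Prop :=
  (factorAt w i u.length).Perm u

/-- `i < j` are consecutive positions at which words abelian equivalent to `u` occur in `w`. -/
def ConsecutiveOccurrences (w : ℕ → A) (u : List A) (i j : ℕ) : Prop :=
  i < j ∧ AbelianOccurs w u i ∧ AbelianOccurs w u j ∧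
    ∀ k, i < k → k < j → ¬ AbelianOccurs w u k

/-- The semi-abelian returns to `u` in `w`: the words `w i, …, w (j - 1)` for consecutive
occurrences `i < j` of the abelian class of `u`. -/
def semiAbelianReturns (w : ℕ → A) (u : List A) : Set (List A) :=
  {v | ∃ i j, ConsecutiveOccurrences w u i j ∧ v = factorAt w i (j - i)}

/-- The abelian returns to `u` in `w`: the abelian classes of the semi-abelian returns. The type
`Multiset A` is by definition the quotient of `List A` by permutation, so its elements are the
abelian classes of words over `A`. -/
def abelianReturns (w : ℕ → A) (u : List A) : Set (Multiset A) :=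
  (fun v : List A => (v : Multiset A)) '' semiAbelianReturns w u

end AbelianReturns

/-! A 0-1 word is balanced if two windows of equal length never differ by more than one in their
number of ones. For aperiodic binary words balanced and Sturmian are the same
(`IsBalanced.isSturmian`, `IsSturmian.isBalanced`), so items 1 and 3 amount to showing that balance
is equivalent to having at most three returns. The lower bound two is cheap: if all returns to a
class were one word, the word would be ultimately periodic.

Number of letters. Let a prefix containing all letters recur at `n`, and let `J` be the first place
where the futures of `0` and `n` disagree. All windows of length `n` at positions up to `J` are
abelian equivalent, so every letter is a return, and the return starting at `J` is longer than a
letter (`PrefixRecurrent.exists_many_returns`). This is item 2, and in items 1 and 3 it leaves only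
binary words.

Balanced words have at most three returns (`IsBalanced.exists_sameWord`). Up to exchanging letters
the class is the lower of two, and a return longer than a letter is `0B1`, with `1B0` at distance
`N`. Balance makes the words `B` prefixes and suffixes of each other. A shorter `B` is a cut of the
longest one, no two lengths share the letter following the cut, and each one-letter return excludes
one of these letters.

At most three returns force balance (`AtMostThree.isBalanced`). Otherwise take a shortest pair
`0P0`, `1P1` and find a class with four returns. If `P` is empty, use windows tied to a long
repeated prefix. If `P` has both letters, use windows two letters longer than `P` plus one: the
class one above the average has returns `0`, `1`, one around `0P0`, and one of length two unless the
word is ultimately periodic. If `P` is constant, the ones (say) have exactly two distances, and the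
word of these distances is analysed in the same way. -/

namespace AbelianReturns

/-! ### Windows and returns in 0-1 words -/

/-- The number of ones among the first `n` letters of a `0`-`1` word. -/
def psum (x : ℕ → ℤ) (n : ℕ) : ℤ := ∑ i ∈ Finset.range n, x i

/-- The number of ones in the window `x i, …, x (i + N - 1)`. -/
def win (x : ℕ → ℤ) (N i : ℕ) : ℤ := psum x (i + N) - psum x i

def IsBinary (x : ℕ → ℤ) : Prop := ∀ i, x i = 0 ∨ x i = 1

/-- Every prefix occurs arbitrarily far. -/
def PrefixRecurrent {B : Type*} (x : ℕ → B) : Prop :=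
  ∀ M b, ∃ q, b ≤ q ∧ ∀ t, t < M → x (q + t) = x t

/-- `i < j` are consecutive positions of windows of length `N` with the same number of ones. -/
def Ret (x : ℕ → ℤ) (N i j : ℕ) : Prop :=
  i < j ∧ win x N j = win x N i ∧ ∀ k, i < k → k < j → win x N k ≠ win x N i

/-- No abelian class has four returns that are pairwise not abelian equivalent. -/
def AtMostThree (x : ℕ → ℤ) : Prop :=
  ∀ (N : ℕ) (i j : Fin 4 → ℕ), (∀ a, Ret x N (i a) (j a)) →
    (∀ a b, win x N (i a) = win x N (i b)) →
    ∃ a b, a ≠ b ∧ j a - i a = j b - i b ∧ psum x (j a) - psum x (i a) = psum x (j b) - psum x (i b)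

/-- The words `0 P 0` and `1 P 1`, with `P` of length `k - 1`, occur at `i` and at `j`. -/
def Unbalanced (x : ℕ → ℤ) (k i j : ℕ) : Prop :=
  x i = 0 ∧ x (i + k) = 0 ∧ x j = 1 ∧ x (j + k) = 1 ∧ ∀ t, 0 < t → t < k → x (i + t) = x (j + t)

def IsBalanced (x : ℕ → ℤ) : Prop := ∀ n i j, win x n j - win x n i ≤ 1

variable {x : ℕ → ℤ}

lemma psum_succ (x : ℕ → ℤ) (n : ℕ) : psum x (n + 1) = psum x n + x n :=
  Finset.sum_range_succ _ _

lemma win_zero (x : ℕ → ℤ) (i : ℕ) : win x 0 i = 0 := by simp [win]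

lemma win_add (x : ℕ → ℤ) (a b i : ℕ) : win x (a + b) i = win x a i + win x b (i + a) := by
  simp only [win, ← add_assoc]; ring

lemma win_one (x : ℕ → ℤ) (i : ℕ) : win x 1 i = x i := by simp [win, psum_succ]

lemma win_succ (x : ℕ → ℤ) (n i : ℕ) : win x (n + 1) i = win x n i + x (i + n) := by
  rw [win_add, win_one]

lemma win_succ' (x : ℕ → ℤ) (n i : ℕ) : win x (n + 1) i = x i + win x n (i + 1) := by
  rw [add_comm n 1, win_add, win_one]

lemma win_shift (x : ℕ → ℤ) (n i : ℕ) : win x n (i + 1) = win x n i + x (i + n) - x i := by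
  have h1 := win_succ x n i
  have h2 := win_succ' x n i
  linarith

lemma psum_eq (x : ℕ → ℤ) (i l : ℕ) : psum x (i + l) = psum x i + win x l i := by
  simp [win]

lemma win_congr {n i j : ℕ} (h : ∀ t, t < n → x (i + t) = x (j + t)) : win x n i = win x n j := by
  induction n with
  | zero => simp [win]
  | succ n ih =>
    rw [win_succ, win_succ, ih (fun t ht => h t (by omega)), h n (by omega)]

lemma win_const {n i : ℕ} {c : ℤ} (h : ∀ t, t < n → x (i + t) = c) : win x n i = n * c := by
  induction n with
  | zero => simp [win]
  | succ n ih =>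
    rw [win_succ, ih (fun t ht => h t (by omega)), h n (by omega)]; push_cast; ring

lemma IsBinary.win_nonneg (hx : IsBinary x) (n i : ℕ) : 0 ≤ win x n i := by
  induction n with
  | zero => simp [win]
  | succ n ih => rw [win_succ]; rcases hx (i + n) with h | h <;> omega

lemma IsBinary.win_le (hx : IsBinary x) (n i : ℕ) : win x n i ≤ n := by
  induction n with
  | zero => simp [win]
  | succ n ih => rw [win_succ]; push_cast; rcases hx (i + n) with h | h <;> omega

lemma PrefixRecurrent.factor {B : Type*} {x : ℕ → B} (h : PrefixRecurrent x) (p M b : ℕ) :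
    ∃ q, b ≤ q ∧ ∀ t, t < M → x (q + t) = x (p + t) := by
  obtain ⟨q, hq, h⟩ := h (p + M) b
  exact ⟨q + p, by omega, fun t ht => by rw [add_assoc, h _ (by omega)]⟩

lemma PrefixRecurrent.next_ret (h : PrefixRecurrent x) (N i : ℕ) : ∃ j, Ret x N i j := by
  have hex : ∃ j, i < j ∧ win x N j = win x N i := by
    obtain ⟨q, hq, h⟩ := h.factor i N (i + 1)
    exact ⟨q, by omega, win_congr h⟩
  classical
  refine ⟨Nat.find hex, (Nat.find_spec hex).1, (Nat.find_spec hex).2, fun k h1 h2 h3 => ?_⟩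
  exact Nat.find_min hex h2 ⟨h1, h3⟩

/-- The return around position `m` in a class that occurs at or before `m`. -/
lemma PrefixRecurrent.straddle (h : PrefixRecurrent x) {N i₀ m : ℕ} (hi : i₀ ≤ m) :
    ∃ i j, i₀ ≤ i ∧ i ≤ m ∧ m < j ∧ Ret x N i j ∧ win x N i = win x N i₀ := by
  classical
  have hP : ∃ i, i₀ ≤ i ∧ win x N i = win x N i₀ := ⟨i₀, le_rfl, rfl⟩
  let P : ℕ → Prop := fun i => i₀ ≤ i ∧ win x N i = win x N i₀
  have hs : P (Nat.findGreatest P m) := Nat.findGreatest_spec (P := P) hi ⟨le_rfl, rfl⟩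
  obtain ⟨j, hj⟩ := h.next_ret N (Nat.findGreatest P m)
  refine ⟨Nat.findGreatest P m, j, hs.1, Nat.findGreatest_le m, ?_, hj, hs.2⟩
  by_contra hc
  have := Nat.le_findGreatest (P := P) (n := m) (m := j) (by omega)
    ⟨by have := hj.1; have := hs.1; omega, hj.2.1.trans hs.2⟩
  have := hj.1
  omega

lemma Ret.of_succ {N i : ℕ} (h : x (i + N) = x i) : Ret x N i (i + 1) :=
  ⟨by omega, by rw [win_shift]; linarith, fun k h1 h2 => by omega⟩

/-- Working form of `AtMostThree`: a return enters through its length `l` and its number of ones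
`o`, and four returns to one class cannot be pairwise different in the pair `(l, o)`. -/
lemma AtMostThree.four (h : AtMostThree x) {N : ℕ} {c : ℤ} {i₀ i₁ i₂ i₃ j₀ j₁ j₂ j₃ : ℕ}
    {l₀ l₁ l₂ l₃ : ℕ} {o₀ o₁ o₂ o₃ : ℤ}
    (r₀ : Ret x N i₀ j₀) (c₀ : win x N i₀ = c) (d₀ : j₀ = i₀ + l₀) (e₀ : win x l₀ i₀ = o₀)
    (r₁ : Ret x N i₁ j₁) (c₁ : win x N i₁ = c) (d₁ : j₁ = i₁ + l₁) (e₁ : win x l₁ i₁ = o₁)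
    (r₂ : Ret x N i₂ j₂) (c₂ : win x N i₂ = c) (d₂ : j₂ = i₂ + l₂) (e₂ : win x l₂ i₂ = o₂)
    (r₃ : Ret x N i₃ j₃) (c₃ : win x N i₃ = c) (d₃ : j₃ = i₃ + l₃) (e₃ : win x l₃ i₃ = o₃)
    (h01 : l₀ = l₁ → o₀ = o₁ → False) (h02 : l₀ = l₂ → o₀ = o₂ → False)
    (h03 : l₀ = l₃ → o₀ = o₃ → False) (h12 : l₁ = l₂ → o₁ = o₂ → False)
    (h13 : l₁ = l₃ → o₁ = o₃ → False) (h23 : l₂ = l₃ → o₂ = o₃ → False) : False := by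
  subst d₀ d₁ d₂ d₃ e₀ e₁ e₂ e₃
  obtain ⟨a, b, hab, h1, h2⟩ := h N ![i₀, i₁, i₂, i₃] ![i₀ + l₀, i₁ + l₁, i₂ + l₂, i₃ + l₃]
    (by intro a; fin_cases a <;> assumption)
    (by intro a b; fin_cases a <;> fin_cases b <;> simp [c₀, c₁, c₂, c₃])
  fin_cases a <;> fin_cases b <;> simp [psum_eq] at hab h1 h2 <;>
    first
      | exact h01 h1 h2
      | exact h01 h1.symm h2.symm
      | exact h02 h1 h2
      | exact h02 h1.symm h2.symm
      | exact h03 h1 h2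
      | exact h03 h1.symm h2.symm
      | exact h12 h1 h2
      | exact h12 h1.symm h2.symm
      | exact h13 h1 h2
      | exact h13 h1.symm h2.symm
      | exact h23 h1 h2
      | exact h23 h1.symm h2.symm

/-- A word in which two distinct positions have the same future is ultimately periodic. -/
lemma IsAperiodic.ne_of_future {B : Type*} {x : ℕ → B} (h : IsAperiodic x) {a b : ℕ}
    (hab : ∀ t, x (a + t) = x (b + t)) : a = b := by
  by_contra hne
  rcases lt_or_gt_of_ne hne with hlt | hlt
  · refine h ⟨b - a, by omega, a, fun n hn => ?_⟩
    have := hab (n - a)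
    rw [show a + (n - a) = n by omega, show b + (n - a) = n + (b - a) by omega] at this
    exact this.symm
  · refine h ⟨a - b, by omega, b, fun n hn => ?_⟩
    have := hab (n - b)
    rw [show b + (n - b) = n by omega, show a + (n - b) = n + (a - b) by omega] at this
    exact this

/-! ### Exchanging the two letters -/

/-- The word with the letters `0` and `1` exchanged. -/
def swapLetters (x : ℕ → ℤ) : ℕ → ℤ := fun i => 1 - x i

lemma swapLetters_apply (x : ℕ → ℤ) (i : ℕ) : swapLetters x i = 1 - x i := rfl

lemma win_swapLetters (x : ℕ → ℤ) (N i : ℕ) : win (swapLetters x) N i = N - win x N i := by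
  induction N with
  | zero => simp [win_zero]
  | succ n ih => rw [win_succ, win_succ, ih, swapLetters]; push_cast; ring

lemma ret_swapLetters {N i j : ℕ} : Ret (swapLetters x) N i j ↔ Ret x N i j := by
  simp only [Ret, win_swapLetters, ne_eq, sub_right_inj]

lemma IsBinary.flip (h : IsBinary x) : IsBinary (swapLetters x) := fun i => by
  rcases h i with h | h <;> simp [swapLetters_apply, h]

lemma PrefixRecurrent.flip (h : PrefixRecurrent x) : PrefixRecurrent (swapLetters x) := fun M b => by
  obtain ⟨q, hq, h⟩ := h M b
  exact ⟨q, hq, fun t ht => by simp [swapLetters_apply, h t ht]⟩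

lemma IsAperiodic.flip (h : IsAperiodic x) : IsAperiodic (swapLetters x) := by
  rintro ⟨T, hT, n, hn⟩
  exact h ⟨T, hT, n, fun m hm => by have := hn m hm; simp only [swapLetters_apply] at this; linarith⟩

lemma AtMostThree.flip (h : AtMostThree x) : AtMostThree (swapLetters x) := by
  intro N i j h1 h2
  obtain ⟨a, b, hab, h3, h4⟩ := h N i j (fun a => ret_swapLetters.1 (h1 a))
    (fun a b => by have := h2 a b; simp only [win_swapLetters] at this; linarith)
  refine ⟨a, b, hab, h3, ?_⟩
  have key : ∀ a, psum (swapLetters x) (j a) - psum (swapLetters x) (i a) =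
      ((j a - i a : ℕ) : ℤ) - (psum x (j a) - psum x (i a)) := fun a => by
    have := win_swapLetters x (j a - i a) (i a)
    have hlt := (h1 a).1
    simpa [win, show i a + (j a - i a) = j a by omega] using this
  rw [key, key, h3, h4]

lemma Unbalanced.flip {k i j : ℕ} (h : Unbalanced x k i j) : Unbalanced (swapLetters x) k j i := by
  obtain ⟨h1, h2, h3, h4, h5⟩ := h
  exact ⟨by simp [swapLetters_apply, h3], by simp [swapLetters_apply, h4], by simp [swapLetters_apply, h1],
    by simp [swapLetters_apply, h2], fun t a b => by simp [swapLetters_apply, h5 t a b]⟩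

lemma swapLetters_swapLetters (x : ℕ → ℤ) : swapLetters (swapLetters x) = x := by ext; simp [swapLetters_apply]

/-! ### Balance -/

/-- Equal or favourable first letters are dropped. If the windows start with `0` and `1`, consider
the next disagreement: one in the opposite direction compensates the first, and the rest is shorter;
one in the same direction closes an unbalanced pair of length below `L`. -/
lemma IsBinary.win_sub_le (hx : IsBinary x) {L : ℕ}
    (hno : ∀ k, 0 < k → k < L → ∀ i j, ¬ Unbalanced x k i j) (n : ℕ) (hn : n ≤ L) (i j : ℕ) :
    win x n j - win x n i ≤ 1 := by
  induction n using Nat.strong_induction_on generalizing i j with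
  | _ n ih =>
    rcases n with _ | n
    · simp [win_zero]
    by_cases h0 : x j - x i ≤ 0
    · have := ih n (by omega) (by omega) (i + 1) (j + 1)
      rw [win_succ', win_succ']; linarith
    have hj : x j = 1 := by rcases hx i with h | h <;> rcases hx j with h' | h' <;> omega
    have hi : x i = 0 := by rcases hx i with h | h <;> rcases hx j with h' | h' <;> omega
    by_cases hall : ∀ t, t < n → x (i + 1 + t) = x (j + 1 + t)
    · rw [win_succ', win_succ', win_congr hall]; linarith
    push Not at hall
    classical
    obtain ⟨ht, hne⟩ := Nat.find_spec hall
    have hmin := fun t (h : t < Nat.find hall) => Nat.find_min hall h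
    set t := Nat.find hall
    have heq : ∀ s, s < t → x (i + 1 + s) = x (j + 1 + s) := fun s hs => by
      have := hmin s hs
      push Not at this
      exact this (by omega)
    rcases hx (j + 1 + t) with h | h
    · have h' : x (i + 1 + t) = 1 := by rcases hx (i + 1 + t) with h' | h' <;> omega
      have := ih (n - t - 1) (by omega) (by omega) (i + 1 + t + 1) (j + 1 + t + 1)
      rw [show n + 1 = 1 + (t + (1 + (n - t - 1))) by omega]
      simp only [win_add, win_one, h, h', hi, hj, win_congr heq]
      linarith
    · have h' : x (i + 1 + t) = 0 := by rcases hx (i + 1 + t) with h' | h' <;> omega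
      refine absurd ⟨hi, by rw [← h']; congr 1; omega, hj, by rw [← h]; congr 1; omega, ?_⟩
        (hno (t + 1) (by omega) (by omega) i j)
      intro s hs1 hs2
      have := heq (s - 1) (by omega)
      rwa [show i + 1 + (s - 1) = i + s by omega, show j + 1 + (s - 1) = j + s by omega] at this

end AbelianReturns

/-! ### Balanced words have at most three returns -/

namespace AbelianReturns
variable {x : ℕ → ℤ}

/-- The words `x i, …, x (j - 1)` and `x i', …, x (j' - 1)` are equal. -/
def SameWord {B : Type*} (x : ℕ → B) (i j i' j' : ℕ) : Prop :=
  j - i = j' - i' ∧ ∀ t, t < j - i → x (i + t) = x (i' + t)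

lemma IsBalanced.flip (hb : IsBalanced x) : IsBalanced (swapLetters x) := fun n i j => by
  have := hb n j i
  simp only [win_swapLetters]; linarith

lemma IsBalanced.not_unbalanced (hb : IsBalanced x) {k i j : ℕ} (hk : 0 < k) :
    ¬ Unbalanced x k i j := by
  rintro ⟨h1, h2, h3, h4, h5⟩
  obtain ⟨m, rfl⟩ : ∃ m, k = m + 1 := ⟨k - 1, by omega⟩
  have := hb (m + 1 + 1) i j
  rw [win_succ, win_succ x (m + 1) i, win_succ', win_succ' x m i, h1, h2, h3, h4,
    win_congr (i := i + 1) (j := j + 1) (fun t ht => by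
      have := h5 (t + 1) (by omega) (by omega)
      rwa [show i + 1 + t = i + (t + 1) by omega, show j + 1 + t = j + (t + 1) by omega])] at this
  omega

/-- A return of length `b + 2 ≥ 2` to the lower of two abelian classes `c < c + 1`: it has the form
`0 B 1` and is accompanied by `1 B 0` at distance `N`. -/
structure LongRet (x : ℕ → ℤ) (N : ℕ) (c : ℤ) (i b : ℕ) : Prop where
  cls : win x N i = c
  first : x i = 0
  first' : x (i + N) = 1
  last : x (i + 1 + b) = 1
  last' : x (i + 1 + b + N) = 0
  up : ∀ t, t ≤ b → win x N (i + 1 + t) = c + 1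
  mid : ∀ t, t < b → x (i + 1 + t + N) = x (i + 1 + t)

/-- With only the counts `c` and `c + 1` available, a return longer than a letter steps up at once,
stays up, and steps down at its last letter. A step without change means equal letters at distance
`N`. -/
lemma Ret.longRet (hx : IsBinary x) {N : ℕ} {c : ℤ} (hup : ∀ i, win x N i = c ∨ win x N i = c + 1)
    {i j : ℕ} (h : Ret x N i j) (hc : win x N i = c) (hij : i + 1 < j) :
    LongRet x N c i (j - i - 2) := by
  obtain ⟨h1, h2, h3⟩ := h
  have up : ∀ t, t ≤ j - i - 2 → win x N (i + 1 + t) = c + 1 := fun t ht => by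
    rcases hup (i + 1 + t) with h | h
    · exact absurd (h.trans hc.symm) (h3 _ (by omega) (by omega))
    · exact h
  have s1 := win_shift x N i
  have s2 := win_shift x N (i + 1 + (j - i - 2))
  rw [show i + 1 + (j - i - 2) + 1 = j by omega, h2, hc, up _ le_rfl] at s2
  have u0 := up 0 (by omega)
  rw [add_zero] at u0
  rw [hc, u0] at s1
  refine ⟨hc, ?_, ?_, ?_, ?_, up, fun t ht => ?_⟩
  · rcases hx i with h | h <;> rcases hx (i + N) with h' | h' <;> omega
  · rcases hx i with h | h <;> rcases hx (i + N) with h' | h' <;> omega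
  · rcases hx (i + 1 + (j - i - 2)) with h | h <;>
      rcases hx (i + 1 + (j - i - 2) + N) with h' | h' <;> omega
  · rcases hx (i + 1 + (j - i - 2)) with h | h <;>
      rcases hx (i + 1 + (j - i - 2) + N) with h' | h' <;> omega
  · have s := win_shift x N (i + 1 + t)
    rw [up t ht.le, show i + 1 + t + 1 = i + 1 + (t + 1) by omega, up (t + 1) ht] at s
    linarith

namespace LongRet
variable {N : ℕ} {c : ℤ} {i b i' b' i₁ b₁ e : ℕ}

/-- A first disagreement after `0` in one return and after the `1` of the shifted copy `1B0` of the
other would close an unbalanced pair. -/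
lemma prefix_eq (hx : IsBinary x) (hb : IsBalanced x) (r : LongRet x N c i b)
    (r' : LongRet x N c i' b') (hbb : b ≤ b') (t : ℕ) (ht : t < b) :
    x (i + 1 + t) = x (i' + 1 + t) := by
  induction t using Nat.strong_induction_on with
  | _ t ih =>
    by_contra hne
    rcases hx (i + 1 + t) with h | h
    · have h' : x (i' + 1 + t) = 1 := by rcases hx (i' + 1 + t) with h' | h' <;> omega
      refine hb.not_unbalanced (k := t + 1) (i := i) (j := i' + N) (by omega)
        ⟨r.first, by rw [← h]; congr 1; omega, r'.first', ?_, fun s h1 h2 => ?_⟩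
      · rw [← h', ← r'.mid t (by omega)]; congr 1; omega
      · have e1 := ih (s - 1) (by omega) (by omega)
        rw [← r'.mid (s - 1) (by omega)] at e1
        rw [show i + s = i + 1 + (s - 1) by omega, e1]; congr 1; omega
    · have h' : x (i' + 1 + t) = 0 := by rcases hx (i' + 1 + t) with h' | h' <;> omega
      refine hb.not_unbalanced (k := t + 1) (i := i') (j := i + N) (by omega)
        ⟨r'.first, by rw [← h']; congr 1; omega, r.first', ?_, fun s h1 h2 => ?_⟩
      · rw [← h, ← r.mid t (by omega)]; congr 1; omega
      · have e1 := ih (s - 1) (by omega) (by omega)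
        rw [← r.mid (s - 1) (by omega)] at e1
        rw [show i' + s = i' + 1 + (s - 1) by omega, ← e1]; congr 1; omega

/-- The mirror argument of `prefix_eq`, read backwards from the final `1` of one return and the
final `0` of the shifted copy of the other. -/
lemma suffix_eq (hx : IsBinary x) (hb : IsBalanced x) (r : LongRet x N c i b)
    (r' : LongRet x N c i' b') (hbb : b ≤ b') (t : ℕ) (ht : t < b) :
    x (i + b - t) = x (i' + b' - t) := by
  induction t using Nat.strong_induction_on with
  | _ t ih =>
    have m : ∀ s, s < b → x (i + b - s + N) = x (i + b - s) := fun s hs => by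
      have := r.mid (b - 1 - s) (by omega)
      rwa [show i + 1 + (b - 1 - s) = i + b - s by omega] at this
    have m' : ∀ s, s < b → x (i' + b' - s + N) = x (i' + b' - s) := fun s hs => by
      have := r'.mid (b' - 1 - s) (by omega)
      rwa [show i' + 1 + (b' - 1 - s) = i' + b' - s by omega] at this
    by_contra hne
    rcases hx (i + b - t) with h | h
    · have h' : x (i' + b' - t) = 1 := by rcases hx (i' + b' - t) with h' | h' <;> omega
      refine hb.not_unbalanced (k := t + 1) (i := i + b - t + N) (j := i' + b' - t) (by omega)
        ⟨by rw [m t ht, h], ?_, h', ?_, fun s h1 h2 => ?_⟩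
      · rw [← r.last']; congr 1; omega
      · rw [← r'.last]; congr 1; omega
      · have e1 := ih (t - s) (by omega) (by omega)
        rw [← m (t - s) (by omega)] at e1
        rw [show i' + b' - t + s = i' + b' - (t - s) by omega, ← e1]; congr 1; omega
    · have h' : x (i' + b' - t) = 0 := by rcases hx (i' + b' - t) with h' | h' <;> omega
      refine hb.not_unbalanced (k := t + 1) (i := i' + b' - t + N) (j := i + b - t) (by omega)
        ⟨by rw [m' t ht, h'], ?_, h, ?_, fun s h1 h2 => ?_⟩
      · rw [← r'.last']; congr 1; omega
      · rw [← r.last]; congr 1; omega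
      · have e1 := ih (t - s) (by omega) (by omega)
        rw [← m' (t - s) (by omega)] at e1
        rw [show i + b - t + s = i + b - (t - s) by omega, e1]; congr 1; omega

/-- Compare the windows starting with `0B0` at `e` and with `0B1` at `i`. After these beginnings the
remainder at `e` has two ones more than the remainder at `i`. If the windows are too short to reach
the last letter they coincide, against their different classes. -/
lemma cut_zero (hb : IsBalanced x) (r : LongRet x N c i b) (he : win x N e = c + 1)
    (hE : ∀ t, t < b → x (e + 1 + t) = x (i + 1 + t)) (h0 : x e = 0) (h1 : x (e + 1 + b) = 0) :
    False := by
  have hc := r.cls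
  have hw : win x (1 + b) e = win x (1 + b) i := by
    rw [win_add, win_add, win_one, win_one, h0, r.first, win_congr hE]
  rcases Nat.lt_or_ge (1 + b) N with h | h
  · have := hb (N - (1 + b) - 1) (i + (1 + b) + 1) (e + (1 + b) + 1)
    have hN : N = 1 + b + (1 + (N - (1 + b) - 1)) := by omega
    rw [hN, win_add x (1 + b), win_add x 1 (N - (1 + b) - 1), win_one, ← add_assoc e, h1] at he
    rw [hN, win_add x (1 + b), win_add x 1 (N - (1 + b) - 1), win_one, ← add_assoc i, r.last] at hc
    rw [← add_assoc, ← add_assoc] at this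
    linarith
  · have : win x N e = win x N i := win_congr fun t ht => by
      rcases t with _ | t
      · simpa using h0.trans r.first.symm
      · have := hE t (by omega)
        rwa [show e + (t + 1) = e + 1 + t by omega, show i + (t + 1) = i + 1 + t by omega]
    linarith

/-- Windows of length `N + b + 2`: at `e` the upper window is followed by a copy of `1B1`, at `i`
the lower one is followed by `1B0`. The counts differ by two. -/
lemma cut_one (hb : IsBalanced x) (r : LongRet x N c i b) (he : win x N e = c + 1)
    (hE : ∀ t, t < b → x (e + 1 + t) = x (i + 1 + t)) (h0 : x e = 1) (h1 : x (e + 1 + b) = 1)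
    (hN : ∀ t, t < 1 + (b + 1) → x (e + N + t) = x (e + t)) : False := by
  have := hb (N + (1 + (b + 1))) i e
  rw [win_add x N, win_add x N, he, r.cls, win_congr hN] at this
  have e1 : win x (1 + (b + 1)) e = 1 + win x b (e + 1) + 1 := by
    rw [win_add, win_one, win_succ, h0, h1]; ring
  have e2 : win x (1 + (b + 1)) (i + N) = 1 + win x b (e + 1) + 0 := by
    rw [win_add, win_one, win_succ, r.first', ← r.last', win_congr (i := e + 1) hE,
      show i + N + 1 + b = i + 1 + b + N by omega,
      win_congr (i := i + N + 1) (j := i + 1) fun t ht => by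
        rw [← r.mid t ht]; congr 1; omega]
    ring
  linarith

/-- The prefix of length `b'` of the longest word ends with a copy of the shortest `B`. Let `χ` be
the common letter after both cuts and `y` the letter before that copy. If `y = χ`, the word `χBχ`
sits in the upper class and `cut_zero` or `cut_one` applies. If `y ≠ χ`, the beginning of the
longest return and the end of the middle one, or their copies at distance `N`, form an unbalanced
pair around `B`. -/
lemma cut_unique (hx : IsBinary x) (hb : IsBalanced x) (r : LongRet x N c i b)
    (r' : LongRet x N c i' b') (r₁ : LongRet x N c i₁ b₁) (h1 : b < b') (h2 : b' < b₁)
    (heq : x (i₁ + 1 + b) = x (i₁ + 1 + b')) : False := by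
  have p1 := r.prefix_eq hx hb r₁ (by omega)
  have p2 := r'.prefix_eq hx hb r₁ (by omega)
  have s := r.suffix_eq hx hb r' (by omega)
  have hye : x (i₁ + b' - b) = x (i' + b' - b) := by
    have := p2 (b' - b - 1) (by omega)
    rw [show i' + 1 + (b' - b - 1) = i' + b' - b by omega,
      show i₁ + 1 + (b' - b - 1) = i₁ + b' - b by omega] at this
    exact this.symm
  have hE : ∀ t, t < b → x (i₁ + b' - b + 1 + t) = x (i + 1 + t) := fun t ht => by
    have e1 := s (b - 1 - t) (by omega)
    have e2 := p2 (b' - 1 - (b - 1 - t)) (by omega)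
    rw [show i' + 1 + (b' - 1 - (b - 1 - t)) = i' + b' - (b - 1 - t) by omega, ← e1,
      show i + b - (b - 1 - t) = i + 1 + t by omega] at e2
    rw [e2]; congr 1; omega
  have hup := r₁.up (b' - b - 1) (by omega)
  rw [show i₁ + 1 + (b' - b - 1) = i₁ + b' - b by omega] at hup
  have hmidB : ∀ u, 0 < u → u < b + 1 → x (i₁ + u) = x (i' + b' - b + u) := fun u hu1 hu2 => by
    have e1 := p1 (u - 1) (by omega)
    have e2 := s (b - u) (by omega)
    rw [show i + b - (b - u) = i + 1 + (u - 1) by omega, e1,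
      show i₁ + 1 + (u - 1) = i₁ + u by omega] at e2
    rw [e2]; congr 1; omega
  rcases hx (i₁ + 1 + b) with hχ | hχ
  · rcases hx (i₁ + b' - b) with hy | hy
    · refine r.cut_zero hb hup hE hy ?_
      rw [← hχ, heq]; congr 1; omega
    · refine hb.not_unbalanced (k := b + 1) (i := i₁) (j := i' + b' - b) (by omega)
        ⟨r₁.first, by rw [← hχ]; congr 1; omega, by rw [← hye, hy], ?_, hmidB⟩
      rw [← r'.last]; congr 1; omega
  · rcases hx (i₁ + b' - b) with hy | hy
    · refine hb.not_unbalanced (k := b + 1) (i := i' + b' - b + N) (j := i₁ + N) (by omega)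
        ⟨?_, ?_, r₁.first', ?_, fun u hu1 hu2 => ?_⟩
      · have := r'.mid (b' - b - 1) (by omega)
        rw [show i' + 1 + (b' - b - 1) = i' + b' - b by omega] at this
        rw [this, ← hye, hy]
      · rw [← r'.last']; congr 1; omega
      · rw [← hχ, ← r₁.mid b (by omega)]; congr 1; omega
      · have e1 := r₁.mid (u - 1) (by omega)
        have e2 := r'.mid (b' - b + u - 1) (by omega)
        rw [show i₁ + 1 + (u - 1) = i₁ + u by omega] at e1
        rw [show i' + 1 + (b' - b + u - 1) = i' + b' - b + u by omega] at e2
        rw [show i₁ + N + u = i₁ + u + N by omega,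
          show i' + b' - b + N + u = i' + b' - b + u + N by omega, e1, e2, hmidB u hu1 hu2]
    · refine r.cut_one hb hup hE hy (by rw [← hχ, heq]; congr 1; omega) fun t ht => ?_
      have := r₁.mid (b' - b - 1 + t) (by omega)
      rw [show i₁ + 1 + (b' - b - 1 + t) = i₁ + b' - b + t by omega] at this
      rw [← this]; congr 1; omega

end LongRet

section
variable {N : ℕ} {c : ℤ} {i₀ e : ℕ}

/-- Removing the first letters leaves windows whose counts differ by two. -/
lemma letter_one_excludes (hb : IsBalanced x) (h0 : win x N i₀ = c) (h1 : x i₀ = 1)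
    (he : win x N e = c + 1) (h2 : x e = 0) : False := by
  rcases N with _ | N
  · rw [win_zero] at *; omega
  · have := hb N (i₀ + 1) (e + 1)
    rw [win_succ'] at h0 he
    linarith

lemma letter_zero_excludes (hb : IsBalanced x) (h0 : win x N i₀ = c) (h1 : x (i₀ + N) = 0)
    (he : win x N e = c + 1) (h2 : x (e + N) = 1) : False := by
  have := hb (N + 1) i₀ e
  rw [win_succ, win_succ] at this
  linarith

lemma sameWord_of_length (hx : IsBinary x) (hb : IsBalanced x)
    (hup : ∀ i, win x N i = c ∨ win x N i = c + 1) {i j i' j' : ℕ} (h : Ret x N i j)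
    (h' : Ret x N i' j') (hc : win x N i = c) (hc' : win x N i' = c) (hij : i + 1 < j)
    (hl : j - i = j' - i') : SameWord x i j i' j' := by
  have r := h.longRet hx hup hc hij
  have r' := h'.longRet hx hup hc' (by omega)
  refine ⟨hl, fun t ht => ?_⟩
  rcases t with _ | t
  · simpa using r.first.trans r'.first.symm
  · rw [show i + (t + 1) = i + 1 + t by omega, show i' + (t + 1) = i' + 1 + t by omega]
    by_cases h : t < j - i - 2
    · exact r.prefix_eq hx hb r' (by omega) t h
    · have := r.last
      have := r'.last
      rw [← hl] at this
      obtain rfl : t = j - i - 2 := by omega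
      linarith

lemma sameWord_of_type (hx : IsBinary x) (hb : IsBalanced x)
    (hup : ∀ i, win x N i = c ∨ win x N i = c + 1) {i j i' j' : ℕ} (h : Ret x N i j)
    (h' : Ret x N i' j') (hc : win x N i = c) (hc' : win x N i' = c)
    (hl : j - i = j' - i') (ho : psum x j - psum x i = psum x j' - psum x i') :
    SameWord x i j i' j' := by
  by_cases hij : i + 1 < j
  · exact sameWord_of_length hx hb hup h h' hc hc' hij hl
  · have := h.1
    have := h'.1
    obtain rfl : j = i + 1 := by omega
    obtain rfl : j' = i' + 1 := by omega
    rw [psum_succ, psum_succ] at ho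
    refine ⟨hl, fun t ht => ?_⟩
    obtain rfl : t = 0 := by omega
    simp only [add_zero]; linarith

lemma exists_sameWord_of_up (hx : IsBinary x) (hb : IsBalanced x)
    (hup : ∀ i, win x N i = c ∨ win x N i = c + 1) (i j : Fin 4 → ℕ)
    (h : ∀ a, Ret x N (i a) (j a)) (hc : ∀ a, win x N (i a) = c) :
    ∃ a b, a ≠ b ∧ SameWord x (i a) (j a) (i b) (j b) := by
  classical
  obtain ⟨m, hm⟩ := Finite.exists_max (fun a => j a - i a)
  -- Label `2` is the maximal length. A shorter long return is a cut of the longest one and is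
  -- labelled by the letter after the cut. The return `0` receives the label of the letter `1` and
  -- the return `1` that of `0`, because these are the cuts they exclude.
  let χ : Fin 4 → Fin 3 := fun a =>
    if j a = i a + 1 then (if x (i a) = 0 then 1 else 0)
    else if j a - i a = j m - i m then 2
    else if x (i m + 1 + (j a - i a - 2)) = 0 then 0 else 1
  obtain ⟨a, b, hab, hχ⟩ := Fintype.exists_ne_map_eq_of_card_lt χ (by simp)
  have hlt : ∀ a, i a < j a := fun a => (h a).1
  have long : ∀ a, j a ≠ i a + 1 → LongRet x N c (i a) (j a - i a - 2) := fun a ha =>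
    (h a).longRet hx hup (hc a) (by have := hlt a; omega)
  have mlong : ∀ a, j a ≠ i a + 1 → LongRet x N c (i m) (j m - i m - 2) := fun a ha =>
    long m (by have := hm a; have := hlt a; omega)
  -- a letter return and a cut with the same category exclude each other
  have mixed : ∀ a b, j a = i a + 1 → j b ≠ i b + 1 → χ a = χ b → False := by
    intro a b ha hb' hχ
    have hmb := hm b
    have hbl := hlt b
    simp only [χ, if_pos ha, if_neg hb'] at hχ
    have hsa : x (i a + N) = x (i a) := by
      have s := win_shift x N (i a)
      have := (h a).2.1
      rw [← ha, this] at s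
      linarith
    by_cases hl : j b - i b = j m - i m
    · rw [if_pos hl] at hχ
      split_ifs at hχ <;> simp at hχ
    · rw [if_neg hl] at hχ
      have rm := mlong b hb'
      have hin : j b - i b - 2 < j m - i m - 2 := by omega
      have hcls := rm.up _ hin.le
      have hmid := rm.mid _ hin
      rcases hx (i a) with h0 | h1
      · rw [if_pos h0] at hχ
        have h1 : x (i m + 1 + (j b - i b - 2)) = 1 := by
          rcases hx (i m + 1 + (j b - i b - 2)) with h | h
          · rw [if_pos h] at hχ; simp at hχ
          · exact h
        exact letter_zero_excludes hb (hc a) (hsa.trans h0) hcls (hmid.trans h1)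
      · rw [if_neg (by omega)] at hχ
        have h0 : x (i m + 1 + (j b - i b - 2)) = 0 := by
          by_contra h
          rw [if_neg h] at hχ; simp at hχ
        exact letter_one_excludes hb (hc a) h1 hcls h0
  have cuts : ∀ a b, j a ≠ i a + 1 → j b ≠ i b + 1 → χ a = χ b → j a - i a < j b - i b →
      False := by
    intro a b ha hb' hχ hl
    have hmb := hm b
    have hal := hlt a
    simp only [χ, if_neg ha, if_neg hb'] at hχ
    rw [if_neg (by omega)] at hχ
    by_cases hlb : j b - i b = j m - i m
    · rw [if_pos hlb] at hχ
      split_ifs at hχ <;> simp at hχ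
    · rw [if_neg hlb] at hχ
      refine (long a ha).cut_unique hx hb (long b hb') (mlong a ha) (by omega) (by omega) ?_
      rcases hx (i m + 1 + (j a - i a - 2)) with h1 | h1 <;>
        rcases hx (i m + 1 + (j b - i b - 2)) with h2 | h2 <;>
        simp [h1, h2] at hχ ⊢
  refine ⟨a, b, hab, ?_⟩
  by_cases ha : j a = i a + 1 <;> by_cases hb' : j b = i b + 1
  · refine ⟨by omega, fun t ht => ?_⟩
    obtain rfl : t = 0 := by omega
    simp only [χ, if_pos ha, if_pos hb'] at hχ
    rcases hx (i a) with h1 | h1 <;> rcases hx (i b) with h2 | h2 <;> simp [h1, h2] at hχ ⊢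
  · exact (mixed a b ha hb' hχ).elim
  · exact (mixed b a hb' ha hχ.symm).elim
  · refine sameWord_of_length hx hb hup (h a) (h b) (hc a) (hc b)
      (by have := hlt a; omega) ?_
    rcases lt_trichotomy (j a - i a) (j b - i b) with hl | hl | hl
    · exact (cuts a b ha hb' hχ hl).elim
    · exact hl
    · exact (cuts b a hb' ha hχ.symm hl).elim

end

lemma SameWord.of_flip {i j i' j' : ℕ} (h : SameWord (swapLetters x) i j i' j') : SameWord x i j i' j' :=
  ⟨h.1, fun t ht => by have := h.2 t ht; simp only [swapLetters_apply] at this; linarith⟩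

/-- Up to exchanging the letters, a class of a balanced word is the lower one of two. -/
lemma IsBalanced.up_or_down (hb : IsBalanced x) (N i₀ : ℕ) :
    (∀ i, win x N i = win x N i₀ ∨ win x N i = win x N i₀ + 1) ∨
    (∀ i, win (swapLetters x) N i = win (swapLetters x) N i₀ ∨ win (swapLetters x) N i = win (swapLetters x) N i₀ + 1) := by
  by_cases h : ∃ j, win x N j = win x N i₀ + 1
  · obtain ⟨j, hj⟩ := h
    left
    intro i
    have h1 := hb N i j
    have h2 := hb N i₀ i
    omega
  · right
    intro i
    push Not at h
    have h1 := hb N i₀ i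
    have h2 := hb N i i₀
    have h3 := h i
    simp only [win_swapLetters]
    omega

theorem IsBalanced.exists_sameWord (hx : IsBinary x) (hb : IsBalanced x) {N : ℕ} {c : ℤ}
    (i j : Fin 4 → ℕ) (h : ∀ a, Ret x N (i a) (j a)) (hc : ∀ a, win x N (i a) = c) :
    ∃ a b, a ≠ b ∧ SameWord x (i a) (j a) (i b) (j b) := by
  rcases hb.up_or_down N (i 0) with hup | hup
  · exact exists_sameWord_of_up hx hb hup i j h fun a => by rw [hc, hc]
  · obtain ⟨a, b, hab, hs⟩ := exists_sameWord_of_up hx.flip hb.flip hup i j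
      (fun a => ret_swapLetters.2 (h a)) fun a => by rw [win_swapLetters, win_swapLetters, hc, hc]
    exact ⟨a, b, hab, hs.of_flip⟩

theorem IsBalanced.sameWord_of_type (hx : IsBinary x) (hb : IsBalanced x) {N : ℕ}
    {i j i' j' : ℕ} (h : Ret x N i j) (h' : Ret x N i' j') (hc : win x N i' = win x N i)
    (hl : j - i = j' - i') (ho : psum x j - psum x i = psum x j' - psum x i') :
    SameWord x i j i' j' := by
  rcases hb.up_or_down N i with hup | hup
  · exact AbelianReturns.sameWord_of_type hx hb hup h h' rfl hc hl ho
  · have h1 := h.1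
    have h2 := h'.1
    refine (AbelianReturns.sameWord_of_type hx.flip hb.flip hup (ret_swapLetters.2 h) (ret_swapLetters.2 h') rfl
      (by rw [win_swapLetters, win_swapLetters, hc]) hl ?_).of_flip
    have w1 := win_swapLetters x (j - i) i
    have w2 := win_swapLetters x (j' - i') i'
    simp only [win, show i + (j - i) = j by omega, show i' + (j' - i') = j' by omega] at w1 w2
    rw [w1, w2, hl]; linarith

/-- If all returns in a class are the same word, then the word is ultimately periodic. -/
theorem PrefixRecurrent.exists_not_sameWord (hr : PrefixRecurrent x) (ha : IsAperiodic x)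
    (N i₀ : ℕ) : ∃ i j i' j', Ret x N i j ∧ Ret x N i' j' ∧ win x N i = win x N i₀ ∧
      win x N i' = win x N i₀ ∧ ¬ SameWord x i j i' j' := by
  by_contra hno
  push Not at hno
  -- Since all returns agree, two occurrences of the class read the same return and arrive again at
  -- occurrences of the class.
  have fut : ∀ t p q, win x N p = win x N i₀ → win x N q = win x N i₀ → x (p + t) = x (q + t) := by
    intro t
    induction t using Nat.strong_induction_on with
    | _ t ih =>
      intro p q hp hq
      obtain ⟨p', hp'⟩ := hr.next_ret N p
      obtain ⟨q', hq'⟩ := hr.next_ret N q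
      obtain ⟨h1, h2⟩ := hno _ _ _ _ hp' hq' hp hq
      have := hp'.1
      have := hq'.1
      rcases Nat.lt_or_ge t (p' - p) with ht | ht
      · exact h2 t ht
      · have := ih (t - (p' - p)) (by omega) p' q' (hp'.2.1.trans hp) (hq'.2.1.trans hq)
        rwa [show p' + (t - (p' - p)) = p + t by omega,
          show q' + (t - (p' - p)) = q + t by omega] at this
  obtain ⟨j, hj⟩ := hr.next_ret N i₀
  have := ha.ne_of_future (a := i₀) (b := j) fun t => fut t _ _ rfl hj.2.1
  have := hj.1
  omega

end AbelianReturns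

/-! ### Right special factors; balanced aperiodic words are Sturmian -/

namespace AbelianReturns
variable {x : ℕ → ℤ}

/-- The factor of length `n` at position `i`, as a function. -/
def window {B : Type*} (x : ℕ → B) (n i : ℕ) : Fin n → B := fun t => x (i + t)

lemma window_eq_iff {B : Type*} {x : ℕ → B} {n i j : ℕ} :
    window x n i = window x n j ↔ ∀ t, t < n → x (i + t) = x (j + t) :=
  ⟨fun h t ht => congrFun h ⟨t, ht⟩, fun h => funext fun t => h t t.2⟩

lemma factorAt_eq_ofFn {B : Type*} (x : ℕ → B) (i n : ℕ) :
    factorAt x i n = List.ofFn (window x n i) := rfl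

lemma complexity_eq {B : Type*} (x : ℕ → B) (n : ℕ) :
    complexity x n = (Set.range (window x n)).ncard := by
  have : {u : List B | u.length = n ∧ IsFactor x u} = List.ofFn '' Set.range (window x n) := by
    ext u
    constructor
    · rintro ⟨rfl, i, hi⟩
      exact ⟨_, ⟨i, rfl⟩, hi⟩
    · rintro ⟨_, ⟨i, rfl⟩, rfl⟩
      refine ⟨by simp, i, ?_⟩
      rw [List.length_ofFn, factorAt_eq_ofFn]
  rw [complexity, this, Set.ncard_image_of_injective _ List.ofFn_injective]

lemma complexity_comp {B C : Type*} (x : ℕ → B) (φ : B → C)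
    (hφ : ∀ i j, φ (x i) = φ (x j) → x i = x j) (n : ℕ) :
    complexity (fun i => φ (x i)) n = complexity x n := by
  rw [complexity_eq, complexity_eq]
  have : Set.range (window (fun i => φ (x i)) n) = (fun v => φ ∘ v) '' Set.range (window x n) := by
    rw [← Set.range_comp]; rfl
  rw [this, Set.InjOn.ncard_image]
  rintro _ ⟨i, rfl⟩ _ ⟨j, rfl⟩ h
  exact funext fun t => hφ _ _ (congrFun h t)

/-- The factor of length `n` at `i` has two different continuations. -/
def RightSpecial {B : Type*} (x : ℕ → B) (n i : ℕ) : Prop :=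
  ∃ j, window x n j = window x n i ∧ x (j + n) ≠ x (i + n)

lemma RightSpecial.congr {B : Type*} {x : ℕ → B} {n i i' : ℕ} (h : RightSpecial x n i)
    (hw : window x n i = window x n i') : RightSpecial x n i' := by
  obtain ⟨j, h1, h2⟩ := h
  by_cases h : x (j + n) = x (i' + n)
  · exact ⟨i, hw, fun h' => h2 (h.trans h'.symm)⟩
  · exact ⟨j, h1.trans hw, h⟩

/-- While no right special factor is met, equal windows have equal successors. Checking the
positions from `a` up to `b` is enough, because afterwards the windows repeat with period `b - a`.
-/
lemma future_of_not_rightSpecial {B : Type*} {x : ℕ → B} {n a b : ℕ} (hab : a < b)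
    (hw : window x n a = window x n b) (h : ∀ t, t < b - a → ¬ RightSpecial x n (a + t)) (t : ℕ) :
    x (a + t) = x (b + t) := by
  have key : ∀ t, window x n (a + t) = window x n (b + t) ∧ ¬ RightSpecial x n (a + t) := by
    intro t
    induction t using Nat.strong_induction_on with
    | _ t ih =>
      have hwt : window x n (a + t) = window x n (b + t) := by
        rcases t with _ | t
        · exact hw
        · obtain ⟨h1, h2⟩ := ih t (by omega)
          have hl : x (a + t + n) = x (b + t + n) := by
            by_contra hne
            exact h2 ⟨b + t, h1.symm, fun h => hne h.symm⟩
          rw [window_eq_iff] at h1 ⊢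
          intro s hs
          by_cases hsn : s + 1 < n
          · have := h1 (s + 1) hsn
            rwa [show a + (t + 1) + s = a + t + (s + 1) by omega,
              show b + (t + 1) + s = b + t + (s + 1) by omega]
          · rwa [show a + (t + 1) + s = a + t + n by omega,
              show b + (t + 1) + s = b + t + n by omega]
      refine ⟨hwt, ?_⟩
      by_cases ht : t < b - a
      · exact h t ht
      · obtain ⟨h1, h2⟩ := ih (t - (b - a)) (by omega)
        rw [show b + (t - (b - a)) = a + t by omega] at h1
        exact fun h => h2 (h.congr h1.symm)
  by_contra hne
  have h1 := (key t).1
  rcases n with _ | n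
  -- For `n = 0` the window does not show the letter, but two different letters would make the empty
  -- word right special.
  · exact (key t).2 ⟨b + t, by ext s; exact s.elim0, fun h => hne h.symm⟩
  · rw [window_eq_iff] at h1
    exact hne (h1 0 (by omega))

lemma IsAperiodic.exists_rightSpecial {B : Type*} {x : ℕ → B} (ha : IsAperiodic x) (n : ℕ)
    (hf : (Set.range (window x n)).Finite) : ∃ i, RightSpecial x n i := by
  by_contra hno
  push Not at hno
  obtain ⟨a, -, b, -, hne, hab⟩ := Set.infinite_univ.exists_ne_map_eq_of_mapsTo
    (f := window x n) (fun i _ => Set.mem_range_self i) hf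
  rcases lt_or_gt_of_ne hne with h | h
  · exact hne (ha.ne_of_future fun t => future_of_not_rightSpecial h hab (fun _ _ => hno _) t)
  · exact hne (ha.ne_of_future fun t =>
      future_of_not_rightSpecial h hab.symm (fun _ _ => hno _) t).symm

/-- If the complexity grows by at most one, there is at most one right special factor. -/
lemma RightSpecial.unique {B : Type*} {x : ℕ → B} {n : ℕ}
    (hf : (Set.range (window x (n + 1))).Finite)
    (hC : (Set.range (window x (n + 1))).ncard ≤ (Set.range (window x n)).ncard + 1)
    {i i' : ℕ} (h : RightSpecial x n i) (h' : RightSpecial x n i') :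
    window x n i = window x n i' := by
  by_contra hne
  let π : (Fin (n + 1) → B) → (Fin n → B) := fun v t => v t.castSucc
  have hsel : ∀ v : Set.range (window x n), ∃ p, window x n p = v := fun v => v.2
  choose pos hpos using hsel
  -- `σ` chooses one extension of each factor of length `n`. Every right special factor has a
  -- further extension outside the range of `σ`, so two of them would raise the complexity by at
  -- least two.
  let σ : Set.range (window x n) → (Fin (n + 1) → B) := fun v => window x (n + 1) (pos v)
  have hπσ : ∀ v, π (σ v) = v := fun v => hpos v
  have hσ : Function.Injective σ := fun a b hab => by
    have := congrArg π hab
    rw [hπσ, hπσ] at this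
    exact Subtype.ext this
  have hext : ∀ i, RightSpecial x n i →
      ∃ j, π (window x (n + 1) j) = window x n i ∧ window x (n + 1) j ∉ Set.range σ := by
    rintro i ⟨j, h1, h2⟩
    by_contra hno
    push Not at hno
    obtain ⟨v, hv⟩ := hno i rfl
    obtain ⟨u, hu⟩ := hno j h1
    have e1 : (v : Fin n → B) = window x n i := by rw [← hπσ, hv]; rfl
    have e2 : (u : Fin n → B) = window x n i := by rw [← hπσ, hu]; exact h1
    have : u = v := Subtype.ext (e2.trans e1.symm)
    rw [← this, hu] at hv
    exact h2 (window_eq_iff.1 hv n (by omega))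
  obtain ⟨j, hj1, hj2⟩ := hext i h
  obtain ⟨j', hj1', hj2'⟩ := hext i' h'
  have hjj : window x (n + 1) j ≠ window x (n + 1) j' := fun hc => hne (by rw [← hj1, hc, hj1'])
  have hfσ : (Set.range σ).Finite := hf.subset (by rintro _ ⟨v, rfl⟩; exact ⟨_, rfl⟩)
  have hsub : insert (window x (n + 1) j) (insert (window x (n + 1) j') (Set.range σ)) ⊆
      Set.range (window x (n + 1)) := by
    rintro v (rfl | rfl | ⟨u, rfl⟩) <;> exact ⟨_, rfl⟩
  have hle := Set.ncard_le_ncard hsub hf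
  rw [Set.ncard_insert_of_notMem (by simp only [Set.mem_insert_iff, not_or]; exact ⟨hjj, hj2⟩)
      (hfσ.insert _), Set.ncard_insert_of_notMem hj2' hfσ, ← Set.image_univ,
    Set.ncard_image_of_injective _ hσ, Set.ncard_univ, Nat.card_coe_set_eq] at hle
  omega

lemma IsBinary.finite_windows (hx : IsBinary x) (n : ℕ) : (Set.range (window x n)).Finite := by
  refine (Set.Finite.pi' (fun _ : Fin n => Set.toFinite ({0, 1} : Set ℤ))).subset ?_
  rintro _ ⟨i, rfl⟩ t
  exact hx _

/-- A balanced aperiodic word is Sturmian. -/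
theorem IsBalanced.isSturmian (hx : IsBinary x) (hb : IsBalanced x) (ha : IsAperiodic x) :
    IsSturmian x := by
  intro n
  rw [complexity_eq]
  induction n with
  | zero =>
    have : Set.range (window x 0) = {window x 0 0} := by
      ext v; simp [Subsingleton.elim v (window x 0 0)]
    simp [this]
  | succ n ih =>
    obtain ⟨i, j, hij, hne⟩ := ha.exists_rightSpecial n (hx.finite_windows n)
    -- Uniqueness of the right special factor: at the last place where two of them differ, extending
    -- each by the letter it has there gives an unbalanced pair.
    have huniq : ∀ p q, window x n p = window x n q → x (p + n) ≠ x (q + n) →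
        window x n p = window x n i := by
      intro p q hpq hpn
      rw [window_eq_iff]
      by_contra hcon
      have hex : ∃ s, s < n ∧ x (p + (n - 1 - s)) ≠ x (i + (n - 1 - s)) := by
        push Not at hcon
        obtain ⟨t, ht, h⟩ := hcon
        exact ⟨n - 1 - t, by omega, by rwa [show n - 1 - (n - 1 - t) = t by omega]⟩
      classical
      obtain ⟨hs, hd⟩ := Nat.find_spec hex
      have hmin := fun t (h : t < Nat.find hex) => Nat.find_min hex h
      set s := Nat.find hex
      have hag : ∀ t, n - 1 - s < t → t < n → x (p + t) = x (i + t) := fun t h1 h2 => by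
        by_contra hc
        exact hmin (n - 1 - t) (by omega) ⟨by omega, by rwa [show n - 1 - (n - 1 - t) = t by omega]⟩
      rw [window_eq_iff] at hpq hij
      -- both words have both continuations, so choose the continuation equal to the last difference
      obtain ⟨p', hp', hpl⟩ : ∃ p', (∀ t, t < n → x (p' + t) = x (p + t)) ∧
          x (p' + n) = x (p + (n - 1 - s)) := by
        rcases hx (p + n) with h | h <;> rcases hx (q + n) with h' | h' <;>
          rcases hx (p + (n - 1 - s)) with h'' | h''
        · exact absurd (h.trans h'.symm) hpn
        · exact absurd (h.trans h'.symm) hpn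
        · exact ⟨p, fun _ _ => rfl, h.trans h''.symm⟩
        · exact ⟨q, fun t ht => (hpq t ht).symm, h'.trans h''.symm⟩
        · exact ⟨q, fun t ht => (hpq t ht).symm, h'.trans h''.symm⟩
        · exact ⟨p, fun _ _ => rfl, h.trans h''.symm⟩
        · exact absurd (h.trans h'.symm) hpn
        · exact absurd (h.trans h'.symm) hpn
      obtain ⟨i', hi', hil⟩ : ∃ i', (∀ t, t < n → x (i' + t) = x (i + t)) ∧
          x (i' + n) = x (i + (n - 1 - s)) := by
        rcases hx (i + n) with h | h <;> rcases hx (j + n) with h' | h' <;>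
          rcases hx (i + (n - 1 - s)) with h'' | h''
        · exact absurd (h'.trans h.symm) hne
        · exact absurd (h'.trans h.symm) hne
        · exact ⟨i, fun _ _ => rfl, h.trans h''.symm⟩
        · exact ⟨j, fun t ht => (hij t ht), h'.trans h''.symm⟩
        · exact ⟨j, fun t ht => (hij t ht), h'.trans h''.symm⟩
        · exact ⟨i, fun _ _ => rfl, h.trans h''.symm⟩
        · exact absurd (h'.trans h.symm) hne
        · exact absurd (h'.trans h.symm) hne
      have hmid : ∀ t, 0 < t → t < s + 1 →
          x (p' + (n - 1 - s) + t) = x (i' + (n - 1 - s) + t) := fun t h1 h2 => by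
        rw [add_assoc, add_assoc, hp' _ (by omega), hi' _ (by omega)]
        exact hag _ (by omega) (by omega)
      have e1 := hp' (n - 1 - s) (by omega)
      have e2 := hi' (n - 1 - s) (by omega)
      have e3 : p' + (n - 1 - s) + (s + 1) = p' + n := by omega
      have e4 : i' + (n - 1 - s) + (s + 1) = i' + n := by omega
      rcases hx (p + (n - 1 - s)) with h | h
      · have h' : x (i + (n - 1 - s)) = 1 := by
          rcases hx (i + (n - 1 - s)) with h' | h'
          · exact absurd (h.trans h'.symm) hd
          · exact h'
        exact hb.not_unbalanced (k := s + 1) (by omega)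
          ⟨e1.trans h, by rw [e3, hpl, h], e2.trans h', by rw [e4, hil, h'], hmid⟩
      · have h' : x (i + (n - 1 - s)) = 0 := by
          rcases hx (i + (n - 1 - s)) with h' | h'
          · exact h'
          · exact absurd (h.trans h'.symm) hd
        exact hb.not_unbalanced (k := s + 1) (by omega)
          ⟨e2.trans h', by rw [e4, hil, h'], e1.trans h, by rw [e3, hpl, h],
            fun t a b => (hmid t a b).symm⟩
    have hfin := hx.finite_windows (n + 1)
    have hlast : ∀ p q, window x n p = window x n q → x (p + n) = x (q + n) →
        window x (n + 1) p = window x (n + 1) q := by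
      intro p q h1 h2
      rw [window_eq_iff] at h1 ⊢
      intro t ht
      rcases Nat.lt_succ_iff_lt_or_eq.1 ht with h | rfl
      · exact h1 t h
      · exact h2
    let π : (Fin (n + 1) → ℤ) → (Fin n → ℤ) := fun v t => v t.castSucc
    -- After removal of one of the two extensions of the right special factor, deleting the last
    -- letter is a bijection onto the factors of length `n`.
    have himg : π '' (Set.range (window x (n + 1)) \ {window x (n + 1) i}) =
        Set.range (window x n) := by
      ext v
      constructor
      · rintro ⟨_, ⟨⟨p, rfl⟩, -⟩, rfl⟩
        exact ⟨p, rfl⟩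
      · rintro ⟨p, rfl⟩
        by_cases h : window x (n + 1) p = window x (n + 1) i
        · refine ⟨window x (n + 1) j, ⟨⟨j, rfl⟩, fun h' => ?_⟩, ?_⟩
          · exact hne (window_eq_iff.1 h' n (by omega))
          · exact hij.trans (congrArg π h).symm
        · exact ⟨window x (n + 1) p, ⟨⟨p, rfl⟩, h⟩, rfl⟩
    have hinj : Set.InjOn π (Set.range (window x (n + 1)) \ {window x (n + 1) i}) := by
      rintro _ ⟨⟨p, rfl⟩, hp⟩ _ ⟨⟨q, rfl⟩, hq⟩ hpq
      by_cases hl : x (p + n) = x (q + n)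
      · exact hlast p q hpq hl
      · have h1 := huniq p q hpq hl
        have h2 := huniq q p (Eq.symm hpq) (Ne.symm hl)
        exfalso
        rcases hx (p + n) with a | a <;> rcases hx (q + n) with b | b <;>
          rcases hx (i + n) with c | c
        · exact hl (a.trans b.symm)
        · exact hl (a.trans b.symm)
        · exact hp (hlast p i h1 (a.trans c.symm))
        · exact hq (hlast q i h2 (b.trans c.symm))
        · exact hq (hlast q i h2 (b.trans c.symm))
        · exact hp (hlast p i h1 (a.trans c.symm))
        · exact hl (a.trans b.symm)
        · exact hl (a.trans b.symm)
    have hcard := Set.ncard_sdiff_singleton_add_one (Set.mem_range_self (f := window x (n + 1)) i) hfin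
    rw [← hinj.ncard_image, himg, ih] at hcard
    exact hcard.symm

/-! ### Sturmian words are balanced -/

section
variable {k i₀ j₀ : ℕ}

/-- In a minimal pair `0P0`, `1P1` the word `P` is a palindrome. At the first failure of symmetry, a
border of `0P0` and the opposite border of `1P1` would be windows of length at most `k` with counts
differing by two. -/
lemma Unbalanced.palindrome (hx : IsBinary x) (hu : Unbalanced x k i₀ j₀)
    (hmin : ∀ l, 0 < l → l < k → ∀ i j, ¬ Unbalanced x l i j) (t : ℕ) (ht : t + 1 < k) :
    x (i₀ + 1 + t) = x (j₀ + (k - 1 - t)) := by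
  obtain ⟨a1, a2, b1, b2, hm⟩ := hu
  have hmid : ∀ t, t + 1 < k → x (i₀ + 1 + t) = x (j₀ + 1 + t) := fun t ht => by
    have := hm (t + 1) (by omega) (by omega)
    rwa [show i₀ + 1 + t = i₀ + (t + 1) by omega, show j₀ + 1 + t = j₀ + (t + 1) by omega]
  have step : ∀ t, t + 1 < k → win x t (i₀ + 1) = win x t (j₀ + (k - t)) →
      x (i₀ + 1 + t) = x (j₀ + (k - 1 - t)) := by
    intro t ht hs
    by_contra hne
    have e1 : win x t (i₀ + 1) = win x t (j₀ + 1) := win_congr fun s hs => hmid s (by omega)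
    have e2 : win x t (i₀ + (k - t)) = win x t (j₀ + (k - t)) := win_congr fun s hs => by
      have := hmid (k - t + s - 1) (by omega)
      rwa [show i₀ + (k - t) + s = i₀ + 1 + (k - t + s - 1) by omega,
        show j₀ + (k - t) + s = j₀ + 1 + (k - t + s - 1) by omega]
    have e3 : x (i₀ + (k - 1 - t)) = x (j₀ + (k - 1 - t)) := by
      have := hmid (k - 2 - t) (by omega)
      rwa [show i₀ + 1 + (k - 2 - t) = i₀ + (k - 1 - t) by omega,
        show j₀ + 1 + (k - 2 - t) = j₀ + (k - 1 - t) by omega] at this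
    have key : ∀ i, win x (t + 1 + 1) i = x i + win x t (i + 1) + x (i + 1 + t) := fun i => by
      rw [win_succ, win_succ']; congr 2; omega
    have p1 := key i₀
    have p2 := key j₀
    have p3 := key (i₀ + (k - 1 - t))
    have p4 := key (j₀ + (k - 1 - t))
    rw [show i₀ + (k - 1 - t) + 1 = i₀ + (k - t) by omega,
      show i₀ + (k - t) + t = i₀ + k by omega] at p3
    rw [show j₀ + (k - 1 - t) + 1 = j₀ + (k - t) by omega,
      show j₀ + (k - t) + t = j₀ + k by omega] at p4
    have q1 := hx.win_sub_le hmin (t + 1 + 1) (by omega) i₀ (j₀ + (k - 1 - t))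
    have q2 := hx.win_sub_le hmin (t + 1 + 1) (by omega) (i₀ + (k - 1 - t)) j₀
    have := hmid t ht
    rcases hx (i₀ + 1 + t) with h | h <;> rcases hx (j₀ + (k - 1 - t)) with h' | h' <;> omega
  have key : ∀ t, t + 1 ≤ k → win x t (i₀ + 1) = win x t (j₀ + (k - t)) := by
    intro t
    induction t with
    | zero => intro _; simp [win_zero]
    | succ t ih =>
      intro ht
      rw [win_succ, win_succ', step t (by omega) (ih (by omega)), ih (by omega),
        show k - (t + 1) = k - 1 - t by omega, show j₀ + (k - 1 - t) + 1 = j₀ + (k - t) by omega]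
      ring
  exact step t ht (key t (by omega))

/-- If `0P` were right special it would be the only such factor of length `k`. It does not occur at
the `k + 1` positions `j₀, …, j₀ + k`: the final `1` of `1P1` would fall on a letter of `P` that, by
the palindrome property, is `0`. So these positions carry only `k` different factors, one of them
repeats with no right special factor met, and the word is ultimately periodic. -/
lemma Unbalanced.not_rightSpecial_zero (hx : IsBinary x) (ha : IsAperiodic x) (hk : 0 < k)
    (hu : Unbalanced x k i₀ j₀) (hmin : ∀ l, 0 < l → l < k → ∀ i j, ¬ Unbalanced x l i j)
    (hcard : (Set.range (window x k)).ncard = k + 1)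
    (huniq : ∀ i i', RightSpecial x k i → RightSpecial x k i' → window x k i = window x k i') :
    ¬ RightSpecial x k i₀ := by
  intro hR
  have hpal := hu.palindrome hx hmin
  obtain ⟨a1, a2, b1, b2, hm⟩ := hu
  have hne : ∀ s, s ≤ k → window x k (j₀ + s) ≠ window x k i₀ := by
    intro s hs h
    rw [window_eq_iff] at h
    have h0 := h 0 hk
    simp only [add_zero, a1] at h0
    rcases Nat.eq_zero_or_pos s with rfl | hs0
    · simp only [add_zero, b1] at h0; omega
    rcases Nat.lt_or_ge s k with hsk | hsk
    · have h1 := h (k - s) (by omega)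
      rw [show j₀ + s + (k - s) = j₀ + k by omega, b2] at h1
      have h2 := hpal (k - s - 1) (by omega)
      rw [show i₀ + 1 + (k - s - 1) = i₀ + (k - s) by omega,
        show k - 1 - (k - s - 1) = s by omega] at h2
      omega
    · obtain rfl : s = k := by omega
      omega
  have hnr : ∀ s, s ≤ k → ¬ RightSpecial x k (j₀ + s) := fun s hs h => hne s hs (huniq _ _ h hR)
  have hfin := hx.finite_windows k
  have hc := Set.ncard_sdiff_singleton_add_one (Set.mem_range_self (f := window x k) i₀) hfin
  rw [hcard] at hc
  obtain ⟨s, hs, s', hs', hss, heq⟩ := Finset.exists_ne_map_eq_of_card_lt_of_maps_to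
    (s := Finset.range (k + 1)) (t := (hfin.sdiff (t := {window x k i₀})).toFinset)
    (f := fun s => window x k (j₀ + s))
    (by rw [← Set.ncard_eq_toFinset_card _ (hfin.sdiff (t := {window x k i₀})), Finset.card_range]
        omega)
    (fun s hs => by
      have hs : s < k + 1 := by simpa using hs
      simpa using hne s (by omega))
  simp only [Finset.mem_range] at hs hs' heq
  rcases lt_or_gt_of_ne hss with h | h
  · have := ha.ne_of_future fun t => future_of_not_rightSpecial (a := j₀ + s) (b := j₀ + s')
      (by omega) heq (fun t ht => by rw [add_assoc]; exact hnr _ (by omega)) t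
    omega
  · have := ha.ne_of_future fun t => future_of_not_rightSpecial (a := j₀ + s') (b := j₀ + s)
      (by omega) heq.symm (fun t ht => by rw [add_assoc]; exact hnr _ (by omega)) t
    omega

end

/-- The least witness of unbalance. -/
lemma IsBinary.exists_min_unbalanced (hx : IsBinary x) (hb : ¬ IsBalanced x) :
    ∃ k i j, 0 < k ∧ Unbalanced x k i j ∧ ∀ l, 0 < l → l < k → ∀ i j, ¬ Unbalanced x l i j := by
  have hex : ∃ k, 0 < k ∧ ∃ i j, Unbalanced x k i j := by
    by_contra hno
    push Not at hno
    exact hb fun n i j => hx.win_sub_le (L := n) (fun k h0 _ i j => hno k h0 i j) n le_rfl i j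
  classical
  obtain ⟨h1, i, j, h2⟩ := Nat.find_spec hex
  exact ⟨Nat.find hex, i, j, h1, h2, fun l h3 h4 i j h5 => Nat.find_min hex h4 ⟨h3, i, j, h5⟩⟩

lemma RightSpecial.swapLetters {n i : ℕ} (h : RightSpecial x n i) :
    RightSpecial (swapLetters x) n i := by
  obtain ⟨j, h1, h2⟩ := h
  rw [window_eq_iff] at h1
  refine ⟨j, window_eq_iff.2 fun t ht => by simp [swapLetters_apply, h1 t ht], fun h => h2 ?_⟩
  simp only [swapLetters_apply] at h; linarith

theorem IsSturmian.isBalanced (hx : IsBinary x) (ha : IsAperiodic x) (hS : IsSturmian x) :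
    IsBalanced x := by
  by_contra hb
  obtain ⟨k, i₀, j₀, hk, hu, hmin⟩ := hx.exists_min_unbalanced hb
  have hcard : ∀ y : ℕ → ℤ, IsSturmian y → ∀ n, (Set.range (window y n)).ncard = n + 1 :=
    fun y hy n => by rw [← complexity_eq]; exact hy n
  have huniq : ∀ y : ℕ → ℤ, IsBinary y → IsSturmian y → ∀ n i i', RightSpecial y n i →
      RightSpecial y n i' → window y n i = window y n i' := fun y hby hy n i i' h h' =>
    h.unique (hby.finite_windows _) (by rw [hcard y hy, hcard y hy]) h'
  obtain ⟨i, hi⟩ := ha.exists_rightSpecial k (hx.finite_windows k)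
  obtain ⟨m, rfl⟩ : ∃ m, k = m + 1 := ⟨k - 1, by omega⟩
  obtain ⟨a1, a2, b1, b2, hm⟩ := id hu
  -- `P` is right special because of `P0` and `P1`, so the right special factor of length `m + 1`,
  -- having a right special suffix, is `0P` or `1P`. Exchanging the letters reduces the second case
  -- to the first.
  have hP : RightSpecial x m (i₀ + 1) := by
    refine ⟨j₀ + 1, window_eq_iff.2 fun t ht => ?_, ?_⟩
    · have := hm (t + 1) (by omega) (by omega)
      rw [show i₀ + 1 + t = i₀ + (t + 1) by omega, show j₀ + 1 + t = j₀ + (t + 1) by omega, this]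
    · rw [show j₀ + 1 + m = j₀ + (m + 1) by omega, show i₀ + 1 + m = i₀ + (m + 1) by omega, a2, b2]
      omega
  have hi' : RightSpecial x m (i + 1) := by
    obtain ⟨j, h1, h2⟩ := hi
    rw [window_eq_iff] at h1
    refine ⟨j + 1, window_eq_iff.2 fun t ht => ?_, ?_⟩
    · have := h1 (t + 1) (by omega)
      rwa [show i + 1 + t = i + (t + 1) by omega, show j + 1 + t = j + (t + 1) by omega]
    · rwa [show i + 1 + m = i + (m + 1) by omega, show j + 1 + m = j + (m + 1) by omega]
  have hw := window_eq_iff.1 (huniq x hx hS m _ _ hi' hP)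
  rcases hx i with h | h
  · refine hu.not_rightSpecial_zero hx ha hk hmin (hcard x hS _) (huniq x hx hS _)
      (hi.congr (window_eq_iff.2 fun t ht => ?_))
    rcases t with _ | t
    · simpa using h.trans a1.symm
    · have := hw t (by omega)
      rwa [show i + (t + 1) = i + 1 + t by omega, show i₀ + (t + 1) = i₀ + 1 + t by omega]
  · have hS' : IsSturmian (swapLetters x) := fun n => by
      rw [← hS n]
      exact complexity_comp x (fun z => 1 - z) (fun i j h => by simpa using h) n
    have hmin' : ∀ l, 0 < l → l < m + 1 → ∀ i j, ¬ Unbalanced (swapLetters x) l i j :=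
      fun l h1 h2 i j h => hmin l h1 h2 j i (by have := h.flip; rwa [swapLetters_swapLetters] at this)
    have hij : RightSpecial x (m + 1) j₀ := hi.congr (window_eq_iff.2 fun t ht => by
      rcases t with _ | t
      · simpa using h.trans b1.symm
      · have := hw t (by omega)
        rw [show i + (t + 1) = i + 1 + t by omega, this, ← hm (t + 1) (by omega) (by omega)]
        congr 1; omega)
    exact hu.flip.not_rightSpecial_zero hx.flip ha.flip hk hmin' (hcard _ hS' _)
      (huniq _ hx.flip hS' _) hij.swapLetters

end AbelianReturns

/-! ### Empty `P`: both `00` and `11` occur -/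

namespace AbelianReturns
variable {x : ℕ → ℤ}

lemma win_slide (x : ℕ → ℤ) (n a r : ℕ) :
    win x n (a + r) = win x n a + win x r (a + n) - win x r a := by
  have h1 := win_add x n r a
  have h2 := win_add x r n a
  rw [add_comm r n] at h2
  linarith

lemma IsBinary.win_le_sub_of_zeros (hx : IsBinary x) {l i u b : ℕ} (h1 : i ≤ u)
    (h2 : u + b ≤ i + l) (h : ∀ s, s < b → x (u + s) = 0) : win x l i ≤ l - b := by
  have e := win_add x (u - i) (b + (i + l - (u + b))) i
  rw [show u - i + (b + (i + l - (u + b))) = l by omega, show i + (u - i) = u by omega, win_add,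
    win_const h] at e
  have a1 := hx.win_le (u - i) i
  have a2 := hx.win_le (i + l - (u + b)) (u + b)
  push_cast [Nat.cast_sub h1, Nat.cast_sub h2] at *
  linarith

lemma IsBinary.win_le_of_two_zeros (hx : IsBinary x) {l i u v : ℕ} (h1 : i ≤ u) (h2 : u < v)
    (h3 : v < i + l) (hu : x u = 0) (hv : x v = 0) : win x l i ≤ l - 2 := by
  have e := win_add x (v - i) (l - (v - i)) i
  rw [show v - i + (l - (v - i)) = l by omega] at e
  have a1 := hx.win_le_sub_of_zeros (l := v - i) (i := i) (u := u) (b := 1) h1 (by omega)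
    (fun s hs => by rw [show s = 0 by omega]; exact hu)
  have a2 := hx.win_le_sub_of_zeros (l := l - (v - i)) (i := i + (v - i)) (u := v) (b := 1)
    (by omega) (by omega) (fun s hs => by rw [show s = 0 by omega]; exact hv)
  push_cast [Nat.cast_sub (show i ≤ v by omega), Nat.cast_sub (show v - i ≤ l by omega)] at *
  linarith

lemma IsBinary.win_pos (hx : IsBinary x) {l i u : ℕ} (h1 : i ≤ u) (h2 : u < i + l)
    (hu : x u = 1) : 0 < win x l i := by
  have e := win_add x (u - i) (1 + (i + l - (u + 1))) i
  rw [show u - i + (1 + (i + l - (u + 1))) = l by omega, show i + (u - i) = u by omega, win_add,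
    win_one, hu] at e
  have a1 := hx.win_nonneg (u - i) i
  have a2 := hx.win_nonneg (i + l - (u + 1)) (u + 1)
  linarith

/-- The letter `0` occurs at `z` and next at `z + l`. -/
structure ZeroGap (x : ℕ → ℤ) (z l : ℕ) : Prop where
  pos : 0 < l
  left : x z = 0
  right : x (z + l) = 0
  ones : ∀ t, 0 < t → t < l → x (z + t) = 1

lemma ZeroGap.win_eq {z l : ℕ} (h : ZeroGap x z l) : win x l z = l - 1 := by
  obtain ⟨m, rfl⟩ : ∃ m, l = m + 1 := ⟨l - 1, by have := h.pos; omega⟩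
  rw [win_succ', h.left, win_const (c := 1) fun t ht => by
    have := h.ones (t + 1) (by omega) (by omega)
    rwa [show z + 1 + t = z + (t + 1) by omega]]
  push_cast; ring

lemma PrefixRecurrent.exists_zeroGap (hx : IsBinary x) (hr : PrefixRecurrent x) {z : ℕ}
    (hz : x z = 0) : ∃ l, ZeroGap x z l := by
  obtain ⟨j, h1, h2, h3⟩ := hr.next_ret 1 z
  simp only [win_one] at h2 h3
  refine ⟨j - z, by omega, hz, by rw [show z + (j - z) = j by omega, h2, hz], fun t h4 h5 => ?_⟩
  rcases hx (z + t) with h | h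
  · exact absurd (h.trans hz.symm) (h3 _ (by omega) (by omega))
  · exact h

/-- The prefix of length `j` recurs at `n`, and the letters at `j` and `j + n` differ. -/
structure MaxRepeat (x : ℕ → ℤ) (n j : ℕ) : Prop where
  agree : ∀ t, t < j → x (t + n) = x t
  differ : x (j + n) ≠ x j

lemma PrefixRecurrent.exists_maxRepeat (hr : PrefixRecurrent x) (ha : IsAperiodic x) (M b : ℕ) :
    ∃ n j, b ≤ n ∧ M ≤ j ∧ MaxRepeat x n j := by
  obtain ⟨q, hq, h⟩ := hr M (b + 1)
  have hex : ∃ j, x (j + q) ≠ x j := by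
    by_contra hno
    push Not at hno
    have := ha.ne_of_future (a := q) (b := 0) fun t => by rw [add_comm, hno, zero_add]
    omega
  classical
  refine ⟨q, Nat.find hex, by omega, ?_, fun t ht => ?_, Nat.find_spec hex⟩
  · by_contra hlt
    exact Nat.find_spec hex (by rw [add_comm]; exact h _ (by omega))
  · have := Nat.find_min hex ht
    push Not at this
    exact this

lemma MaxRepeat.win_eq {n j t : ℕ} (h : MaxRepeat x n j) (ht : t ≤ j) : win x n t = win x n 0 := by
  induction t with
  | zero => rfl
  | succ t ih => rw [win_shift, ih (by omega), h.agree t (by omega)]; ring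

lemma MaxRepeat.swapLetters {n j : ℕ} (h : MaxRepeat x n j) : MaxRepeat (swapLetters x) n j :=
  ⟨fun t ht => by simp [swapLetters_apply, h.agree t ht], fun hc => h.differ (by
    simp only [swapLetters_apply] at hc; linarith)⟩

/-- Three distinct distances between consecutive zeros. -/
def ThreeGaps (x : ℕ → ℤ) : Prop :=
  ∃ z₁ z₂ z₃ l₁ l₂ l₃, ZeroGap x z₁ l₁ ∧ ZeroGap x z₂ l₂ ∧ ZeroGap x z₃ l₃ ∧
    l₁ ≠ l₂ ∧ l₁ ≠ l₃ ∧ l₂ ≠ l₃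

/-- If `x j = 0`, the windows of length `n + 1` at `t < j` have `x t` ones more than a constant, so
the lower class marks exactly the zeros before `j`, while `j` itself falls in the upper class. The
three gaps are returns with one zero each, and the return passing over `j` contains two zeros. -/
lemma AtMostThree.maxRepeat_ne_zero (hx : IsBinary x) (hr : PrefixRecurrent x)
    (h3 : AtMostThree x) (hg : ThreeGaps x) :
    ∃ M, ∀ n j, M ≤ j → MaxRepeat x n j → x j ≠ 0 := by
  obtain ⟨z₁, z₂, z₃, l₁, l₂, l₃, g₁, g₂, g₃, h12, h13, h23⟩ := hg
  -- Beyond this bound the three gaps lie before the end of the repeat.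
  refine ⟨z₁ + l₁ + z₂ + l₂ + z₃ + l₃ + 1, fun n j hM hm hj => ?_⟩
  have hw : ∀ t, t < j → win x (n + 1) t = x t + win x n 0 := fun t ht => by
    rw [win_succ', hm.win_eq (by omega)]
  have hwj : win x (n + 1) j = win x n 0 + 1 := by
    rw [win_succ, hm.win_eq le_rfl]
    have := hm.differ
    rcases hx (j + n) with h | h
    · exact absurd (h.trans hj.symm) this
    · rw [h]
  have key : ∀ z l, z + l < j → ZeroGap x z l →
      Ret x (n + 1) z (z + l) ∧ win x (n + 1) z = win x n 0 := fun z l hz g => by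
    have e := hw z (by omega)
    rw [g.left] at e
    refine ⟨⟨by have := g.pos; omega, ?_, fun k hk1 hk2 hc => ?_⟩, by rw [e]; ring⟩
    · rw [e, hw _ hz, g.right]
    · have := g.ones (k - z) (by omega) (by omega)
      rw [show z + (k - z) = k by omega] at this
      rw [e, hw k (by omega), this] at hc
      omega
  obtain ⟨r₁, c₁⟩ := key z₁ l₁ (by omega) g₁
  obtain ⟨r₂, c₂⟩ := key z₂ l₂ (by omega) g₂
  obtain ⟨r₃, c₃⟩ := key z₃ l₃ (by omega) g₃
  obtain ⟨i, i', -, hij, hji, r, c⟩ := hr.straddle (N := n + 1) (i₀ := z₁) (m := j) (by omega)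
  rw [c₁] at c
  have hlt : i < j := lt_of_le_of_ne hij fun he => by rw [he, hwj] at c; omega
  have hi0 : x i = 0 := by have := hw i hlt; omega
  have hz := hx.win_le_of_two_zeros (l := i' - i) (i := i) le_rfl hlt (by omega) hi0 hj
  exact h3.four r₁ c₁ rfl g₁.win_eq r₂ c₂ rfl g₂.win_eq r₃ c₃ rfl g₃.win_eq r c
    (show i' = i + (i' - i) by omega) rfl (by omega) (by omega) (by omega) (by omega) (by omega)
    (by omega)

/-- Every maximal block of zeros (preceded by a one) has length `b`. -/
def ZeroBlocks (x : ℕ → ℤ) (b : ℕ) : Prop :=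
  ∀ t, x t = 1 → x (t + 1) = 0 → (∀ s, 0 < s → s ≤ b → x (t + s) = 0) ∧ x (t + b + 1) = 1

/-- The factor `11` gives the gap `1` between ones, and `00` gives a gap of at least `3`. With no
third gap available, every block of zeros has the same length. -/
lemma zeroBlocks_of_not_threeGaps (hx : IsBinary x) (hr : PrefixRecurrent x)
    (hg : ¬ ThreeGaps (swapLetters x)) {i j : ℕ} (hi : x i = 0) (hi' : x (i + 1) = 0)
    (hj : x j = 1) (hj' : x (j + 1) = 1) : ∃ b, 2 ≤ b ∧ ZeroBlocks x b := by
  have gap : ∀ z, x z = 1 → ∃ l, ZeroGap (swapLetters x) z l := fun z hz =>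
    hr.flip.exists_zeroGap hx.flip (by simp [swapLetters_apply, hz])
  have g₁ : ZeroGap (swapLetters x) j 1 := ⟨by omega, by simp [swapLetters_apply, hj],
    by simp [swapLetters_apply, hj'], fun t _ _ => by omega⟩
  -- a block of at least two zeros
  obtain ⟨i', hi1, h2⟩ := hr.factor i 2 (j + 1)
  have hz0 := h2 0 (by omega)
  have hz1 := h2 1 (by omega)
  rw [add_zero, add_zero, hi] at hz0
  rw [hi'] at hz1
  obtain ⟨u, u', hju, hui, hiu, hru, hcu⟩ := hr.straddle (N := 1) (i₀ := j) (m := i') (by omega)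
  simp only [Ret, win_one] at hru hcu
  have hu1 : x u = 1 := hcu.trans hj
  obtain ⟨l, g₂⟩ := gap u hu1
  have hul : i' < u + l := by
    by_contra hc
    have h1 := g₂.right
    have h2 := g₂.pos
    simp only [swapLetters_apply] at h1
    exact hru.2.2 (u + l) (by omega) (by omega) (by linarith)
  have hne : u ≠ i' := fun h => by rw [h, hz0] at hu1; omega
  have hl : 3 ≤ l := by
    have h1 := g₂.right
    simp only [swapLetters_apply] at h1
    by_contra hc
    have : u + l = i' + 1 := by omega
    rw [this, hz1] at h1; omega
  refine ⟨l - 1, by omega, fun t ht ht1 => ?_⟩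
  obtain ⟨l', g₃⟩ := gap t ht
  have hl' : l' ≠ 1 := fun h => by
    have := g₃.right
    rw [h] at this
    simp only [swapLetters_apply] at this
    omega
  have : l' = l := by
    by_contra hc
    exact hg ⟨_, _, _, _, _, _, g₁, g₂, g₃, by omega, Ne.symm hl', Ne.symm hc⟩
  subst this
  refine ⟨fun s h1 h2 => ?_, ?_⟩
  · have := g₃.ones s h1 (by omega)
    simp only [swapLetters_apply] at this; linarith
  · have := g₃.right
    rw [show t + l' = t + (l' - 1) + 1 by omega] at this
    simp only [swapLetters_apply] at this; linarith

lemma ZeroBlocks.backward {b z : ℕ} (hx : IsBinary x) (h : ZeroBlocks x b) (hz : x z = 0)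
    (hz1 : x (z + 1) = 1) (hu : ∃ u, u < z ∧ x u = 1) : ∃ u, u + b = z ∧ x u = 1 ∧ x (u + 1) = 0 := by
  classical
  obtain ⟨u₀, hu₀, hu1⟩ := hu
  have hs := Nat.findGreatest_spec (P := fun u => x u = 1) hu₀.le hu1
  have hle := Nat.findGreatest_le (P := fun u => x u = 1) z
  have hgr : ∀ k, Nat.findGreatest (fun u => x u = 1) z < k → k ≤ z → ¬ x k = 1 :=
    fun k h1 h2 => Nat.findGreatest_is_greatest (P := fun u => x u = 1) h1 h2
  set u := Nat.findGreatest (fun u => x u = 1) z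
  have hne : u ≠ z := fun h => by rw [h, hz] at hs; omega
  have hzero : ∀ k, u < k → k ≤ z → x k = 0 := fun k h1 h2 =>
    (hx k).resolve_right (hgr k h1 h2)
  have hu1 := hzero (u + 1) (by omega) (by omega)
  obtain ⟨h1, h2⟩ := h u hs hu1
  refine ⟨u, ?_, hs, hu1⟩
  rcases lt_trichotomy (u + b) z with hc | hc | hc
  · have := hzero (u + b + 1) (by omega) (by omega)
    omega
  · exact hc
  · have := h1 (z + 1 - u) (by omega) (by omega)
    rw [show u + (z + 1 - u) = z + 1 by omega] at this
    omega

/-- After every descent `10` the word reads `b` zeros, `k` ones, and descends again. -/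
lemma ZeroBlocks.not_aperiodic {b k i j : ℕ} (hx : IsBinary x) (hr : PrefixRecurrent x) (hb : 0 < b)
    (hk : 0 < k) (h0 : ZeroBlocks x b) (h1 : ZeroBlocks (swapLetters x) k) (hi : x i = 0) (hj : x j = 1) :
    ¬ IsAperiodic x := by
  intro ha
  have h1' : ∀ t, x t = 0 → x (t + 1) = 1 →
      (∀ s, 0 < s → s ≤ k → x (t + s) = 1) ∧ x (t + k + 1) = 0 := fun t ht ht1 => by
    obtain ⟨a, b⟩ := h1 t (by simp [swapLetters_apply, ht]) (by simp [swapLetters_apply, ht1])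
    refine ⟨fun s p q => ?_, ?_⟩
    · have := a s p q
      simp only [swapLetters_apply] at this; linarith
    · simp only [swapLetters_apply] at b; linarith
  have blk : ∀ t, x t = 1 → x (t + 1) = 0 → (∀ s, 0 < s → s ≤ b → x (t + s) = 0) ∧
      (∀ s, b < s → s ≤ b + k → x (t + s) = 1) ∧ x (t + (b + k) + 1) = 0 := fun t p q => by
    obtain ⟨a1, a2⟩ := h0 t p q
    obtain ⟨b1, b2⟩ := h1' (t + b) (a1 b hb le_rfl) a2
    refine ⟨a1, fun s h2 h3 => ?_, by rw [← b2]; congr 1; omega⟩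
    rw [← b1 (s - b) (by omega) (by omega)]; congr 1; omega
  have fut : ∀ s t t', x t = 1 → x (t + 1) = 0 → x t' = 1 → x (t' + 1) = 0 → x (t + s) = x (t' + s) := by
    intro s
    induction s using Nat.strong_induction_on with
    | _ s ih =>
      intro t t' p q p' q'
      obtain ⟨a1, a2, a3⟩ := blk t p q
      obtain ⟨b1, b2, b3⟩ := blk t' p' q'
      rcases Nat.eq_zero_or_pos s with rfl | hs
      · exact p.trans p'.symm
      rcases Nat.lt_or_ge b s with h | h
      · rcases Nat.lt_or_ge s (b + k + 1) with h2 | h2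
        · rw [a2 s h (by omega), b2 s h (by omega)]
        · have := ih (s - (b + k)) (by omega) (t + (b + k)) (t' + (b + k))
            (a2 _ (by omega) le_rfl) a3 (b2 _ (by omega) le_rfl) b3
          rwa [show t + (b + k) + (s - (b + k)) = t + s by omega,
            show t' + (b + k) + (s - (b + k)) = t' + s by omega] at this
      · rw [a1 s hs h, b1 s hs h]
  obtain ⟨q, hq, hq'⟩ := hr.factor i 1 (j + 1)
  have hq0 := hq' 0 (by omega)
  rw [add_zero, add_zero, hi] at hq0
  obtain ⟨u, u', h2, h3, h4, h5, h6⟩ := hr.straddle (N := 1) (i₀ := j) (m := q) (by omega)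
  simp only [Ret, win_one] at h5 h6
  have hu : x u = 1 := h6.trans hj
  have hu1 : x (u + 1) = 0 := by
    rcases hx (u + 1) with h | h
    · exact h
    · have : u ≠ q := fun h => by rw [h, hq0] at hu; omega
      exact absurd (h.trans hu.symm) (h5.2.2 (u + 1) (by omega) (by omega))
  obtain ⟨a1, a2, a3⟩ := blk u hu hu1
  have := ha.ne_of_future fun s => fut s u (u + (b + k)) hu hu1 (a2 _ (by omega) le_rfl) a3
  omega

/-- The four returns, with `s = b - 1`: the letter `0`; the words consisting of `l - 1` ones and `s`
zeros, for two different gaps `l`; and the return around the end `j` of a long repeat, which has at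
least `b` zeros. -/
lemma AtMostThree.false_of_zeroBlocks (hx : IsBinary x) (hr : PrefixRecurrent x)
    (ha : IsAperiodic x) (h3 : AtMostThree x) {b : ℕ} (hb : 2 ≤ b) (h0 : ZeroBlocks x b)
    (hg : ThreeGaps x) : False := by
  obtain ⟨M₀, hM₀⟩ := h3.maxRepeat_ne_zero hx hr hg
  obtain ⟨z₁, l₁, z₂, l₂, g₁, g₂, hl₁, hl₂, hne⟩ : ∃ z₁ l₁ z₂ l₂, ZeroGap x z₁ l₁ ∧ ZeroGap x z₂ l₂ ∧
      2 ≤ l₁ ∧ 2 ≤ l₂ ∧ l₁ ≠ l₂ := by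
    obtain ⟨z₁, z₂, z₃, l₁, l₂, l₃, g₁, g₂, g₃, h12, h13, h23⟩ := hg
    have := g₁.pos
    have := g₂.pos
    have := g₃.pos
    by_cases h1 : l₁ = 1
    · exact ⟨_, _, _, _, g₂, g₃, by omega, by omega, h23⟩
    · by_cases h2 : l₂ = 1
      · exact ⟨_, _, _, _, g₁, g₃, by omega, by omega, h13⟩
      · exact ⟨_, _, _, _, g₁, g₂, by omega, by omega, h12⟩
  -- move both gaps beyond a one and beyond `b`
  have move : ∀ z l, ZeroGap x z l → 2 ≤ l → ∃ z', z + 1 + b < z' ∧ ZeroGap x z' l := fun z l g hl => by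
    obtain ⟨q, hq, h⟩ := hr.factor z (l + 1) (z + b + 2)
    refine ⟨q, by omega, g.pos, by have := h 0 (by omega); rw [add_zero, add_zero, g.left] at this; exact this,
      by rw [h l (by omega), g.right], fun t h1 h2 => by rw [h t (by omega), g.ones t h1 h2]⟩
  have one₁ := g₁.ones 1 (by omega) (by omega)
  have one₂ := g₂.ones 1 (by omega) (by omega)
  obtain ⟨y₁, hy₁, f₁⟩ := move _ _ g₁ hl₁
  obtain ⟨y₂, hy₂, f₂⟩ := move _ _ g₂ hl₂
  obtain ⟨n, j, hn, hj, hm⟩ := hr.exists_maxRepeat ha (M₀ + y₁ + l₁ + y₂ + l₂ + 3 * b) b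
  have hj1 : x j = 1 := (hx j).resolve_left (hM₀ n j (by omega) hm)
  have hjn : x (j + n) = 0 := (hx (j + n)).resolve_right fun h => hm.differ (h.trans hj1.symm)
  set c := win x n 0
  -- Within the repeat, a window of length `N = n - s` has `c` minus the number of ones among the
  -- `s` letters before it. It has `c` ones exactly when these are all zeros, that is, at the last
  -- zero of a block and just after the block.
  obtain ⟨s, rfl⟩ : ∃ s, b = s + 1 := ⟨b - 1, by omega⟩
  obtain ⟨N, rfl⟩ : ∃ N, n = N + s := ⟨n - s, by omega⟩
  have hwN : ∀ t, win x N t = win x (N + s) t - win x s (t + N) := fun t => by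
    rw [win_add]; ring
  have hw : ∀ t, t + s ≤ j → win x N (t + s) = c - win x s t := fun t ht => by
    rw [hwN, hm.win_eq ht]
    congr 1
    refine win_congr fun r hr => ?_
    rw [← hm.agree (t + r) (by omega)]; congr 1; omega
  have hzero : ∀ t, t + s ≤ j → (∀ r, r < s → x (t + r) = 0) → win x N (t + s) = c := fun t ht h => by
    rw [hw t ht, win_const h]; ring
  have hone : ∀ t u, t + s ≤ j → t ≤ u → u < t + s → x u = 1 → win x N (t + s) ≠ c := fun t u ht h1 h2 h => by
    have := hx.win_pos h1 h2 h
    rw [hw t ht]; omega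
  have key : ∀ y z l, z + 1 + (s + 1) < y → x (z + 1) = 1 → ZeroGap x y l → 2 ≤ l → y + l + s < j →
      Ret x N (y + 1) (y + 1 + (l - 1 + s)) ∧ win x N (y + 1) = c ∧
        win x (l - 1 + s) (y + 1) = l - 1 := by
    intro y z l hzy hz g hl hyj
    obtain ⟨u, hu, hu1, hu2⟩ := h0.backward hx g.left (g.ones 1 (by omega) (by omega))
      ⟨z + 1, by omega, hz⟩
    obtain ⟨a1, -⟩ := h0 u hu1 hu2
    have hl1 : x (y + (l - 1)) = 1 := g.ones _ (by omega) (by omega)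
    obtain ⟨b1, -⟩ := h0 (y + (l - 1)) hl1 (by
      have := g.right
      rwa [show y + (l - 1) + 1 = y + l by omega])
    have c0 : win x N (y + 1) = c := by
      have := hzero (u + 2) (by omega) fun r hr => by
        rw [add_assoc]; exact a1 _ (by omega) (by omega)
      rwa [show u + 2 + s = y + 1 by omega] at this
    have c1 : win x N (y + 1 + (l - 1 + s)) = c := by
      have := hzero (y + l) (by omega) fun r hr => by
        have := b1 (r + 1) (by omega) (by omega)
        rwa [show y + (l - 1) + (r + 1) = y + l + r by omega] at this
      rwa [show y + 1 + (l - 1 + s) = y + l + s by omega]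
    refine ⟨⟨by omega, c1.trans c0.symm, fun k h1 h2 => ?_⟩, c0, ?_⟩
    · rw [c0]
      rcases Nat.lt_or_ge (y + l) k with h | h
      · have := hone (k - s) (y + (l - 1)) (by omega) (by omega) (by omega) hl1
        rwa [show k - s + s = k by omega] at this
      · have := g.ones (k - 1 - y) (by omega) (by omega)
        have := hone (k - s) (k - 1) (by omega) (by omega) (by omega)
          (by rwa [show y + (k - 1 - y) = k - 1 by omega] at this)
        rwa [show k - s + s = k by omega] at this
    · rw [win_add, win_const (c := 1) (fun t ht => by
        have := g.ones (t + 1) (by omega) (by omega)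
        rwa [show y + 1 + t = y + (t + 1) by omega]),
        win_const (c := 0) (fun t ht => by
          have := b1 (t + 1) (by omega) (by omega)
          rwa [show y + 1 + (l - 1) + t = y + (l - 1) + (t + 1) by omega])]
      push_cast [Nat.cast_sub (show 1 ≤ l by omega)]; ring
  obtain ⟨r₁, c₁, e₁⟩ := key y₁ z₁ l₁ (by omega) one₁ f₁ hl₁ (by omega)
  obtain ⟨r₂, c₂, e₂⟩ := key y₂ z₂ l₂ (by omega) one₂ f₂ hl₂ (by omega)
  -- the return `0`
  obtain ⟨u, hu, hu1, hu2⟩ := h0.backward hx f₁.left (f₁.ones 1 (by omega) (by omega))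
    ⟨z₁ + 1, by omega, one₁⟩
  obtain ⟨a1, -⟩ := h0 u hu1 hu2
  have c₀ : win x N y₁ = c := by
    have := hzero (u + 1) (by omega) fun r hr => by
      rw [add_assoc]; exact a1 _ (by omega) (by omega)
    rwa [show u + 1 + s = y₁ by omega] at this
  have r₀ : Ret x N y₁ (y₁ + 1) := ⟨by omega, c₁.trans c₀.symm, fun k _ _ => by omega⟩
  -- the return around `j`
  have hjp : x (j - 1) = 1 := by
    by_contra hc
    have hc : x (j - 1) = 0 := (hx _).resolve_right hc
    obtain ⟨v, hv, hv1, hv2⟩ := h0.backward hx hc (by rwa [show j - 1 + 1 = j by omega])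
      ⟨z₁ + 1, by omega, one₁⟩
    have k1 := hm.agree v (by omega)
    have k2 := hm.agree (v + 1) (by omega)
    obtain ⟨-, k3⟩ := h0 (v + (N + s)) (k1.trans hv1) (by
      rw [hv2] at k2; rw [← k2]; congr 1; omega)
    rw [show v + (N + s) + (s + 1) + 1 = j + (N + s) by omega, hjn] at k3
    omega
  obtain ⟨b1, -⟩ := h0 (j - 1 + (N + s)) ((hm.agree _ (by omega)).trans hjp)
    (by rw [← hjn]; congr 1; omega)
  have hY : ∀ r, r < s + 1 → x (j + (N + s) + r) = 0 := fun r hr => by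
    rw [← b1 (r + 1) (by omega) (by omega)]; congr 1; omega
  obtain ⟨i, i', hi1, hij, hji, r, hc⟩ := hr.straddle (N := N) (i₀ := y₁) (m := j) (by omega)
  rw [c₀] at hc
  have hi'c : win x N i' = c := r.2.1.trans hc
  -- `T` is the first position after `j` whose window of length `N + s` has regained `c` ones. The
  -- stretch from `i` to `T` then has as many ones as its shift by `N + s`, and this shift contains
  -- the whole block of `s + 1` zeros at `j + (N + s)`.
  have hexT : ∃ t, j < t ∧ c ≤ win x (N + s) t := ⟨i', hji, by
    rw [win_add, hi'c]
    have := hx.win_nonneg s (i' + N)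
    linarith⟩
  classical
  obtain ⟨hT1, hT2⟩ := Nat.find_spec hexT
  have hTle : Nat.find hexT ≤ i' := Nat.find_le ⟨hji, by
    rw [win_add, hi'c]
    have := hx.win_nonneg s (i' + N)
    linarith⟩
  have hTmin := fun t (h : t < Nat.find hexT) => Nat.find_min hexT h
  set T := Nat.find hexT
  have hTb : j + (s + 1) < T := by
    by_contra hcon
    have e := win_slide x (N + s) j (T - j)
    rw [show j + (T - j) = T by omega, win_const (i := j + (N + s)) (c := 0)
      (fun r hr => hY r (by omega)), hm.win_eq le_rfl] at e
    have := hx.win_pos (l := T - j) (i := j) le_rfl (by omega) hj1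
    omega
  have hTc : win x (N + s) T = c := by
    have h1 := hTmin (T - 1) (by omega)
    have h2 := win_shift x (N + s) (T - 1)
    rw [show T - 1 + 1 = T by omega] at h2
    have h3 : win x (N + s) (T - 1) < c := by
      by_contra hge
      exact h1 ⟨by omega, by omega⟩
    rcases hx (T - 1 + (N + s)) with h | h <;> rcases hx (T - 1) with h' | h' <;> omega
  have hbound : win x (i' - i) i ≤ (i' - i : ℕ) - (s + 1 : ℕ) := by
    have e1 := win_slide x (N + s) i (T - i)
    rw [show i + (T - i) = T by omega, hTc, hm.win_eq hij] at e1
    have e2 := hx.win_le_sub_of_zeros (l := T - i) (i := i + (N + s)) (u := j + (N + s)) (b := s + 1)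
      (by omega) (by omega) hY
    have e3 := win_add x (T - i) (i' - T) i
    rw [show T - i + (i' - T) = i' - i by omega, show i + (T - i) = T by omega] at e3
    have e4 := hx.win_le (i' - T) T
    omega
  refine h3.four r₀ c₀ rfl (win_one x y₁) r₁ c₁ rfl e₁ r₂ c₂ rfl e₂ r hc
    (show i' = i + (i' - i) by omega) rfl (fun h _ => by omega) (fun h _ => by omega)
    (fun h _ => by omega) (fun _ h => hne (by omega)) (fun h h' => by omega) (fun h h' => by omega)

/-- A recurrent aperiodic binary word containing `00` and `11` has a class with four returns. -/
theorem AtMostThree.not_unbalanced_one (hx : IsBinary x) (hr : PrefixRecurrent x)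
    (ha : IsAperiodic x) (h3 : AtMostThree x) (i j : ℕ) : ¬ Unbalanced x 1 i j := by
  rintro ⟨h1, h2, h3', h4, -⟩
  by_cases hg : ThreeGaps x
  · by_cases hg' : ThreeGaps (swapLetters x)
    · obtain ⟨M, hM⟩ := h3.maxRepeat_ne_zero hx hr hg
      obtain ⟨M', hM'⟩ := h3.flip.maxRepeat_ne_zero hx.flip hr.flip hg'
      obtain ⟨n, k, -, hk, hm⟩ := hr.exists_maxRepeat ha (M + M') 0
      have e1 := hM n k (by omega) hm
      have e2 := hM' n k (by omega) hm.swapLetters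
      rw [swapLetters_apply] at e2
      rcases hx k with h | h <;> omega
    · obtain ⟨b, hb, h0⟩ := zeroBlocks_of_not_threeGaps hx hr hg' h1 h2 h3' h4
      exact h3.false_of_zeroBlocks hx hr ha hb h0 hg
  · have sw : ∀ k, x k = 0 → swapLetters x k = 1 := fun k h => by simp [swapLetters_apply, h]
    have sw' : ∀ k, x k = 1 → swapLetters x k = 0 := fun k h => by simp [swapLetters_apply, h]
    obtain ⟨k, hk, h1'⟩ := zeroBlocks_of_not_threeGaps (x := swapLetters x) hx.flip hr.flip
      (by rwa [swapLetters_swapLetters]) (sw' _ h3') (sw' _ h4) (sw _ h1) (sw _ h2)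
    by_cases hg' : ThreeGaps (swapLetters x)
    · exact h3.flip.false_of_zeroBlocks hx.flip hr.flip ha.flip hk h1' hg'
    · obtain ⟨b, hb, h0⟩ := zeroBlocks_of_not_threeGaps hx hr hg' h1 h2 h3' h4
      exact h0.not_aperiodic hx hr (by omega) (by omega) h1' h1 h3' ha

end AbelianReturns

/-! ### Minimal pairs `0P0`, `1P1` in which `P` has both letters -/

namespace AbelianReturns
variable {x : ℕ → ℤ}

/-- At the first length where balance fails, removing either end or splitting anywhere must restore
it. This fixes the outer letters and makes the inner ones agree. -/
lemma IsBinary.extremal_windows (hx : IsBinary x) {k a b : ℕ}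
    (hb : ∀ n, n ≤ k → ∀ i j, win x n j - win x n i ≤ 1)
    (h : 2 ≤ win x (k + 1) a - win x (k + 1) b) :
    win x (k + 1) a - win x (k + 1) b = 2 ∧ x a = 1 ∧ x b = 0 ∧ x (a + k) = 1 ∧ x (b + k) = 0 ∧
      ∀ t, 0 < t → t < k → x (a + t) = x (b + t) := by
  have p1 := win_succ x k a
  have p2 := win_succ x k b
  have p3 := win_succ' x k a
  have p4 := win_succ' x k b
  have q1 := hb k le_rfl b a
  have q2 := hb k le_rfl (b + 1) (a + 1)
  refine ⟨?_, ?_, ?_, ?_, ?_, fun t ht htk => ?_⟩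
  · rcases hx a with h | h <;> rcases hx b with h' | h' <;> omega
  · rcases hx a with h | h <;> rcases hx b with h' | h' <;> omega
  · rcases hx a with h | h <;> rcases hx b with h' | h' <;> omega
  · rcases hx (a + k) with h | h <;> rcases hx (b + k) with h' | h' <;> omega
  · rcases hx (a + k) with h | h <;> rcases hx (b + k) with h' | h' <;> omega
  · have key : ∀ c, win x (k + 1) c = win x t c + x (c + t) + win x (k - t) (c + t + 1) := fun c => by
      rw [show k + 1 = t + 1 + (k - t) by omega, win_add, win_succ]; rfl
    have s1 := key a
    have s2 := key b
    have t1 := hb t htk.le b a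
    have t2 := hb (t + 1) (by omega) b a
    have t3 := hb (k - t) (by omega) (b + t + 1) (a + t + 1)
    have t4 := hb (k - t + 1) (by omega) (b + t) (a + t)
    rw [win_succ, win_succ] at t2
    rw [win_succ', win_succ'] at t4
    rcases hx (a + t) with h | h <;> rcases hx (b + t) with h' | h' <;> omega

/-- The extremal numbers of ones in windows of length `k + 1` are `m - 1` and `m + 1`, attained at the
occurrences of one word each. -/
structure ExtremalPair (x : ℕ → ℤ) (k i₀ j₀ : ℕ) (m : ℤ) : Prop where
  bot_eq : win x (k + 1) i₀ = m - 1
  top_eq : win x (k + 1) j₀ = m + 1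
  le : ∀ a, win x (k + 1) a ≤ m + 1
  ge : ∀ a, m - 1 ≤ win x (k + 1) a
  top : ∀ a, win x (k + 1) a = m + 1 → ∀ t, t ≤ k → x (a + t) = x (j₀ + t)
  bot : ∀ a, win x (k + 1) a = m - 1 → ∀ t, t ≤ k → x (a + t) = x (i₀ + t)
  before_top : ∀ a, win x (k + 1) (a + 1) = m + 1 → x a = 0
  after_top : ∀ a, win x (k + 1) a = m + 1 → x (a + (k + 1)) = 0

lemma Unbalanced.exists_extremalPair (hx : IsBinary x) {k i₀ j₀ : ℕ} (hk : 0 < k)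
    (hu : Unbalanced x k i₀ j₀) (hmin : ∀ l, 0 < l → l < k → ∀ i j, ¬ Unbalanced x l i j)
    (hj : ∃ t, t ≤ k ∧ x (j₀ + t) = 0) : ∃ m, ExtremalPair x k i₀ j₀ m := by
  have hb := hx.win_sub_le hmin
  obtain ⟨a1, a2, b1, b2, hm⟩ := id hu
  set m := win x (k + 1) i₀ + 1 with hmdef
  have hf0 : win x (k + 1) i₀ = m - 1 := by rw [hmdef]; ring
  have hf1 : win x (k + 1) j₀ = m + 1 := by
    obtain ⟨l, rfl⟩ : ∃ l, k = l + 1 := ⟨k - 1, by omega⟩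
    have e1 := win_succ x (l + 1) i₀
    have e2 := win_succ x (l + 1) j₀
    have e3 := win_succ' x l i₀
    have e4 := win_succ' x l j₀
    have e5 : win x l (i₀ + 1) = win x l (j₀ + 1) := win_congr fun t ht => by
      have := hm (t + 1) (by omega) (by omega)
      rwa [show i₀ + 1 + t = i₀ + (t + 1) by omega, show j₀ + 1 + t = j₀ + (t + 1) by omega]
    omega
  have hle : ∀ a, win x (k + 1) a ≤ m + 1 := fun a => by
    by_contra hc
    have := (hx.extremal_windows (a := a) (b := i₀) hb (by omega)).1
    omega
  have hge : ∀ a, m - 1 ≤ win x (k + 1) a := fun a => by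
    by_contra hc
    have := (hx.extremal_windows (a := j₀) (b := a) hb (by omega)).1
    omega
  have top : ∀ a, win x (k + 1) a = m + 1 → ∀ t, t ≤ k → x (a + t) = x (j₀ + t) := by
    intro a hfa t ht
    obtain ⟨-, c1, -, c2, -, c3⟩ :=
      hx.extremal_windows (a := a) (b := i₀) hb (by omega)
    rcases Nat.eq_zero_or_pos t with rfl | h0
    · exact c1.trans b1.symm
    rcases Nat.lt_or_ge t k with h | h
    · rw [c3 t h0 h, hm t h0 h]
    · obtain rfl : t = k := by omega
      exact c2.trans b2.symm
  have bot : ∀ a, win x (k + 1) a = m - 1 → ∀ t, t ≤ k → x (a + t) = x (i₀ + t) := by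
    intro a hfa t ht
    obtain ⟨-, -, c1, -, c2, c3⟩ :=
      hx.extremal_windows (a := j₀) (b := a) hb (by omega)
    rcases Nat.eq_zero_or_pos t with rfl | h0
    · exact c1.trans a1.symm
    rcases Nat.lt_or_ge t k with h | h
    · rw [← c3 t h0 h, hm t h0 h]
    · obtain rfl : t = k := by omega
      exact c2.trans a2.symm
  -- Two successive occurrences of `1P1` would make it equal to its own shift, hence a power of `1`,
  -- although it contains a zero.
  have notop2 : ∀ a, win x (k + 1) a = m + 1 → win x (k + 1) (a + 1) = m + 1 → False := by
    intro a h h'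
    obtain ⟨t, ht, h0⟩ := hj
    have hone : ∀ s, s ≤ k → x (j₀ + s) = 1 := by
      intro s
      induction s with
      | zero => intro _; exact b1
      | succ s ih =>
        intro hs
        rw [← top a h (s + 1) hs, ← ih (by omega), ← top (a + 1) h' s (by omega)]
        congr 1; omega
    rw [hone t ht] at h0; omega
  have pre_top : ∀ a, win x (k + 1) (a + 1) = m + 1 → x a = 0 := by
    intro a h
    by_contra hc
    have hc : x a = 1 := (hx a).resolve_left hc
    have s := win_shift x (k + 1) a
    have := hle a
    rcases hx (a + (k + 1)) with h' | h'
    · omega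
    · exact notop2 a (by omega) h
  have post_top : ∀ a, win x (k + 1) a = m + 1 → x (a + (k + 1)) = 0 := by
    intro a h
    by_contra hc
    have hc : x (a + (k + 1)) = 1 := (hx _).resolve_left hc
    have s := win_shift x (k + 1) a
    have h1 := top a h 0 (by omega)
    rw [add_zero, add_zero, b1] at h1
    exact notop2 a h (by omega)
  exact ⟨m, hf0, hf1, hle, hge, top, bot, pre_top, post_top⟩

/-- Every zero begins an occurrence of `0 P 0`, or is followed by one of `1 P 1`, or begins `010` with
`0 P 0` occurring at the second zero. -/
def ZeroCases (x : ℕ → ℤ) (k : ℕ) (m : ℤ) : Prop :=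
  ∀ u, 0 < u → x u = 0 → win x (k + 1) u = m - 1 ∨ win x (k + 1) (u + 1) = m + 1 ∨
    (win x (k + 1) (u + 2) = m - 1 ∧ x (u + 2) = 0)

/-- Let `r` be the length of the first run of ones in `P`. The three cases make consecutive zeros
lie at distance `r + 1` or `r + 2`, and each distance determines the next. So the future of a zero
depends only on its letter at distance `r + 1`; of three zeros two share it, against aperiodicity.
-/
lemma ZeroCases.false (hx : IsBinary x) (hr : PrefixRecurrent x)
    (ha : IsAperiodic x) {k i₀ j₀ : ℕ} {m : ℤ}
    (hu : Unbalanced x k i₀ j₀) (hmin : ∀ l, 0 < l → l < k → ∀ i j, ¬ Unbalanced x l i j)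
    (h00 : ∀ t, x t = 0 → x (t + 1) = 1) (hj : ∃ t, t ≤ k ∧ x (j₀ + t) = 0)
    (top : ∀ a, win x (k + 1) a = m + 1 → ∀ t, t ≤ k → x (a + t) = x (j₀ + t))
    (bot : ∀ a, win x (k + 1) a = m - 1 → ∀ t, t ≤ k → x (a + t) = x (i₀ + t))
    (hcase : ZeroCases x k m) : False := by
  obtain ⟨a1, a2, b1, b2, hm⟩ := hu
  obtain ⟨b, hba, hbi⟩ := hr.factor i₀ (k + 1) 1
  have hxb : x b = 0 := by have := hbi 0 (by omega); rwa [add_zero, add_zero, a1] at this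
  -- the first block of ones of `0 P 0` has length `r`
  have hex : ∃ r, x (i₀ + (r + 1)) = 0 ∧ r + 1 < k := by
    obtain ⟨t, ht, h0⟩ := hj
    have t0 : t ≠ 0 := by rintro rfl; rw [add_zero] at h0; omega
    have tk : t ≠ k := by rintro rfl; omega
    exact ⟨t - 1, by rw [show t - 1 + 1 = t by omega, hm t (by omega) (by omega), h0], by omega⟩
  classical
  obtain ⟨hr0, hrk⟩ := Nat.find_spec hex
  have hrmin := fun t (h : t < Nat.find hex) => Nat.find_min hex h
  set r := Nat.find hex
  have hones : ∀ s, 0 < s → s ≤ r → x (i₀ + s) = 1 := fun s h1 h2 => by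
    refine (hx _).resolve_left fun h => hrmin (s - 1) (by omega) ⟨?_, by omega⟩
    rwa [show s - 1 + 1 = s by omega]
  have hr1 : 1 ≤ r := by
    by_contra hc
    have := h00 _ a1
    rw [show r + 1 = 1 by omega] at hr0; omega
  have hjones : ∀ s, s ≤ r → x (j₀ + s) = 1 := fun s hs => by
    rcases Nat.eq_zero_or_pos s with rfl | h0
    · exact b1
    · rw [← hm s h0 (by omega), hones s h0 hs]
  have hj0 : x (j₀ + (r + 1)) = 0 := by rw [← hm _ (by omega) hrk, hr0]
  -- For `r ≥ 2` the word `010` at `u` and the beginning `111` of `1P1` would be a shorter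
  -- unbalanced pair.
  have cr : ∀ u, win x (k + 1) (u + 2) = m - 1 → x (u + 2) = 0 → x u = 0 → r = 1 := by
    intro u _ h2 h0
    by_contra hc
    refine hmin 2 (by omega) (by omega) u j₀ ⟨h0, h2, b1, hjones 2 (by omega), fun t h4 h5 => ?_⟩
    obtain rfl : t = 1 := by omega
    rw [h00 u h0, hjones 1 (by omega)]
  have hgap : ∀ u, 0 < u → x u = 0 → ∀ s, 0 < s → s ≤ r → x (u + s) = 1 := by
    intro u hu0 hxu s h1 h2
    rcases hcase u hu0 hxu with h | h | ⟨h, h'⟩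
    · rw [bot u h s (by omega), hones s h1 h2]
    · have := top _ h (s - 1) (by omega)
      rw [hjones (s - 1) (by omega), show u + 1 + (s - 1) = u + s by omega] at this
      exact this
    · have := cr u h h' hxu
      obtain rfl : s = 1 := by omega
      exact h00 u hxu
  have h2r : 2 * r + 2 ≤ k := by
    by_contra hc
    have e1 := hbi (r + 1) (by omega)
    have e2 := hbi k (by omega)
    have := hgap (b + (r + 1)) (by omega) (e1.trans hr0) (k - (r + 1)) (by omega) (by omega)
    rw [show b + (r + 1) + (k - (r + 1)) = b + k by omega, e2, a2] at this
    omega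
  -- the distance to the next zero determines the following distance
  have next0 : ∀ u, 0 < u → x u = 0 → x (u + (r + 1)) = 0 →
      x (u + (r + 1) + (r + 1)) = x (i₀ + (2 * r + 2)) := by
    intro u hu0 hxu h
    rcases hcase u hu0 hxu with h' | h' | ⟨h', h''⟩
    · rw [← bot u h' _ h2r]; congr 1; omega
    · have := top _ h' r (by omega)
      rw [hjones r le_rfl, show u + 1 + r = u + (r + 1) by omega, h] at this
      omega
    · have hr' := cr u h' h'' hxu
      rw [hr'] at h hr0 ⊢
      have u4 := bot _ h' 2 (by omega)
      rw [show u + 2 + 2 = u + (1 + 1) + (1 + 1) by omega] at u4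
      rw [u4, show 2 = 1 + 1 from rfl, hr0]
      by_contra hne
      have hα : x (i₀ + 4) = 1 := (hx _).resolve_left fun h => hne h.symm
      have hk4 : 4 < k := by
        rcases Nat.lt_or_ge 4 k with h | h
        · exact h
        · have : k = 4 := by omega
          rw [this, hα] at a2; omega
      -- The pair is `01010` at `u` and `11011` at `j₀`, read with the common middle `101`.
      refine hmin 4 (by omega) hk4 u j₀ ⟨hxu, by rw [← hr0, ← u4], b1,
        by rw [← hm 4 (by omega) hk4, hα], fun t h4 h5 => ?_⟩
      interval_cases t
      · rw [h00 u hxu, ← hm 1 (by omega) (by omega), hones 1 (by omega) (by omega)]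
      · rw [h'', hj0.symm, hr']
      · rw [← hm 3 (by omega) (by omega), show u + 3 = u + 2 + 1 by omega, h00 _ h'']
        exact (h00 _ hr0).symm
  have next1 : ∀ u, 0 < u → x u = 0 → x (u + (r + 1)) = 1 →
      x (u + (r + 2)) = 0 ∧ x (u + (r + 2) + (r + 1)) = x (j₀ + (2 * r + 2)) := by
    intro u hu0 hxu h
    rcases hcase u hu0 hxu with h' | h' | ⟨h', h''⟩
    · have := bot u h' (r + 1) (by omega)
      rw [h, hr0] at this; omega
    · refine ⟨?_, ?_⟩
      · rw [← hj0, ← top _ h' (r + 1) (by omega)]; congr 1; omega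
      · rw [← top _ h' (2 * r + 2) (by omega)]; congr 1; omega
    · have hr' := cr u h' h'' hxu
      rw [hr'] at h
      rw [show u + (1 + 1) = u + 2 by omega, h''] at h; omega
  have fut : ∀ s u u', 0 < u → 0 < u' → x u = 0 → x u' = 0 → x (u + (r + 1)) = x (u' + (r + 1)) →
      x (u + s) = x (u' + s) := by
    intro s
    induction s using Nat.strong_induction_on with
    | _ s ih =>
      intro u u' hu0 hu0' h0 h0' heq
      rcases Nat.eq_zero_or_pos s with rfl | hs
      · exact h0.trans h0'.symm
      rcases Nat.lt_or_ge r s with hrs | hrs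
      · rcases hx (u + (r + 1)) with h | h
        · have := ih (s - (r + 1)) (by omega) (u + (r + 1)) (u' + (r + 1)) (by omega) (by omega) h
            (heq ▸ h) (by rw [next0 u hu0 h0 h, next0 u' hu0' h0' (heq ▸ h)])
          rwa [show u + (r + 1) + (s - (r + 1)) = u + s by omega,
            show u' + (r + 1) + (s - (r + 1)) = u' + s by omega] at this
        · rcases Nat.eq_or_lt_of_le (show r + 1 ≤ s from hrs) with rfl | hrs2
          · exact heq
          obtain ⟨c1, c2⟩ := next1 u hu0 h0 h
          obtain ⟨d1, d2⟩ := next1 u' hu0' h0' (heq ▸ h)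
          have := ih (s - (r + 2)) (by omega) (u + (r + 2)) (u' + (r + 2)) (by omega) (by omega) c1
            d1 (c2.trans d2.symm)
          rwa [show u + (r + 2) + (s - (r + 2)) = u + s by omega,
            show u' + (r + 2) + (s - (r + 2)) = u' + s by omega] at this
      · rw [hgap u hu0 h0 s hs hrs, hgap u' hu0' h0' s hs hrs]
  obtain ⟨u₁, g1, g1'⟩ := hr.factor i₀ 1 1
  obtain ⟨u₂, g2, g2'⟩ := hr.factor i₀ 1 (u₁ + 1)
  obtain ⟨u₃, g3, g3'⟩ := hr.factor i₀ 1 (u₂ + 1)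
  have z1 := g1' 0 (by omega)
  have z2 := g2' 0 (by omega)
  have z3 := g3' 0 (by omega)
  rw [add_zero, add_zero, a1] at z1 z2 z3
  have fin : ∀ u u', 0 < u → u < u' → x u = 0 → x u' = 0 → x (u + (r + 1)) ≠ x (u' + (r + 1)) :=
    fun u u' h1 h2 h3 h4 h5 => by
      have := ha.ne_of_future fun s => fut s u u' h1 (by omega) h3 h4 h5
      omega
  have f12 := fin u₁ u₂ (by omega) (by omega) z1 z2
  have f13 := fin u₁ u₃ (by omega) (by omega) z1 z3
  have f23 := fin u₂ u₃ (by omega) (by omega) z2 z3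
  rcases hx (u₁ + (r + 1)) with h | h <;> rcases hx (u₂ + (r + 1)) with h' | h' <;>
    rcases hx (u₃ + (r + 1)) with h'' | h'' <;> omega

set_option maxHeartbeats 1000000 in
/-- If no return of length two of the class with `m + 1` ones exists, the zeros are confined. -/
lemma ExtremalPair.zeroCases (hx : IsBinary x) {k i₀ j₀ : ℕ} {m : ℤ}
    (h00 : ∀ t, x t = 0 → x (t + 1) = 1) (hE : ExtremalPair x k i₀ j₀ m)
    (a1 : x i₀ = 0) (b1 : x j₀ = 1)
    (hno2 : ∀ t, Ret x (k + 1 + 1) t (t + 2) → win x (k + 1 + 1) t ≠ m + 1) : ZeroCases x k m := by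
  obtain ⟨-, -, hle, hge, top, bot, pre_top, -⟩ := hE
  have hv : ∀ t, win x (k + 1 + 1) t = x t + win x (k + 1) (t + 1) := fun t => win_succ' x _ t
  intro u hu0 hxu
  obtain ⟨t, rfl⟩ : ∃ t, u = t + 1 := ⟨u - 1, by omega⟩
  have hxt : x t = 1 := (hx t).resolve_left fun h => by rw [h00 t h] at hxu; omega
  have hxt2 : x (t + 2) = 1 := h00 _ hxu
  by_contra hcon
  push Not at hcon
  obtain ⟨c1, c2, c3⟩ := hcon
  have n1 : win x (k + 1) (t + 1) ≠ m + 1 := fun h => by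
    have := top _ h 0 (by omega)
    rw [add_zero, add_zero, hxu, b1] at this; omega
  have n2 : win x (k + 1) (t + 2) ≠ m - 1 := fun h => by
    have := bot _ h 0 (by omega)
    rw [add_zero, add_zero, hxt2, a1] at this; omega
  have n3 : win x (k + 1) (t + 3) ≠ m + 1 := fun h => by
    have := pre_top (t + 2) h
    omega
  have n4 : win x (k + 1) (t + 3) ≠ m - 1 := fun h => by
    have := bot _ h 0 (by omega)
    rw [add_zero, add_zero, a1] at this
    exact c3 h this
  have f1 : win x (k + 1) (t + 1) = m := by have := hle (t + 1); have := hge (t + 1); omega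
  have f2 : win x (k + 1) (t + 2) = m := by
    have := hle (t + 2); have := hge (t + 2)
    have : win x (k + 1) (t + 2) ≠ m + 1 := c2
    omega
  have f3 : win x (k + 1) (t + 3) = m := by have := hle (t + 3); have := hge (t + 3); omega
  have v0 : win x (k + 1 + 1) t = m + 1 := by rw [hv, hxt, f1]; ring
  have v1 : win x (k + 1 + 1) (t + 1) = m := by
    rw [hv, hxu, show t + 1 + 1 = t + 2 by omega, f2]; ring
  have v2 : win x (k + 1 + 1) (t + 2) = m + 1 := by
    rw [hv, hxt2, show t + 2 + 1 = t + 3 by omega, f3]; ring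
  refine hno2 t ⟨by omega, by rw [v0, v2], fun s h1 h2 => ?_⟩ v0
  obtain rfl : s = t + 1 := by omega
  omega

/-- A word with a minimal unbalanced pair `0 P 0`, `1 P 1` in which `P` contains both letters has a
class with four returns. -/
theorem AtMostThree.false_of_unbalanced_mixed (hx : IsBinary x) (hr : PrefixRecurrent x)
    (ha : IsAperiodic x) (h3 : AtMostThree x) {k i₀ j₀ : ℕ} (hk : 2 ≤ k)
    (hu : Unbalanced x k i₀ j₀) (hmin : ∀ l, 0 < l → l < k → ∀ i j, ¬ Unbalanced x l i j)
    (h00 : ∀ t, x t = 0 → x (t + 1) = 1) (hj : ∃ t, t ≤ k ∧ x (j₀ + t) = 0) : False := by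
  obtain ⟨m, hE⟩ := hu.exists_extremalPair hx (by omega) hmin hj
  obtain ⟨hf0, hf1, hle, hge, top, bot, pre_top, post_top⟩ := id hE
  obtain ⟨a1, a2, b1, b2, hm⟩ := id hu
  have hv : ∀ t, win x (k + 1 + 1) t = x t + win x (k + 1) (t + 1) := fun t => win_succ' x _ t
  have v_top : ∀ a, win x (k + 1) a = m + 1 → win x (k + 1 + 1) a = m + 1 := fun a h => by
    have := post_top a h
    rw [win_succ, h, this]; ring
  -- the returns `0`, `1`
  obtain ⟨a, ha2, haj⟩ := hr.factor j₀ (k + 1) 2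
  have hfa : win x (k + 1) a = m + 1 := by rw [win_congr haj, hf1]
  obtain ⟨a, rfl⟩ : ∃ a', a = a' + 2 := ⟨a - 2, by omega⟩
  have hxa1 : x (a + 1) = 0 := pre_top _ hfa
  have hxa : x a = 1 := (hx a).resolve_left fun h => by rw [h00 a h] at hxa1; omega
  have va2 := v_top _ hfa
  have va1 : win x (k + 1 + 1) (a + 1) = m + 1 := by rw [hv, hxa1, hfa]; ring
  have va : win x (k + 1 + 1) a = m + 1 := by
    have s := win_shift x (k + 1 + 1) a
    have := haj k (by omega)
    rw [b2, show a + 2 + k = a + (k + 1 + 1) by omega] at this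
    omega
  have r₀ : Ret x (k + 1 + 1) (a + 1) (a + 2) := ⟨by omega, by rw [va1, va2], fun t _ _ => by omega⟩
  have r₁ : Ret x (k + 1 + 1) a (a + 1) := ⟨by omega, by rw [va1, va], fun t _ _ => by omega⟩
  -- the return around `0 P 0`
  obtain ⟨b, hba, hbi⟩ := hr.factor i₀ (k + 1) (a + 2)
  have hfb : win x (k + 1) b = m - 1 := by rw [win_congr hbi, hf0]
  have hxb : x b = 0 := by have := hbi 0 (by omega); rwa [add_zero, add_zero, a1] at this
  have hxb1 : x (b - 1) = 1 := (hx _).resolve_left fun h => by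
    have := h00 _ h
    rw [show b - 1 + 1 = b by omega, hxb] at this
    omega
  have vb : win x (k + 1 + 1) b = m := by
    have h1 := hbi k (by omega)
    have h2 := h00 (b + k) (h1.trans a2)
    rw [win_succ, hfb, show b + (k + 1) = b + k + 1 by omega, h2]; ring
  have vb1 : win x (k + 1 + 1) (b - 1) = m := by
    rw [hv, show b - 1 + 1 = b by omega, hxb1, hfb]; ring
  obtain ⟨i, j, hi1, hib, hbj, r₂, hc⟩ := hr.straddle (N := k + 1 + 1) (i₀ := a) (m := b) (by omega)
  rw [va] at hc
  -- Both `b - 1` and `b` have only `m` ones, so the return jumps over two positions and has length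
  -- at least three.
  have hib1 : i + 1 < b := by
    by_contra hcon
    rcases (show i = b ∨ i = b - 1 by omega) with rfl | rfl
    · omega
    · omega
  obtain ⟨l, rfl⟩ : ∃ l, j = i + l := ⟨j - i, by omega⟩
  have hl : 3 ≤ l := by omega
  -- A return of length two would be the fourth, next to `0`, `1` and one of length at least three.
  -- Without it the zeros are confined.
  refine ZeroCases.false hx hr ha hu hmin h00 hj top bot (hE.zeroCases hx h00 a1 b1 fun t r₃ hc3 => ?_)
  clear hib1 hbj hib hi1 vb1 vb hxb1 hxb hfb
  exact h3.four r₀ va1 rfl rfl r₁ va rfl rfl r₂ hc rfl rfl r₃ hc3 rfl rfl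
    (fun _ h => by rw [win_one, win_one, hxa1, hxa] at h; exact absurd h (by decide))
    (fun h _ => by rw [← h] at hl; exact absurd hl (by decide))
    (fun h _ => absurd h (by decide))
    (fun h _ => by rw [← h] at hl; exact absurd hl (by decide))
    (fun h _ => absurd h (by decide))
    (fun h _ => by rw [h] at hl; exact absurd hl (by decide))

end AbelianReturns

/-! ### Constant `P`: the word of distances between ones -/

namespace AbelianReturns
variable {x : ℕ → ℤ}

/-- The increasing sequence `ζ` enumerates the positions `≥ ζ 0` of the letter `1`. -/
structure OneEnum (x : ℕ → ℤ) (ζ : ℕ → ℕ) : Prop where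
  one : ∀ n, x (ζ n) = 1
  lt : ∀ n, ζ n < ζ (n + 1)
  zero : ∀ n t, ζ n < t → t < ζ (n + 1) → x t = 0

variable {ζ : ℕ → ℕ} {y : ℕ → ℤ} {k D : ℕ}

lemma OneEnum.exists_of_one (hx : IsBinary x) (hr : PrefixRecurrent x) {z : ℕ} (hz : x z = 1) :
    ∃ ζ, OneEnum x ζ := by
  choose f hf using fun i => hr.next_ret 1 i
  let g : ℕ → ℕ := fun n => f^[n] z
  have hg : ∀ n, g (n + 1) = f (g n) := fun n => Function.iterate_succ_apply' f n z
  have h1 : ∀ n, x (g n) = 1 := by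
    intro n
    induction n with
    | zero => exact hz
    | succ n ih =>
      have := (hf (g n)).2.1
      rw [win_one, win_one, ih] at this
      rw [hg, this]
  refine ⟨g, h1, fun n => hg n ▸ (hf (g n)).1, fun n t h2 h3 => ?_⟩
  have := (hf (g n)).2.2 t h2 (hg n ▸ h3)
  rw [win_one, win_one, h1] at this
  exact (hx t).resolve_right this

lemma OneEnum.strictMono (he : OneEnum x ζ) : StrictMono ζ := strictMono_nat_of_lt_succ he.lt

lemma OneEnum.locate (he : OneEnum x ζ) {t : ℕ} (h : ζ 0 < t) : ∃ n, ζ n < t ∧ t ≤ ζ (n + 1) := by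
  induction t, h using Nat.le_induction with
  | base => exact ⟨0, by omega, he.lt 0⟩
  | succ t ht ih =>
    obtain ⟨n, h1, h2⟩ := ih
    rcases Nat.lt_or_ge t (ζ (n + 1)) with h | h
    · exact ⟨n, by omega, h⟩
    · exact ⟨n + 1, by omega, by have := he.lt (n + 1); omega⟩

lemma OneEnum.exists_eq (he : OneEnum x ζ) {t : ℕ} (h : ζ 0 < t) (ht : x t = 1) : ∃ n, ζ n = t := by
  obtain ⟨n, h1, h2⟩ := he.locate h
  refine ⟨n + 1, le_antisymm ?_ h2⟩
  by_contra hc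
  have := he.zero n t h1 (by omega)
  omega

lemma OneEnum.psum_eq (he : OneEnum x ζ) : ∀ n t, ζ n < t → t ≤ ζ (n + 1) →
    psum x t = psum x (ζ 0) + n + 1 := by
  have step : ∀ n, psum x (ζ n) = psum x (ζ 0) + n → ∀ t, ζ n < t → t ≤ ζ (n + 1) →
      psum x t = psum x (ζ 0) + n + 1 := by
    intro n hn t h
    induction t, h using Nat.le_induction with
    | base => intro _; rw [psum_succ, hn, he.one]
    | succ t ht ih =>
      intro h2
      rw [psum_succ, ih (by omega), he.zero n t (by omega) (by omega)]; ring
  intro n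
  refine step n ?_
  induction n with
  | zero => simp
  | succ n ih => rw [step n ih _ (he.lt n) le_rfl]; push_cast; ring

lemma OneEnum.win_eq (he : OneEnum x ζ) {N n m t : ℕ} (h1 : ζ n < t) (h2 : t ≤ ζ (n + 1))
    (h3 : ζ m < t + N) (h4 : t + N ≤ ζ (m + 1)) : win x N t = m - n := by
  rw [win, he.psum_eq n t h1 h2, he.psum_eq m _ h3 h4]; ring

lemma OneEnum.le_win (he : OneEnum x ζ) {N n m t : ℕ} (h1 : ζ n < t) (h2 : t ≤ ζ (n + 1))
    (h3 : ζ m < t + N) : (m : ℤ) - n ≤ win x N t := by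
  obtain ⟨p, h4, h5⟩ := he.locate (t := t + N) (by
    have := he.strictMono.monotone (Nat.zero_le n); omega)
  rw [he.win_eq h1 h2 h4 h5]
  have : m < p + 1 := he.strictMono.lt_iff_lt.1 (lt_of_lt_of_le h3 h5)
  omega

/-- The distances in `ζ` are `k` and `D`, as told by the letters of `y`. -/
structure TwoGaps (ζ : ℕ → ℕ) (y : ℕ → ℤ) (k D : ℕ) : Prop where
  gap : ∀ n, (y n = 0 ∧ ζ (n + 1) = ζ n + k) ∨ (y n = 1 ∧ ζ (n + 1) = ζ n + D)
  ne : k ≠ D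

lemma TwoGaps.isBinary (h : TwoGaps ζ y k D) : IsBinary y := fun n => (h.gap n).imp And.left And.left

lemma TwoGaps.of_zero (h : TwoGaps ζ y k D) {n : ℕ} (hn : y n = 0) : ζ (n + 1) = ζ n + k := by
  rcases h.gap n with h | h
  · exact h.2
  · rw [hn] at h; omega

lemma TwoGaps.of_one (h : TwoGaps ζ y k D) {n : ℕ} (hn : y n = 1) : ζ (n + 1) = ζ n + D := by
  rcases h.gap n with h | h
  · rw [hn] at h; omega
  · exact h.2

lemma TwoGaps.eq_add (h : TwoGaps ζ y k D) (n s : ℕ) :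
    (ζ (n + s) : ℤ) = ζ n + s * k + (D - k) * win y s n := by
  induction s with
  | zero => simp [win_zero]
  | succ s ih =>
    rw [win_succ]
    rcases h.gap (n + s) with ⟨h1, h2⟩ | ⟨h1, h2⟩
    · rw [h1, ← add_assoc, h2]; push_cast; rw [ih]; ring
    · rw [h1, ← add_assoc, h2]; push_cast; rw [ih]; ring

lemma TwoGaps.future (h : TwoGaps ζ y k D) (he : OneEnum x ζ) {a b : ℕ}
    (hab : ∀ t, y (a + t) = y (b + t)) : ∀ t, x (ζ a + t) = x (ζ b + t) := by
  have hs : ∀ s, ζ (a + s) - ζ a = ζ (b + s) - ζ b := fun s => by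
    have h1 := h.eq_add a s
    have h2 := h.eq_add b s
    rw [win_congr (fun t _ => hab t)] at h1
    omega
  have hma := he.strictMono.monotone
  intro t
  rcases Nat.eq_zero_or_pos t with rfl | ht
  · rw [add_zero, add_zero, he.one, he.one]
  obtain ⟨n, h1, h2⟩ := he.locate (t := ζ a + t) (by have := hma (Nat.zero_le a); omega)
  have han : a ≤ n := by
    have : a < n + 1 := he.strictMono.lt_iff_lt.1 (show ζ a < ζ (n + 1) by omega)
    omega
  obtain ⟨s, rfl⟩ := Nat.exists_eq_add_of_le han
  have e1 := hs s
  have e2 := hs (s + 1)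
  have m1 := hma (Nat.le_add_right a s)
  have m2 := hma (Nat.le_add_right b s)
  have m3 := hma (Nat.le_add_right a (s + 1))
  have m4 := hma (Nat.le_add_right b (s + 1))
  rcases Nat.eq_or_lt_of_le h2 with h3 | h3
  · rw [h3, he.one, show ζ b + t = ζ (b + (s + 1)) by rw [← add_assoc] at e2 m3; omega, he.one]
  · rw [he.zero _ _ h1 h3, he.zero (b + s) _ (by omega) (by simp only [← add_assoc] at e2 m3 m4; omega)]

lemma TwoGaps.aperiodic (h : TwoGaps ζ y k D) (he : OneEnum x ζ) (ha : IsAperiodic x) :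
    IsAperiodic y := by
  rintro ⟨T, hT, n₀, hn⟩
  have := ha.ne_of_future (h.future he (a := n₀ + T) (b := n₀) fun t => by
    rw [show n₀ + T + t = n₀ + t + T by omega]; exact hn _ (by omega))
  have := he.strictMono.injective this
  omega

/-- A recurrence of a prefix of `x` past `ζ M` carries the enumerated ones to consecutive ones, so
the first `M` distances recur. -/
lemma TwoGaps.prefixRecurrent (h : TwoGaps ζ y k D) (he : OneEnum x ζ) (hr : PrefixRecurrent x) :
    PrefixRecurrent y := by
  intro M b
  obtain ⟨q, hq, hqt⟩ := hr (ζ M + 1) (ζ b + 1)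
  have hma := he.strictMono.monotone
  have h0 := hma (Nat.zero_le b)
  obtain ⟨n, hn⟩ := he.exists_eq (t := q + ζ 0) (by omega) (by
    rw [hqt _ (by have := hma (Nat.zero_le M); omega), he.one])
  have key : ∀ s, s ≤ M → ζ (n + s) = q + ζ s := by
    intro s
    induction s with
    | zero => intro _; exact hn
    | succ s ih =>
      intro hs
      have ih := ih (by omega)
      have l1 := he.lt s
      have l2 := he.lt (n + s)
      have l3 := hma hs
      rcases lt_trichotomy (ζ (n + s + 1)) (q + ζ (s + 1)) with hc | hc | hc
      · have e1 := he.one (n + s + 1)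
        have e2 := hqt (ζ (n + s + 1) - q) (by omega)
        rw [show q + (ζ (n + s + 1) - q) = ζ (n + s + 1) by omega, e1,
          he.zero s _ (by omega) (by omega)] at e2
        omega
      · exact hc
      · have e2 := hqt (ζ (s + 1)) (by omega)
        rw [he.one, he.zero (n + s) _ (by omega) hc] at e2
        omega
  refine ⟨n, ?_, fun t ht => ?_⟩
  · exact (he.strictMono.lt_iff_lt.1 (show ζ b < ζ n by omega)).le
  · have k1 := key t (by omega)
    have k2 := key (t + 1) (by omega)
    have hne := h.ne
    rcases h.gap (n + t) with h1 | h1 <;> rcases h.gap t with h2 | h2 <;>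
      first | (rw [h1.1, h2.1]; done) | (rw [← add_assoc] at k2; omega)

end AbelianReturns

/-! ### Constant `P`: runs of long distances -/

namespace AbelianReturns
variable {x : ℕ → ℤ}
variable {ζ : ℕ → ℕ} {y : ℕ → ℤ} {k D b m₀ : ℕ}

lemma TwoGaps.lt_add (ht : TwoGaps ζ y k D) (hD : k ≤ D) (n : ℕ) : ζ n + k ≤ ζ (n + 1) := by
  rcases ht.gap n with ⟨-, h⟩ | ⟨-, h⟩ <;> omega

/-- The window is two longer than `b` short distances and one long one. To contain their `b + 2`
ones it must start at the first one or immediately before it. One more one cannot fit because `2 ≤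
k`. -/
lemma TwoGaps.win_eq_iff (ht : TwoGaps ζ y k D) (he : OneEnum x ζ) (hk : 2 ≤ k) (hD : k + 2 ≤ D)
    (h1 : ∀ m, m₀ ≤ m → 1 ≤ win y (b + 1) m) {n t : ℕ} (hn : m₀ ≤ n) (hnt : ζ n < t)
    (htn : t ≤ ζ (n + 1)) :
    win x (b * k + D + 2) t = b + 2 ↔ win y (b + 1) (n + 1) = 1 ∧ ζ (n + 1) ≤ t + 1 := by
  have e := ht.eq_add (n + 1) (b + 1)
  have hW := h1 (n + 1) (by omega)
  rw [show n + 1 + (b + 1) = n + b + 2 by omega] at e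
  push_cast at e
  set W := win y (b + 1) (n + 1)
  have hD' : (k : ℤ) + 2 ≤ D := by exact_mod_cast hD
  constructor
  · intro h
    have hs := he.strictMono.monotone (Nat.zero_le n)
    obtain ⟨p, h2, h3⟩ := he.locate (t := t + (b * k + D + 2)) (by omega)
    rw [he.win_eq hnt htn h2 h3] at h
    obtain rfl : p = n + b + 2 := by omega
    have h2' : (ζ (n + b + 2) : ℤ) < t + (b * k + D + 2) := by exact_mod_cast h2
    have htn' : (t : ℤ) ≤ ζ (n + 1) := by exact_mod_cast htn
    -- A second long distance lengthens the span by `D - k ≥ 2`, too much for the window.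
    have hW1 : W = 1 := by
      by_contra hc
      have : 2 ≤ W := by omega
      nlinarith
    refine ⟨hW1, ?_⟩
    rw [hW1] at e
    have : (ζ (n + 1) : ℤ) < t + 2 := by nlinarith
    omega
  · rintro ⟨h2, h3⟩
    rw [h2] at e
    have e' : ζ (n + b + 2) = ζ (n + 1) + b * k + D := by
      have : (ζ (n + b + 2) : ℤ) = ζ (n + 1) + b * k + D := by rw [e]; ring
      exact_mod_cast this
    have := ht.lt_add (by omega) (n + b + 2)
    rw [he.win_eq hnt htn (m := n + b + 2) (by omega) (by omega)]
    push_cast; ring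

/-- Each position of the class in `y` gives two adjacent positions of the class in `x`, namely `ζ n
- 1` and `ζ n`. A return in `y` thus becomes a return from `ζ n` to one letter before the next
marked one, whence the `- 1` in its length. -/
lemma TwoGaps.ret_of_ret (ht : TwoGaps ζ y k D) (he : OneEnum x ζ) (hk : 2 ≤ k) (hD : k + 2 ≤ D)
    (h1 : ∀ m, m₀ ≤ m → 1 ≤ win y (b + 1) m) {n l : ℕ} (hn : m₀ < n) (r : Ret y (b + 1) n (n + l))
    (c : win y (b + 1) n = 1) :
    ∃ L : ℕ, Ret x (b * k + D + 2) (ζ n) (ζ n + L) ∧ win x (b * k + D + 2) (ζ n) = b + 2 ∧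
      win x L (ζ n) = l ∧ (L : ℤ) = l * k + (D - k) * win y l n - 1 := by
  obtain ⟨n, rfl⟩ : ∃ n', n = n' + 1 := ⟨n - 1, by omega⟩
  have hl : 0 < l := by have := r.1; omega
  obtain ⟨l, rfl⟩ : ∃ l', l = l' + 1 := ⟨l - 1, by omega⟩
  have e := ht.eq_add (n + 1) (l + 1)
  have g1 := ht.lt_add (by omega) (n + (l + 1))
  have g2 := he.strictMono.monotone (show n + 1 ≤ n + (l + 1) by omega)
  have hm : n + 1 + (l + 1) = n + (l + 1) + 1 := by omega
  rw [hm] at e r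
  have c1 : win x (b * k + D + 2) (ζ (n + 1)) = b + 2 :=
    (ht.win_eq_iff he hk hD h1 (by omega) (he.lt n) le_rfl).2 ⟨c, by omega⟩
  have hL : ζ (n + 1) + (ζ (n + (l + 1) + 1) - 1 - ζ (n + 1)) = ζ (n + (l + 1) + 1) - 1 := by omega
  have c2 : win x (b * k + D + 2) (ζ (n + (l + 1) + 1) - 1) = b + 2 :=
    (ht.win_eq_iff he hk hD h1 (n := n + (l + 1)) (by omega) (by omega) (by omega)).2
      ⟨r.2.1.trans c, by omega⟩
  refine ⟨ζ (n + (l + 1) + 1) - 1 - ζ (n + 1), ⟨by omega, ?_, fun t h2 h3 h4 => ?_⟩, c1, ?_, ?_⟩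
  · rw [hL, c1, c2]
  · rw [hL] at h3
    obtain ⟨p, h5, h6⟩ := he.locate (t := t) (by have := he.strictMono.monotone (Nat.zero_le (n + 1)); omega)
    have p1 : n + 1 < p + 1 := he.strictMono.lt_iff_lt.1 (lt_of_lt_of_le h2 h6)
    have p2 : p < n + (l + 1) + 1 := he.strictMono.lt_iff_lt.1 (by omega)
    obtain ⟨h7, h8⟩ := (ht.win_eq_iff he hk hD h1 (by omega) h5 h6).1 (h4.trans c1)
    rcases Nat.lt_or_ge (p + 1) (n + (l + 1) + 1) with h | h
    · exact r.2.2 (p + 1) p1 h (h7.trans c.symm)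
    · obtain rfl : p = n + (l + 1) := by omega
      omega
  · rw [he.win_eq (n := n) (m := n + (l + 1)) (he.lt n) le_rfl (by omega) (by omega)]
    push_cast; ring
  · omega

/-- Three types of returns in the derived word give four types in the word. -/
lemma AtMostThree.false_of_three_derived (h3 : AtMostThree x) (ht : TwoGaps ζ y k D)
    (he : OneEnum x ζ) (hk : 2 ≤ k) (hD : k + 2 ≤ D)
    (h1 : ∀ m, m₀ ≤ m → 1 ≤ win y (b + 1) m) {n₁ n₂ n₃ l₁ l₂ l₃ : ℕ} (g₁ : m₀ < n₁) (g₂ : m₀ < n₂)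
    (g₃ : m₀ < n₃)
    (r₁ : Ret y (b + 1) n₁ (n₁ + l₁)) (c₁ : win y (b + 1) n₁ = 1)
    (r₂ : Ret y (b + 1) n₂ (n₂ + l₂)) (c₂ : win y (b + 1) n₂ = 1)
    (r₃ : Ret y (b + 1) n₃ (n₃ + l₃)) (c₃ : win y (b + 1) n₃ = 1)
    (h12 : l₁ = l₂ → win y l₁ n₁ = win y l₂ n₂ → False)
    (h13 : l₁ = l₃ → win y l₁ n₁ = win y l₃ n₃ → False)
    (h23 : l₂ = l₃ → win y l₂ n₂ = win y l₃ n₃ → False) : False := by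
  obtain ⟨L₁, R₁, C₁, E₁, F₁⟩ := ht.ret_of_ret he hk hD h1 g₁ r₁ c₁
  obtain ⟨L₂, R₂, C₂, E₂, F₂⟩ := ht.ret_of_ret he hk hD h1 g₂ r₂ c₂
  obtain ⟨L₃, R₃, C₃, E₃, F₃⟩ := ht.ret_of_ret he hk hD h1 g₃ r₃ c₃
  obtain ⟨n, rfl⟩ : ∃ n', n₁ = n' + 1 := ⟨n₁ - 1, by omega⟩
  have g := ht.lt_add (by omega) n
  have C₀ : win x (b * k + D + 2) (ζ (n + 1) - 1) = b + 2 :=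
    (ht.win_eq_iff he hk hD h1 (n := n) (by omega) (by omega) (by omega)).2 ⟨c₁, by omega⟩
  have hs : ζ (n + 1) - 1 + 1 = ζ (n + 1) := by omega
  have R₀ : Ret x (b * k + D + 2) (ζ (n + 1) - 1) (ζ (n + 1)) :=
    ⟨by omega, by rw [C₁, C₀], fun t _ _ => by omega⟩
  have E₀ : win x 1 (ζ (n + 1) - 1) = 0 := by
    rw [win_one]; exact he.zero n _ (by omega) (by omega)
  have p1 : l₁ ≠ 0 := by rintro rfl; have := r₁.1; omega
  have p2 : l₂ ≠ 0 := by rintro rfl; have := r₂.1; omega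
  have p3 : l₃ ≠ 0 := by rintro rfl; have := r₃.1; omega
  have hne : (D : ℤ) - k ≠ 0 := by omega
  -- As `D ≠ k`, the length of the return and its number of ones recover the type of the derived
  -- return.
  have cancel : ∀ {L L' l l' : ℕ} {o o' : ℤ}, (L : ℤ) = l * k + (D - k) * o - 1 →
      (L' : ℤ) = l' * k + (D - k) * o' - 1 → (l = l' → o = o' → False) → L = L' →
      (l : ℤ) = l' → False := by
    intro L L' l l' o o' h h' hd e1 e2
    refine hd (by exact_mod_cast e2) (mul_left_cancel₀ hne ?_)
    rw [e1, e2] at h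
    linarith
  exact h3.four R₀ C₀ hs.symm E₀ R₁ C₁ rfl E₁ R₂ C₂ rfl E₂ R₃ C₃ rfl E₃
    (fun _ h => p1 (by exact_mod_cast h.symm)) (fun _ h => p2 (by exact_mod_cast h.symm))
    (fun _ h => p3 (by exact_mod_cast h.symm)) (cancel F₁ F₂ h12) (cancel F₁ F₃ h13)
    (cancel F₂ F₃ h23)

/-- Runs of zeros of a fixed length but runs of ones of two lengths in the derived word. -/
lemma AtMostThree.false_of_derived_zeroBlocks (h3 : AtMostThree x) (ht : TwoGaps ζ y k D)
    (he : OneEnum x ζ) (hk : 2 ≤ k) (hD : k + 2 ≤ D) (hr : PrefixRecurrent y) (hb : 0 < b)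
    (h0 : ZeroBlocks y b) {p₁ p₂ l₁ l₂ : ℕ} (hl₁ : 2 ≤ l₁) (hl : l₁ < l₂)
    (G₁ : ZeroGap y p₁ l₁) (G₂ : ZeroGap y p₂ l₂) : False := by
  have hy := ht.isBinary
  -- from the first one on, there is a one among any `b + 1` letters
  obtain ⟨m₀, hm₀⟩ : ∃ m, y m = 1 := ⟨p₂ + 1, G₂.ones 1 (by omega) (by omega)⟩
  have h1 : ∀ m, m₀ ≤ m → 1 ≤ win y (b + 1) m := by
    intro m hm
    by_contra hc
    have hz : ∀ t, t ≤ b → y (m + t) = 0 := fun t htb => by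
      by_contra hc'
      have := hy.win_pos (l := b + 1) (i := m) (u := m + t) (by omega) (by omega)
        ((hy _).resolve_left hc')
      omega
    classical
    have hs := Nat.findGreatest_spec (P := fun u => y u = 1) hm hm₀
    have hle := Nat.findGreatest_le (P := fun u => y u = 1) m
    have hgr : ∀ k, Nat.findGreatest (fun u => y u = 1) m < k → k ≤ m → ¬ y k = 1 :=
      fun k h1 h2 => Nat.findGreatest_is_greatest (P := fun u => y u = 1) h1 h2
    set u := Nat.findGreatest (fun u => y u = 1) m
    have hne : u ≠ m := fun h => by have := hz 0 (by omega); rw [add_zero, ← h, hs] at this; omega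
    obtain ⟨-, h2⟩ := h0 u hs ((hy _).resolve_right (hgr _ (by omega) (by omega)))
    rcases Nat.lt_or_ge m (u + b + 1) with h | h
    · have := hz (u + b + 1 - m) (by omega)
      rw [show m + (u + b + 1 - m) = u + b + 1 by omega] at this
      omega
    · exact hgr _ (by omega) h h2
  -- the returns around the runs of ones
  have main : ∀ p l, 2 ≤ l → ZeroGap y p l → ∃ n, m₀ < n ∧ win y (b + 1) n = 1 ∧
      ((3 ≤ l ∧ Ret y (b + 1) n (n + (b + (l - 2)))) ∨
        (l = 2 ∧ Ret y (b + 1) n (n + 1) ∧ win y 1 n = 0)) := by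
    intro p l hl2 G
    obtain ⟨q, hq, hqp⟩ := hr.factor p (l + 1) (m₀ + b + 2)
    have hq0 : y q = 0 := by rw [← G.left]; exact hqp 0 (by omega)
    have hq1 : ∀ t, 0 < t → t < l → y (q + t) = 1 := fun t h h' => by
      rw [hqp t (by omega), G.ones t h h']
    have hql : y (q + l) = 0 := by rw [hqp l (by omega), G.right]
    obtain ⟨u, hu, hu1, hu2⟩ := h0.backward hy hq0 (hq1 1 (by omega) (by omega)) ⟨m₀, by omega, hm₀⟩
    obtain ⟨h0u, -⟩ := h0 u hu1 hu2
    have c1 : win y (b + 1) (u + 1) = 1 := by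
      rw [win_succ, win_const (c := 0) fun t htb => by
        rw [show u + 1 + t = u + (t + 1) by omega]; exact h0u _ (by omega) (by omega),
        show u + 1 + b = q + 1 by omega, hq1 1 (by omega) (by omega)]
      ring
    refine ⟨u + 1, by omega, c1, ?_⟩
    rcases Nat.lt_or_ge 2 l with h | h
    · left
      refine ⟨h, by omega, ?_, fun t h4 h5 h6 => ?_⟩
      · have hend : y (q + (l - 1)) = 1 := hq1 _ (by omega) (by omega)
        have hend' : y (q + (l - 1) + 1) = 0 := by
          rw [show q + (l - 1) + 1 = q + l by omega, hql]
        obtain ⟨e1, -⟩ := h0 _ hend hend'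
        rw [c1, show u + 1 + (b + (l - 2)) = q + (l - 1) by omega, win_succ', hend,
          win_const (c := 0) fun t htb => by
            rw [show q + (l - 1) + 1 + t = q + (l - 1) + (t + 1) by omega]
            exact e1 _ (by omega) (by omega)]
        ring
      · rw [c1] at h6
        -- Between the two ends of a run of ones every window contains `11`, so it leaves the class
        -- with a single one.
        have two : ∀ v, t ≤ v → v + 1 ≤ t + b → y v = 1 → y (v + 1) = 1 → False := by
          intro v v1 v2 v3 v4
          have e := win_add y (v + 1 - t) (t + b - v) t
          rw [show v + 1 - t + (t + b - v) = b + 1 by omega, h6] at e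
          have p1 := hy.win_pos (l := v + 1 - t) (i := t) (u := v) v1 (by omega) v3
          have p2 := hy.win_pos (l := t + b - v) (i := t + (v + 1 - t)) (u := v + 1) (by omega)
            (by omega) v4
          omega
        rcases Nat.lt_or_ge (q + 1) t with h7 | h7
        · refine two t le_rfl (by omega) ?_ ?_
          · have := hq1 (t - q) (by omega) (by omega)
            rwa [show q + (t - q) = t by omega] at this
          · have := hq1 (t + 1 - q) (by omega) (by omega)
            rwa [show q + (t + 1 - q) = t + 1 by omega] at this
        · exact two (q + 1) h7 (by omega) (hq1 1 (by omega) (by omega)) (hq1 2 (by omega) h)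
    · right
      obtain rfl : l = 2 := by omega
      exact ⟨rfl, Ret.of_succ (by rw [hu2, show u + 1 + (b + 1) = q + 2 by omega, hql]),
        by rw [win_one, hu2]⟩
  obtain ⟨n₁, g₁, c₁, d₁⟩ := main p₁ l₁ hl₁ G₁
  obtain ⟨n₂, g₂, c₂, d₂⟩ := main p₂ l₂ (by omega) G₂
  obtain ⟨d₂l, r₂⟩ : 3 ≤ l₂ ∧ Ret y (b + 1) n₂ (n₂ + (b + (l₂ - 2))) := by
    rcases d₂ with d | d
    · exact d
    · omega
  -- the return `1`
  obtain ⟨q, hq, hqp⟩ := hr.factor p₁ (l₁ + 1) (m₀ + 1)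
  set n₀ := q + (l₁ - 1) with hn₀
  have s1 : y n₀ = 1 := by rw [hqp _ (by omega), G₁.ones _ (by omega) (by omega)]
  have s2 : y (n₀ + 1) = 0 := by
    rw [show n₀ + 1 = q + l₁ by omega, hqp _ (by omega), G₁.right]
  obtain ⟨s3, s4⟩ := h0 _ s1 s2
  have r₀ : Ret y (b + 1) n₀ (n₀ + 1) := Ret.of_succ (by rw [s1, ← s4]; rfl)
  have c₀ : win y (b + 1) n₀ = 1 := by
    rw [win_succ', s1, win_const (c := 0) fun t htb => by
      rw [show n₀ + 1 + t = n₀ + (t + 1) by omega]; exact s3 _ (by omega) (by omega)]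
    ring
  rcases d₁ with ⟨d, r₁⟩ | ⟨rfl, r₁, e₁⟩
  · exact h3.false_of_three_derived ht he hk hD h1 (by omega) g₁ g₂ r₀ c₀ r₁ c₁ r₂ c₂
      (fun h _ => by omega) (fun h _ => by omega) (fun h _ => by omega)
  · exact h3.false_of_three_derived ht he hk hD h1 (by omega) g₁ g₂ r₀ c₀ r₁ c₁ r₂ c₂
      (fun _ h => by rw [e₁, win_one, s1] at h; omega) (fun h _ => by omega) (fun h _ => by omega)

end AbelianReturns

/-! ### Constant `P`: runs of short distances -/

namespace AbelianReturns
variable {x : ℕ → ℤ}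
variable {ζ : ℕ → ℕ} {y : ℕ → ℤ} {k D : ℕ}

/-- The return starts at the last window that contains only the first one of the run of short
distances and ends at the first window that contains only its last one. In between a window always
covers two ones, since it is longer than `k` by at least as much as this requires. -/
lemma TwoGaps.ret_of_zero_run (ht : TwoGaps ζ y k D) (hen : OneEnum x ζ) {e : ℕ}
    (he : 1 ≤ e) (hke : e < k + 1) (heD : k + e ≤ D) {n l : ℕ} (h1 : y n = 1) (h2 : y (n + (l + 2)) = 1)
    (h0 : ∀ t, 0 < t → t < l + 2 → y (n + t) = 0) :
    ∃ t, Ret x (2 * k + e - 1) t (t + ((l + 1) * k + e)) ∧ win x (2 * k + e - 1) t = 1 ∧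
      win x ((l + 1) * k + e) t = l + 1 := by
  have g1 := ht.of_one h1
  have g2 := ht.of_one h2
  have gs : ∀ s, s ≤ l + 1 → ζ (n + 1 + s) = ζ (n + 1) + s * k := by
    intro s
    induction s with
    | zero => simp
    | succ s ih =>
      intro hs
      have := ht.of_zero (h0 (s + 1) (by omega) (by omega))
      rw [show n + (s + 1) = n + 1 + s by omega, ih (by omega)] at this
      rw [← add_assoc, this]; ring
  have gl := gs l (by omega)
  have gl1 := gs (l + 1) le_rfl
  have g11 := gs 1 (by omega)
  rw [show n + 1 + (l + 1) = n + (l + 2) by omega] at gl1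
  rw [show n + (l + 2) + 1 = n + l + 3 by omega] at g2
  rw [show n + 1 + l = n + l + 1 by omega] at gl
  have hlk : (l + 1) * k = l * k + k := by ring
  set t₀ := ζ (n + 1) + 1 - k - e with ht₀
  have c₀ : win x (2 * k + e - 1) t₀ = 1 := by
    rw [hen.win_eq (n := n) (m := n + 1) (by omega) (by omega) (by omega)
      (by show _ ≤ ζ (n + 1 + 1); omega)]
    push_cast; ring
  have hend : t₀ + ((l + 1) * k + e) = ζ (n + l + 1) + 1 := by omega
  have hlast := hen.lt (n + l + 1)
  have hn2 : n + l + 1 + 1 = n + (l + 2) := by omega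
  have c₁ : win x (2 * k + e - 1) (ζ (n + l + 1) + 1) = 1 := by
    rw [hen.win_eq (n := n + l + 1) (m := n + l + 2) (by omega) (by omega)
      (by show ζ (n + (l + 2)) < _; omega) (by show _ ≤ ζ (n + l + 3); omega)]
    push_cast; ring
  refine ⟨t₀, ⟨by omega, by rw [hend, c₀, c₁], fun t h3 h4 h5 => ?_⟩, c₀, ?_⟩
  · rw [hend] at h4
    rw [c₀] at h5
    obtain ⟨i, h6, h7⟩ := hen.locate (t := t) (by
      have := hen.strictMono.monotone (Nat.zero_le n); omega)
    have i1 : n < i + 1 := hen.strictMono.lt_iff_lt.1 (by omega)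
    have i2 : i < n + l + 1 := hen.strictMono.lt_iff_lt.1 (by omega)
    have h8 : ζ (i + 2) < t + (2 * k + e - 1) := by
      rcases Nat.eq_or_lt_of_le (show n ≤ i by omega) with rfl | hi
      · show ζ (n + 1 + 1) < _
        omega
      · obtain ⟨s, rfl⟩ : ∃ s, i = n + 1 + s := ⟨i - (n + 1), by omega⟩
        have e1 := gs s (by omega)
        have e2 := gs (s + 2) (by omega)
        rw [← add_assoc] at e2
        have : (s + 2) * k = s * k + 2 * k := by ring
        omega
    have := hen.le_win h6 h7 h8
    push_cast at this
    omega
  · rw [hen.win_eq (n := n) (m := n + l + 1) (by omega) (by omega) (by omega) (by omega)]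
    push_cast; ring

/-- If the long distance is shorter than the window, the return passes through windows with at least
two ones; otherwise it passes through windows with none. In both cases it contains just the one at
the start of the long distance. -/
lemma TwoGaps.ret_of_long_gap (ht : TwoGaps ζ y k D) (hen : OneEnum x ζ) {e : ℕ} (he : 1 ≤ e) (hk0 : 0 < k)
    (hkD : k ≤ D) (heD : k + e ≤ D) {p : ℕ} (h1 : y (p + 1) = 1) :
    ∃ t l, Ret x (2 * k + e - 1) t (t + l) ∧ win x (2 * k + e - 1) t = 1 ∧ win x l t = 1 ∧
      ((l : ℤ) = D - (2 * k + e - 1) + 1 ∨ (l : ℤ) = (2 * k + e - 1) - D + 1) := by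
  have g0 := ht.lt_add hkD p
  have g1 := ht.of_one h1
  have g2 := ht.lt_add hkD (p + 1 + 1)
  rcases Nat.lt_or_ge D (2 * k + e - 1) with h | h
  · have c₀ : win x (2 * k + e - 1) (ζ (p + 1) + D - (2 * k + e - 1)) = 1 := by
      rw [hen.win_eq (n := p) (m := p + 1) (by omega) (by omega) (by omega) (by omega)]
      push_cast; ring
    have c₁ : win x (2 * k + e - 1) (ζ (p + 1) + 1) = 1 := by
      rw [hen.win_eq (n := p + 1) (m := p + 1 + 1) (by omega) (by omega) (by omega) (by omega)]
      push_cast; ring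
    have hend : ζ (p + 1) + D - (2 * k + e - 1) + (2 * k + e - 1 - D + 1) = ζ (p + 1) + 1 := by omega
    refine ⟨ζ (p + 1) + D - (2 * k + e - 1), 2 * k + e - 1 - D + 1,
      ⟨by omega, by rw [hend, c₀, c₁], fun t h3 h4 h5 => ?_⟩, c₀, ?_, by omega⟩
    · rw [c₀] at h5
      have := hen.le_win (N := 2 * k + e - 1) (t := t) (n := p) (m := p + 1 + 1) (by omega) (by omega)
        (by omega)
      push_cast at this
      omega
    · rw [hen.win_eq (n := p) (m := p + 1) (by omega) (by omega) (by omega) (by omega)]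
      push_cast; ring
  · have c₀ : win x (2 * k + e - 1) (ζ (p + 1)) = 1 := by
      rw [hen.win_eq (n := p) (m := p + 1) (by omega) (by omega) (by omega) (by omega)]
      push_cast; ring
    have c₁ : win x (2 * k + e - 1) (ζ (p + 1) + (D - (2 * k + e - 1) + 1)) = 1 := by
      rw [hen.win_eq (n := p + 1) (m := p + 1 + 1) (by omega) (by omega) (by omega) (by omega)]
      push_cast; ring
    refine ⟨ζ (p + 1), D - (2 * k + e - 1) + 1, ⟨by omega, by rw [c₀, c₁], fun t h3 h4 h5 => ?_⟩, c₀,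
      ?_, by omega⟩
    · rw [c₀, hen.win_eq (n := p + 1) (m := p + 1) (by omega) (by omega) (by omega) (by omega)] at h5
      omega
    · rw [hen.win_eq (n := p) (m := p + 1) (by omega) (by omega) (by omega) (by omega)]
      push_cast; ring

/-- Two lengths of runs of short distances give four returns. -/
lemma AtMostThree.false_of_two_zero_runs (h3 : AtMostThree x) (ht : TwoGaps ζ y k D)
    (hen : OneEnum x ζ) (hk : 2 ≤ k) (hD : k + 2 ≤ D) {n₁ n₂ l₁ l₂ : ℕ} (hl₁ : 2 ≤ l₁) (hl₂ : 2 ≤ l₂)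
    (hl : l₁ ≠ l₂) (G₁ : ZeroGap (swapLetters y) n₁ l₁) (G₂ : ZeroGap (swapLetters y) n₂ l₂) :
    False := by
  obtain ⟨l₁, rfl⟩ : ∃ l, l₁ = l + 2 := ⟨l₁ - 2, by omega⟩
  obtain ⟨l₂, rfl⟩ : ∃ l, l₂ = l + 2 := ⟨l₂ - 2, by omega⟩
  have one : ∀ t, swapLetters y t = 0 → y t = 1 := fun t h => by rw [swapLetters_apply] at h; omega
  have zero : ∀ t, swapLetters y t = 1 → y t = 0 := fun t h => by rw [swapLetters_apply] at h; omega
  -- The return over a long distance has a single one and could coincide with the return over a run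
  -- of one short distance. This happens only for `D = 3 * k + 2 * e - 2`, so one of `e = 1`, `e =
  -- 2` avoids it.
  obtain ⟨e, he, hke, heD, hne⟩ : ∃ e, 1 ≤ e ∧ e < k + 1 ∧ k + e < D ∧ D ≠ 3 * k + 2 * e - 2 := by
    by_cases h : D = 3 * k
    · exact ⟨2, by omega, by omega, by omega, by omega⟩
    · exact ⟨1, by omega, by omega, by omega, by omega⟩
  obtain ⟨t₁, R₁, C₁, E₁⟩ := ht.ret_of_zero_run hen he hke heD.le (one _ G₁.left)
    (one _ G₁.right) fun t p q => zero _ (G₁.ones t p q)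
  obtain ⟨t₂, R₂, C₂, E₂⟩ := ht.ret_of_zero_run hen he hke heD.le (one _ G₂.left)
    (one _ G₂.right) fun t p q => zero _ (G₂.ones t p q)
  have hp := one _ G₁.right
  rw [← add_assoc] at hp
  set p := n₁ + l₁ + 1 with hpdef
  replace hp : y (p + 1) = 1 := hp
  obtain ⟨t₃, L, R₃, C₃, E₃, F₃⟩ := ht.ret_of_long_gap hen he (by omega) (by omega) heD.le hp
  have g0 := ht.lt_add (by omega) p
  have g1 := ht.of_one hp
  have C₀ : win x (2 * k + e - 1) (ζ (p + 1) + 1 - k) = 1 := by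
    rw [hen.win_eq (n := p) (m := p + 1) (by omega) (by omega) (by omega) (by omega)]
    push_cast; ring
  have C₀' : win x (2 * k + e - 1) (ζ (p + 1) + 1 - k + 1) = 1 := by
    rw [hen.win_eq (n := p) (m := p + 1) (by omega) (by omega) (by omega) (by omega)]
    push_cast; ring
  have R₀ : Ret x (2 * k + e - 1) (ζ (p + 1) + 1 - k) (ζ (p + 1) + 1 - k + 1) :=
    ⟨by omega, by rw [C₀', C₀], fun t _ _ => by omega⟩
  have E₀ : win x 1 (ζ (p + 1) + 1 - k) = 0 := by
    rw [win_one]; exact hen.zero p _ (by omega) (by omega)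
  have long : ∀ l : ℕ, L = (l + 1) * k + e → (1 : ℤ) = l + 1 → False := fun l h h' => by
    obtain rfl : l = 0 := by omega
    rw [zero_add, one_mul] at h
    omega
  exact h3.four R₀ C₀ rfl E₀ R₃ C₃ rfl E₃ R₁ C₁ rfl E₁ R₂ C₂ rfl E₂ (fun _ h => by omega)
    (fun _ h => by omega) (fun _ h => by omega) (long l₁) (long l₂) (fun _ h => by omega)

end AbelianReturns

/-! ### At most three returns force balance -/

namespace AbelianReturns
variable {x : ℕ → ℤ}

lemma PrefixRecurrent.exists_descent (hx : IsBinary x) (hr : PrefixRecurrent x) {i j : ℕ}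
    (hi : x i = 0) (hj : x j = 1) : ∃ u, x u = 1 ∧ x (u + 1) = 0 := by
  obtain ⟨q, hq, hq'⟩ := hr.factor i 1 (j + 1)
  have hq0 := hq' 0 (by omega)
  rw [add_zero, add_zero, hi] at hq0
  obtain ⟨u, u', h2, h3, h4, h5, h6⟩ := hr.straddle (N := 1) (i₀ := j) (m := q) (by omega)
  simp only [Ret, win_one] at h5 h6
  have hu : x u = 1 := h6.trans hj
  refine ⟨u, hu, (hx (u + 1)).resolve_right fun h => ?_⟩
  have : u ≠ q := fun h => by rw [h, hq0] at hu; omega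
  exact h5.2.2 (u + 1) (by omega) (by omega) (h.trans hu.symm)

lemma zeroBlocks_of_unique_gap (hx : IsBinary x) (hr : PrefixRecurrent x) {L : ℕ}
    (h : ∀ z l, ZeroGap (swapLetters x) z l → 2 ≤ l → l = L + 1) : ZeroBlocks x L := by
  intro t ht ht1
  obtain ⟨l, g⟩ := hr.flip.exists_zeroGap hx.flip (z := t) (by simp [swapLetters_apply, ht])
  have hl : 2 ≤ l := by
    have h1 := g.pos
    have h2 := g.right
    rw [swapLetters_apply] at h2
    by_contra hc
    obtain rfl : l = 1 := by omega
    omega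
  obtain rfl := h t l g hl
  refine ⟨fun s h1 h2 => ?_, ?_⟩
  · have := g.ones s h1 (by omega)
    rw [swapLetters_apply] at this; linarith
  · have := g.right
    rw [swapLetters_apply] at this
    rw [add_assoc]; linarith

/-- A descent in a binary word starts a gap of length at least two between ones. -/
lemma PrefixRecurrent.exists_long_gap (hx : IsBinary x) (hr : PrefixRecurrent x) {i j : ℕ}
    (hi : x i = 0) (hj : x j = 1) : ∃ z l, 2 ≤ l ∧ ZeroGap (swapLetters x) z l := by
  obtain ⟨u, h1, h2⟩ := hr.exists_descent hx hi hj
  obtain ⟨l, g⟩ := hr.flip.exists_zeroGap hx.flip (z := u) (by simp [swapLetters_apply, h1])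
  refine ⟨u, l, ?_, g⟩
  have h3 := g.pos
  have h4 := g.right
  rw [swapLetters_apply] at h4
  by_contra hc
  obtain rfl : l = 1 := by omega
  omega

/-- First the runs of short distances, then those of long distances, are shown to have constant
length. Then `y` is ultimately periodic, although it inherits aperiodicity from `x`. -/
lemma AtMostThree.false_of_twoGaps (h3 : AtMostThree x) {ζ : ℕ → ℕ} {y : ℕ → ℤ} {k D : ℕ}
    (hr : PrefixRecurrent x) (ha : IsAperiodic x) (ht : TwoGaps ζ y k D) (he : OneEnum x ζ)
    (hk : 2 ≤ k) (hD : k + 2 ≤ D) {i j : ℕ} (hi : y i = 0) (hj : y j = 1) : False := by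
  have hy := ht.isBinary
  have hry := ht.prefixRecurrent he hr
  have hay := ht.aperiodic he ha
  obtain ⟨n, l, hl, G⟩ := hry.exists_long_gap hy hi hj
  have h0 : ZeroBlocks y (l - 1) := zeroBlocks_of_unique_gap hy hry fun n' l' G' hl' => by
    by_contra hc
    exact h3.false_of_two_zero_runs ht he hk hD hl' hl (by omega) G' G
  obtain ⟨p, m, hm, G'⟩ := hry.flip.exists_long_gap hy.flip (i := j) (j := i)
    (by simp [swapLetters_apply, hj]) (by simp [swapLetters_apply, hi])
  rw [swapLetters_swapLetters] at G'
  have h1 : ZeroBlocks (swapLetters y) (m - 1) :=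
    zeroBlocks_of_unique_gap hy.flip hry.flip fun p' m' G'' hm' => by
      rw [swapLetters_swapLetters] at G''
      by_contra hc
      rcases lt_or_gt_of_ne (show m' ≠ m by omega) with h | h
      · exact h3.false_of_derived_zeroBlocks ht he hk hD hry (by omega) h0 hm' h G'' G'
      · exact h3.false_of_derived_zeroBlocks ht he hk hD hry (by omega) h0 hm h G' G''
  exact h0.not_aperiodic hy hry (by omega) (by omega) h1 hi hj hay

/-- If ones are at distance at least `k` and `1 0^(k-1) 1` occurs, then only one larger distance
occurs. -/
lemma AtMostThree.gap_unique (h3 : AtMostThree x) {ζ : ℕ → ℕ} {k q : ℕ} (he : OneEnum x ζ)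
    (hk : 2 ≤ k) (hg : ∀ n, ζ n + k ≤ ζ (n + 1)) (hq : x q = 1) (hqk : x (q + k) = 1)
    (hq0 : ∀ t, 0 < t → t < k → x (q + t) = 0) {n m : ℕ} (hn : ζ (n + 1) + k < ζ (n + 1 + 1))
    (hm : ζ (m + 1) + k < ζ (m + 1 + 1)) : ζ (n + 1 + 1) - ζ (n + 1) = ζ (m + 1 + 1) - ζ (m + 1) := by
  have one : ∀ n, win x k (ζ (n + 1)) = 1 := fun n => by
    rw [he.win_eq (n := n) (m := n + 1) (he.lt n) le_rfl (by omega) (hg (n + 1))]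
    push_cast; ring
  -- A window of length `k` loses the one it starts with and stays empty until the next one enters:
  -- a distance `g > k` gives a return of length `g - k + 1` with a single one.
  have main : ∀ n, ζ (n + 1) + k < ζ (n + 1 + 1) →
      Ret x k (ζ (n + 1)) (ζ (n + 1) + (ζ (n + 1 + 1) - ζ (n + 1) - k + 1)) ∧
      win x (ζ (n + 1 + 1) - ζ (n + 1) - k + 1) (ζ (n + 1)) = 1 := by
    intro n hn
    have g := hg (n + 1 + 1)
    have g0 := he.lt n
    refine ⟨⟨by omega, ?_, fun t h4 h5 h6 => ?_⟩, ?_⟩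
    · rw [one, he.win_eq (n := n + 1) (m := n + 1 + 1) (by omega) (by omega) (by omega) (by omega)]
      push_cast; ring
    · rw [one, he.win_eq (n := n + 1) (m := n + 1) (by omega) (by omega) (by omega) (by omega)] at h6
      omega
    · rw [he.win_eq (n := n) (m := n + 1) (by omega) (by omega) (by omega) (by omega)]
      push_cast; ring
  obtain ⟨R₂, E₂⟩ := main n hn
  obtain ⟨R₃, E₃⟩ := main m hm
  have g := hg n
  have C₀ : win x k (ζ (n + 1) - 1) = 1 := by
    rw [he.win_eq (n := n) (m := n + 1) (by omega) (by omega) (by omega) (by omega)]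
    push_cast; ring
  have hs : ζ (n + 1) = ζ (n + 1) - 1 + 1 := by omega
  have R₀ : Ret x k (ζ (n + 1) - 1) (ζ (n + 1)) :=
    ⟨by omega, by rw [C₀, one], fun t _ _ => by omega⟩
  have E₀ : win x 1 (ζ (n + 1) - 1) = 0 := by
    rw [win_one]; exact he.zero n _ (by omega) (by omega)
  have C₁ : win x k q = 1 := by
    obtain ⟨k', rfl⟩ : ∃ k', k = k' + 1 := ⟨k - 1, by omega⟩
    rw [win_succ', hq, win_const (c := 0) fun t ht => by
      rw [show q + 1 + t = q + (t + 1) by omega]; exact hq0 _ (by omega) (by omega)]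
    ring
  have R₁ : Ret x k q (q + 1) := Ret.of_succ (hqk.trans hq.symm)
  have E₁ : win x 1 q = 1 := by rw [win_one, hq]
  by_contra hne
  exact h3.four R₀ C₀ hs E₀ R₁ C₁ rfl E₁ R₂ (one n) rfl E₂ R₃ (one m) rfl E₃ (fun _ h => by omega)
    (fun h _ => by omega) (fun h _ => by omega) (fun h _ => by omega) (fun h _ => by omega)
    (fun h _ => by omega)

/-- Two ones at a distance smaller than `k` would, against the available block of `k + 1` zeros,
form a shorter unbalanced pair. So distances are at least `k`, the value `k` occurs, and
`AtMostThree.gap_unique` leaves one larger value `D`; it is at least `k + 2` since it encloses the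
block of zeros. -/
theorem AtMostThree.false_of_unbalanced_zeros (hx : IsBinary x) (hr : PrefixRecurrent x)
    (ha : IsAperiodic x) (h3 : AtMostThree x) {k i j : ℕ} (hk : 2 ≤ k)
    (hu : Unbalanced x k i j) (hmin : ∀ l, 0 < l → l < k → ∀ i j, ¬ Unbalanced x l i j)
    (hz : ∀ t, t ≤ k → x (i + t) = 0) : False := by
  obtain ⟨-, -, b1, b2, hm⟩ := hu
  have hj0 : ∀ t, 0 < t → t < k → x (j + t) = 0 := fun t h h' => by rw [← hm t h h', hz t h'.le]
  obtain ⟨ζ, he⟩ := OneEnum.exists_of_one hx hr b1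
  have hg : ∀ n, ζ n + k ≤ ζ (n + 1) := fun n => by
    by_contra hc
    have h0 := he.lt n
    refine hmin (ζ (n + 1) - ζ n) (by omega) (by omega) i (ζ n) ⟨hz 0 (by omega), hz _ (by omega),
      he.one n, ?_, fun t h1 h2 => ?_⟩
    · rw [show ζ n + (ζ (n + 1) - ζ n) = ζ (n + 1) by omega, he.one]
    · rw [hz t (by omega), he.zero n _ (by omega) (by omega)]
  -- a large gap
  obtain ⟨q, hq, hqi⟩ := hr.factor i (k + 1) (ζ 1 + 1)
  obtain ⟨n, h1, h2⟩ := he.locate (t := q) (by have := he.lt 0; rw [zero_add] at this; omega)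
  have hn0 : n ≠ 0 := by rintro rfl; rw [zero_add] at h2; omega
  obtain ⟨n, rfl⟩ : ∃ n', n = n' + 1 := ⟨n - 1, by omega⟩
  have hbig : q + k < ζ (n + 1 + 1) := by
    by_contra hc
    have := hqi (ζ (n + 1 + 1) - q) (by omega)
    rw [show q + (ζ (n + 1 + 1) - q) = ζ (n + 1 + 1) by omega, he.one, hz _ (by omega)] at this
    omega
  -- a small gap
  obtain ⟨p, hp, hpj⟩ := hr.factor j (k + 1) (ζ 1 + 1)
  obtain ⟨m, hmp⟩ := he.exists_eq (t := p) (by have := he.lt 0; rw [zero_add] at this; omega) (by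
    have := hpj 0 (by omega); rw [add_zero, add_zero] at this; rw [this, b1])
  have hm0 : m ≠ 0 := by rintro rfl; have := he.lt 0; rw [zero_add] at this; omega
  obtain ⟨m, rfl⟩ : ∃ m', m = m' + 1 := ⟨m - 1, by omega⟩
  have hsmall : ζ (m + 1 + 1) = ζ (m + 1) + k := by
    refine le_antisymm ?_ (hg _)
    by_contra hc
    have := hpj k (by omega)
    rw [b2, he.zero (m + 1) (p + k) (by omega) (by omega)] at this
    omega
  set D := ζ (n + 1 + 1) - ζ (n + 1) with hD
  have ht : TwoGaps (fun n => ζ (n + 1))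
      (fun n => if ζ (n + 1 + 1) = ζ (n + 1) + k then 0 else 1) k D := by
    refine ⟨fun s => ?_, by omega⟩
    have gs := hg (s + 1)
    by_cases h : ζ (s + 1 + 1) = ζ (s + 1) + k
    · exact Or.inl ⟨if_pos h, h⟩
    · refine Or.inr ⟨if_neg h, ?_⟩
      have := h3.gap_unique he hk hg b1 b2 hj0 (n := s) (m := n) (by omega) (by omega)
      show ζ (s + 1 + 1) = ζ (s + 1) + D
      omega
  exact h3.false_of_twoGaps hr ha ht ⟨fun n => he.one _, fun n => he.lt _, fun n => he.zero _⟩ hk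
    (by omega) (i := m) (j := n) (if_pos hsmall) (if_neg (by omega))

/-- A recurrent aperiodic binary word with at most three types of returns is balanced. -/
theorem AtMostThree.isBalanced (hx : IsBinary x) (hr : PrefixRecurrent x) (ha : IsAperiodic x)
    (h3 : AtMostThree x) : IsBalanced x := by
  by_contra hb
  obtain ⟨k, i, j, hk, hu, hmin⟩ := hx.exists_min_unbalanced hb
  have no1 := h3.not_unbalanced_one hx hr ha
  have hk2 : 2 ≤ k := by
    by_contra hc
    obtain rfl : k = 1 := by omega
    exact no1 _ _ hu
  have main : ∀ x : ℕ → ℤ, IsBinary x → PrefixRecurrent x → IsAperiodic x → AtMostThree x →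
      ∀ i j, Unbalanced x k i j → (∀ l, 0 < l → l < k → ∀ i j, ¬ Unbalanced x l i j) →
      (∀ t, x t = 0 → x (t + 1) = 1) → False := by
    intro x hx hr ha h3 i j hu hmin h00
    by_cases hj : ∃ t, t ≤ k ∧ x (j + t) = 0
    · exact h3.false_of_unbalanced_mixed hx hr ha hk2 hu hmin h00 hj
    · push Not at hj
      refine h3.flip.false_of_unbalanced_zeros hx.flip hr.flip ha.flip hk2 hu.flip
        (fun l h1 h2 a b h => hmin l h1 h2 b a (by simpa [swapLetters_swapLetters] using h.flip))
        fun t ht => ?_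
      rw [swapLetters_apply, (hx _).resolve_left (hj t ht)]; rfl
  -- `00` and `11` do not both occur, so up to exchanging the letters there is no `00`.
  by_cases h00 : ∀ t, x t = 0 → x (t + 1) = 1
  · exact main x hx hr ha h3 i j hu hmin h00
  · push Not at h00
    obtain ⟨a, ha0, ha1⟩ := h00
    refine main _ hx.flip hr.flip ha.flip h3.flip j i hu.flip
      (fun l h1 h2 a b h => hmin l h1 h2 b a (by simpa [swapLetters_swapLetters] using h.flip))
      fun t ht => ?_
    rw [swapLetters_apply] at ht ⊢
    by_contra hc
    refine no1 a t ⟨ha0, (hx _).resolve_right ha1, by omega, ?_, fun _ _ _ => by omega⟩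
    rcases hx (t + 1) with h | h
    · omega
    · exact h

end AbelianReturns

/-! ### From finite alphabets to 0-1 words, and the theorem -/

namespace AbelianReturns
variable {A : Type*} {w : ℕ → A}

/-- The abelian class of the factor of length `n` at position `i`. -/
def content (w : ℕ → A) (n i : ℕ) : Multiset A := (factorAt w i n : Multiset A)

lemma length_factorAt (w : ℕ → A) (i n : ℕ) : (factorAt w i n).length = n := List.length_ofFn

lemma card_content (w : ℕ → A) (n i : ℕ) : (content w n i).card = n := by
  rw [content, Multiset.coe_card, length_factorAt]

lemma content_zero (w : ℕ → A) (i : ℕ) : content w 0 i = 0 := rfl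

lemma content_succ (w : ℕ → A) (n i : ℕ) : content w (n + 1) i = content w n i + {w (i + n)} := by
  rw [content, factorAt, List.ofFn_succ', List.concat_eq_append, ← Multiset.coe_add]
  rfl

lemma content_succ' (w : ℕ → A) (n i : ℕ) : content w (n + 1) i = {w i} + content w n (i + 1) := by
  rw [content, factorAt, List.ofFn_succ, Multiset.singleton_add, ← Multiset.cons_coe, content, factorAt]
  simp only [Fin.val_zero, add_zero, Fin.val_succ]
  congr 3
  ext j
  congr 1
  omega

lemma content_shift_eq_iff (w : ℕ → A) (n i : ℕ) :
    content w n (i + 1) = content w n i ↔ w (i + n) = w i := by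
  have h := (content_succ w n i).symm.trans (content_succ' w n i)
  rw [add_comm] at h
  constructor
  · intro hc
    rw [hc] at h
    exact Multiset.singleton_inj.1 (add_right_cancel h)
  · intro hw
    rw [hw] at h
    exact (add_left_cancel h).symm

lemma factorAt_eq_iff {i j n : ℕ} :
    factorAt w i n = factorAt w j n ↔ ∀ t, t < n → w (i + t) = w (j + t) := by
  rw [factorAt_eq_ofFn, factorAt_eq_ofFn, List.ofFn_injective.eq_iff, window_eq_iff]

lemma isFactor_factorAt (w : ℕ → A) (i n : ℕ) : IsFactor w (factorAt w i n) :=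
  ⟨i, by rw [length_factorAt]⟩

lemma consecutiveOccurrences_iff {p n i j : ℕ} :
    ConsecutiveOccurrences w (factorAt w p n) i j ↔ i < j ∧ content w n i = content w n p ∧
      content w n j = content w n p ∧ ∀ k, i < k → k < j → content w n k ≠ content w n p := by
  simp only [ConsecutiveOccurrences, AbelianOccurs, length_factorAt, content, Ne, Multiset.coe_eq_coe]

lemma IsRecurrent.prefixRecurrent (h : IsRecurrent w) : PrefixRecurrent w := by
  intro M b
  have hinf := h _ (isFactor_factorAt w 0 M)
  rw [length_factorAt] at hinf
  obtain ⟨q, hq, hbq⟩ := hinf.exists_gt b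
  refine ⟨q, hbq.le, fun t ht => ?_⟩
  have := factorAt_eq_iff.1 hq t ht
  rwa [zero_add] at this

lemma PrefixRecurrent.isPeriodic (h : PrefixRecurrent w) (hu : IsUltimatelyPeriodic w) :
    IsPeriodic w := by
  obtain ⟨T, hT, n₀, hn⟩ := hu
  refine ⟨T, hT, fun n => ?_⟩
  obtain ⟨q, hq, hqt⟩ := h (n + T + 1) n₀
  rw [← hqt (n + T) (by omega), ← hqt n (by omega), ← hn (q + n) (by omega), add_assoc]

lemma PrefixRecurrent.exists_consecutive (h : PrefixRecurrent w) {p n i : ℕ}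
    (hi : content w n i = content w n p) :
    ∃ j, ConsecutiveOccurrences w (factorAt w p n) i j := by
  have hex : ∃ j, i < j ∧ content w n j = content w n p := by
    obtain ⟨q, hq, hqt⟩ := h.factor i n (i + 1)
    refine ⟨q, hq, ?_⟩
    rw [← hi, content, content, factorAt_eq_iff.2 hqt]
  classical
  refine ⟨Nat.find hex, consecutiveOccurrences_iff.2 ⟨(Nat.find_spec hex).1, hi,
    (Nat.find_spec hex).2, fun k h1 h2 h3 => Nat.find_min hex h2 ⟨h1, h3⟩⟩⟩

lemma mem_abelianReturns {u : List A} {i j : ℕ} (h : ConsecutiveOccurrences w u i j) :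
    content w (j - i) i ∈ abelianReturns w u :=
  ⟨_, ⟨i, j, h, rfl⟩, rfl⟩

/-- In a recurrent aperiodic word some factor has more abelian returns than there are letters. -/
theorem PrefixRecurrent.exists_many_returns [Finite A] (hr : PrefixRecurrent w)
    (ha : IsAperiodic w) :
    ∃ u, IsFactor w u ∧ (Set.range w).encard < (abelianReturns w u).encard := by
  obtain ⟨M, hM⟩ : ∃ M, ∀ a ∈ Set.range w, ∃ t, t < M ∧ w t = a := by
    choose f hf using fun a : Set.range w => a.2
    obtain ⟨M, hM⟩ := (Set.finite_range f).bddAbove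
    exact ⟨M + 1, fun a h => ⟨f ⟨a, h⟩, by have := hM ⟨⟨a, h⟩, rfl⟩; omega, hf ⟨a, h⟩⟩⟩
  obtain ⟨n, hn, hnt⟩ := hr M 1
  have hex : ∃ J, w (n + J) ≠ w J := by
    by_contra hno
    push Not at hno
    have := ha.ne_of_future (a := n) (b := 0) fun t => by rw [hno, zero_add]
    omega
  classical
  have hJ := Nat.find_spec hex
  have hlt : ∀ t, t < Nat.find hex → w (n + t) = w t := fun t ht => by
    have := Nat.find_min hex ht
    push Not at this
    exact this
  set J := Nat.find hex
  have hMJ : M ≤ J := by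
    by_contra hc
    exact hJ (hnt J (by omega))
  -- Up to `J` the letter entering a window of length `n` equals the letter leaving it.
  have hcl : ∀ t, t ≤ J → content w n t = content w n 0 := by
    intro t
    induction t with
    | zero => intro _; rfl
    | succ t ih =>
      intro ht
      rw [← ih (by omega), content_shift_eq_iff, add_comm, hlt t (by omega)]
  refine ⟨factorAt w 0 n, isFactor_factorAt w 0 n, ?_⟩
  obtain ⟨j, hj⟩ := hr.exists_consecutive (hcl J le_rfl)
  -- At `J` the entering and leaving letters differ, so the class is left and the return is longer
  -- than a letter.
  have hjJ : J + 1 < j := by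
    obtain ⟨h1, -, h3, -⟩ := consecutiveOccurrences_iff.1 hj
    rcases Nat.eq_or_lt_of_le (show J + 1 ≤ j by omega) with h | h
    · rw [← h, ← hcl J le_rfl, content_shift_eq_iff, add_comm] at h3
      exact absurd h3 hJ
    · exact h
  have hletters : (fun a => ({a} : Multiset A)) '' Set.range w ⊆ abelianReturns w (factorAt w 0 n) := by
    rintro _ ⟨a, ha', rfl⟩
    obtain ⟨t, ht, rfl⟩ := hM a ha'
    have := mem_abelianReturns (w := w) (u := factorAt w 0 n) (i := t) (j := t + 1)
      (consecutiveOccurrences_iff.2 ⟨by omega, hcl t (by omega), hcl (t + 1) (by omega),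
        fun k _ _ => by omega⟩)
    rw [show t + 1 - t = 0 + 1 by omega, content_succ', content_zero, add_zero] at this
    exact this
  have hnot : content w (j - J) J ∉ (fun a => ({a} : Multiset A)) '' Set.range w := by
    rintro ⟨a, -, h⟩
    have := congrArg Multiset.card h
    rw [card_content, Multiset.card_singleton] at this
    omega
  have hsub := Set.encard_le_encard (Set.insert_subset (mem_abelianReturns hj) hletters)
  rw [Set.encard_insert_of_notMem hnot, Set.InjOn.encard_image fun _ _ _ _ h => Multiset.singleton_inj.1 h]
    at hsub
  exact lt_of_lt_of_le (ENat.lt_add_one_iff (Set.toFinite (Set.range w)).encard_lt_top.ne |>.2 le_rfl) hsub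

/-- The letters of `w` are `c` and `d`, and `x` marks the occurrences of `c`. -/
structure Codes (w : ℕ → A) (c d : A) (x : ℕ → ℤ) : Prop where
  ne : c ≠ d
  letter : ∀ i, (w i = c ∧ x i = 1) ∨ (w i = d ∧ x i = 0)

variable {c d : A} {x : ℕ → ℤ}

lemma Codes.isBinary (h : Codes w c d x) : IsBinary x := fun i => by
  rcases h.letter i with h | h
  · exact Or.inr h.2
  · exact Or.inl h.2

lemma Codes.eq_iff (h : Codes w c d x) (i j : ℕ) : x i = x j ↔ w i = w j := by
  have hne := h.ne
  have hne' := h.ne.symm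
  rcases h.letter i with h1 | h1 <;> rcases h.letter j with h2 | h2 <;>
    simp [h1.1, h1.2, h2.1, h2.2, hne, hne']

lemma Codes.content_eq (h : Codes w c d x) (n i : ℕ) : content w n i =
    Multiset.replicate (win x n i).toNat c + Multiset.replicate (n - (win x n i).toNat) d := by
  induction n with
  | zero => simp [content_zero, win_zero]
  | succ n ih =>
    have h0 := h.isBinary.win_nonneg n i
    have h1 := h.isBinary.win_le n i
    rw [content_succ, win_succ, ih]
    rcases h.letter (i + n) with ⟨h2, h3⟩ | ⟨h2, h3⟩
    · rw [h2, h3, show (win x n i + 1).toNat = (win x n i).toNat + 1 by omega,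
        show n + 1 - ((win x n i).toNat + 1) = n - (win x n i).toNat by omega,
        Multiset.replicate_succ, ← Multiset.singleton_add]
      abel
    · rw [h2, h3, add_zero, show n + 1 - (win x n i).toNat = n - (win x n i).toNat + 1 by omega,
        Multiset.replicate_succ, ← Multiset.singleton_add]
      abel

lemma Codes.content_eq_iff (h : Codes w c d x) {n m i j : ℕ} :
    content w n i = content w m j ↔ n = m ∧ win x n i = win x m j := by
  classical
  constructor
  · intro he
    have h1 := congrArg Multiset.card he
    rw [card_content, card_content] at h1
    have h2 := congrArg (Multiset.count c) he
    rw [h.content_eq, h.content_eq] at h2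
    simp only [Multiset.count_add, Multiset.count_replicate_self, Multiset.count_replicate,
      if_neg h.ne.symm, add_zero] at h2
    have h3 := h.isBinary.win_nonneg n i
    have h4 := h.isBinary.win_nonneg m j
    exact ⟨h1, by omega⟩
  · rintro ⟨rfl, he⟩
    rw [h.content_eq, h.content_eq, he]

lemma Codes.consecutiveOccurrences_iff (h : Codes w c d x) {p n i j : ℕ} :
    ConsecutiveOccurrences w (factorAt w p n) i j ↔ Ret x n i j ∧ win x n i = win x n p := by
  rw [AbelianReturns.consecutiveOccurrences_iff]
  simp only [Ne, h.content_eq_iff, true_and, Ret]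
  constructor
  · rintro ⟨h1, h2, h3, h4⟩
    exact ⟨⟨h1, h3.trans h2.symm, fun k a b => h2 ▸ h4 k a b⟩, h2⟩
  · rintro ⟨⟨h1, h2, h3⟩, h4⟩
    exact ⟨h1, h4, h2.trans h4, fun k a b => h4 ▸ h3 k a b⟩

lemma Codes.isAperiodic (h : Codes w c d x) (ha : IsAperiodic w) : IsAperiodic x := by
  rintro ⟨T, hT, n₀, hn⟩
  exact ha ⟨T, hT, n₀, fun n hn' => (h.eq_iff _ _).1 (hn n hn')⟩

lemma Codes.prefixRecurrent (h : Codes w c d x) (hr : PrefixRecurrent w) : PrefixRecurrent x := by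
  intro M b
  obtain ⟨q, hq, hqt⟩ := hr M b
  exact ⟨q, hq, fun t ht => (h.eq_iff _ _).2 (hqt t ht)⟩

lemma Codes.exists_of_range (hcd : c ≠ d) (hw : Set.range w = {c, d}) : ∃ x, Codes w c d x := by
  classical
  refine ⟨fun i => if w i = c then 1 else 0, hcd, fun i => ?_⟩
  have : w i ∈ ({c, d} : Set A) := hw ▸ ⟨i, rfl⟩
  rcases this with h | h
  · exact Or.inl ⟨h, if_pos h⟩
  · have h : w i = d := h
    exact Or.inr ⟨h, if_neg fun h' => hcd (h'.symm.trans h)⟩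

lemma Codes.isSturmian_iff (h : Codes w c d x) : IsSturmian x ↔ IsSturmian w := by
  classical
  have : ∀ n, complexity x n = complexity w n := fun n => by
    rw [← complexity_comp w (fun a => if a = c then (1 : ℤ) else 0) _ n]
    · congr 1
      ext i
      rcases h.letter i with ⟨h1, h2⟩ | ⟨h1, h2⟩
      · simp [h1, h2]
      · simp [h1, h2, h.ne.symm]
    · intro i j
      have hne := h.ne
      have hne' := h.ne.symm
      rcases h.letter i with ⟨h1, -⟩ | ⟨h1, -⟩ <;> rcases h.letter j with ⟨h2, -⟩ | ⟨h2, -⟩ <;>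
        simp [h1, h2, hne, hne']
  simp only [IsSturmian, this]

lemma abelianReturns_encard_le (w : ℕ → A) (u : List A) :
    (abelianReturns w u).encard ≤ (semiAbelianReturns w u).encard :=
  Set.encard_image_le _ _

lemma exists_injective_of_four_le {α : Type*} {s : Set α} (h : 4 ≤ s.encard) :
    ∃ f : Fin 4 → α, Function.Injective f ∧ ∀ a, f a ∈ s := by
  obtain ⟨t, hts, ht⟩ := Set.exists_subset_encard_eq h
  have hfin : t.Finite := Set.finite_of_encard_eq_coe (k := 4) ht
  have hc : Nat.card t = 4 := by
    rw [Nat.card_coe_set_eq, Set.ncard, ht]; rfl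
  have := hfin.to_subtype
  let e := (Finite.equivFinOfCardEq hc).symm
  exact ⟨fun a => e a, Subtype.val_injective.comp e.injective, fun a => hts (e a).2⟩

/-- Each factor of a balanced aperiodic recurrent word has two or three returns. -/
lemma Codes.encard_of_isBalanced (h : Codes w c d x) (hr : PrefixRecurrent x) (ha : IsAperiodic x)
    (hb : IsBalanced x) {u : List A} (hu : IsFactor w u) :
    2 ≤ (abelianReturns w u).encard ∧ (semiAbelianReturns w u).encard ≤ 3 := by
  obtain ⟨p, hp⟩ := hu
  rw [← hp]
  generalize u.length = n
  constructor
  -- Two returns that differ as words are not even abelian equivalent, because in a balanced word a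
  -- return to a given class is determined by its length and its number of ones.
  · obtain ⟨i, j, i', j', r, r', e, e', hne⟩ := hr.exists_not_sameWord ha n p
    have : 1 < (abelianReturns w (factorAt w p n)).encard := Set.one_lt_encard_iff.2
      ⟨_, _, mem_abelianReturns (h.consecutiveOccurrences_iff.2 ⟨r, e⟩),
        mem_abelianReturns (h.consecutiveOccurrences_iff.2 ⟨r', e'⟩), fun hc => hne ?_⟩
    · exact Order.add_one_le_of_lt this
    · obtain ⟨h1, h2⟩ := h.content_eq_iff.1 hc
      have := r.1
      have := r'.1
      refine hb.sameWord_of_type h.isBinary r r' (e'.trans e.symm) h1 ?_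
      simpa only [win, show i + (j - i) = j by omega, show i' + (j' - i') = j' by omega] using h2
  · by_contra hc
    obtain ⟨f, hf, hfs⟩ := exists_injective_of_four_le (Order.add_one_le_of_lt (not_le.1 hc))
    choose i j hij hfa using hfs
    obtain ⟨a, b, hab, hl, hs⟩ := hb.exists_sameWord h.isBinary (N := n) (c := win x n p) i j
      (fun a => (h.consecutiveOccurrences_iff.1 (hij a)).1)
      (fun a => (h.consecutiveOccurrences_iff.1 (hij a)).2)
    refine hab (hf ?_)
    rw [hfa, hfa, ← hl]
    exact factorAt_eq_iff.2 fun t ht => (h.eq_iff _ _).1 (hs t ht)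

lemma Codes.atMostThree (h : Codes w c d x)
    (h3 : ∀ u, IsFactor w u → (abelianReturns w u).encard ≤ 3) : AtMostThree x := by
  intro n i j hr hc
  by_contra hno
  push Not at hno
  let f : Fin 4 → Multiset A := fun a => content w (j a - i a) (i a)
  have hf : Function.Injective f := by
    intro a b hab
    by_contra hne
    obtain ⟨h1, h2⟩ := h.content_eq_iff.1 hab
    refine hno a b hne h1 ?_
    have := (hr a).1
    have := (hr b).1
    simpa only [win, show i a + (j a - i a) = j a by omega, show i b + (j b - i b) = j b by omega]
      using h2
  have hsub : Set.range f ⊆ abelianReturns w (factorAt w (i 0) n) := by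
    rintro _ ⟨a, rfl⟩
    exact mem_abelianReturns (h.consecutiveOccurrences_iff.2 ⟨hr a, hc a 0⟩)
  have h4 := Set.encard_le_encard hsub
  have h5 := hf.encard_range.trans (h4.trans (h3 _ (isFactor_factorAt w (i 0) n)))
  rw [ENat.card_eq_coe_fintype_card, Fintype.card_fin] at h5
  exact absurd h5 (by decide)

lemma IsSturmian.range_eq (hS : IsSturmian w) : ∃ c d, c ≠ d ∧ Set.range w = {c, d} := by
  have h := hS 1
  rw [complexity_eq] at h
  have : Set.range (window w 1) = (fun a _ => a) '' Set.range w := by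
    rw [← Set.range_comp]
    congr 1
    ext i t
    rw [Subsingleton.elim t 0]; rfl
  rw [this, Set.ncard_image_of_injective _ fun a b hab => congrFun hab 0] at h
  exact Set.ncard_eq_two.1 h

lemma IsSturmian.encard_returns (hr : PrefixRecurrent w) (ha : IsAperiodic w) (hS : IsSturmian w)
    {u : List A} (hu : IsFactor w u) :
    2 ≤ (abelianReturns w u).encard ∧ (semiAbelianReturns w u).encard ≤ 3 := by
  obtain ⟨c, d, hcd, hw⟩ := hS.range_eq
  obtain ⟨x, hx⟩ := Codes.exists_of_range hcd hw
  have hax := hx.isAperiodic ha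
  exact hx.encard_of_isBalanced (hx.prefixRecurrent hr) hax
    (IsSturmian.isBalanced hx.isBinary hax (hx.isSturmian_iff.2 hS)) hu

/-- `PrefixRecurrent.exists_many_returns` leaves fewer than three letters and aperiodicity at least
two, so the word can be coded by zeros and ones and `AtMostThree.isBalanced` applies. -/
lemma isSturmian_of_encard_le [Finite A] (hr : PrefixRecurrent w) (ha : IsAperiodic w)
    (h3 : ∀ u, IsFactor w u → (abelianReturns w u).encard ≤ 3) : IsSturmian w := by
  have hlt : (Set.range w).encard < 3 := by
    obtain ⟨u, hu, h⟩ := hr.exists_many_returns ha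
    exact lt_of_lt_of_le h (h3 u hu)
  have hgt : 1 < (Set.range w).encard := by
    by_contra hc
    refine ha ⟨1, one_pos, 0, fun n _ => ?_⟩
    exact Set.encard_le_one_iff.1 (not_lt.1 hc) _ _ ⟨_, rfl⟩ ⟨_, rfl⟩
  obtain ⟨c, d, hcd, hw⟩ := Set.encard_eq_two.1
    (le_antisymm (ENat.lt_add_one_iff (by decide) |>.1 hlt) (Order.add_one_le_of_lt hgt))
  obtain ⟨x, hx⟩ := Codes.exists_of_range hcd hw
  have hax := hx.isAperiodic ha
  have hb := (hx.atMostThree h3).isBalanced hx.isBinary (hx.prefixRecurrent hr) hax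
  exact hx.isSturmian_iff.1 (hb.isSturmian hx.isBinary hax)

lemma eq_two_or_eq_three {e : ℕ∞} (h2 : 2 ≤ e) (h3 : e ≤ 3) : e = 2 ∨ e = 3 := by
  rcases eq_or_lt_of_le h2 with h | h
  · exact Or.inl h.symm
  · exact Or.inr (le_antisymm h3 (Order.add_one_le_of_lt h))

end AbelianReturns

open AbelianReturns in
theorem mainTheorem7 {A : Type*} [Finite A] (w : ℕ → A)
    (hrec : AbelianReturns.IsRecurrent w) :
    (AbelianReturns.IsAperiodic w →
      (AbelianReturns.IsSturmian w ↔
        ∀ u, AbelianReturns.IsFactor w u →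
          (AbelianReturns.abelianReturns w u).encard = 2 ∨
          (AbelianReturns.abelianReturns w u).encard = 3)) ∧
    ((∀ u, AbelianReturns.IsFactor w u →
        (AbelianReturns.abelianReturns w u).encard ≤ (Set.range w).encard) →
      AbelianReturns.IsPeriodic w) ∧
    (AbelianReturns.IsAperiodic w →
      (AbelianReturns.IsSturmian w ↔
        ∀ u, AbelianReturns.IsFactor w u →
          (AbelianReturns.semiAbelianReturns w u).encard = 2 ∨
          (AbelianReturns.semiAbelianReturns w u).encard = 3)) := by
  have hr := hrec.prefixRecurrent
  have le3 : ∀ {e : ℕ∞}, e = 2 ∨ e = 3 → e ≤ 3 := by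
    rintro e (rfl | rfl)
    · decide
    · exact le_rfl
  refine ⟨fun ha => ⟨fun hS u hu => ?_, fun h => ?_⟩, fun h => ?_,
    fun ha => ⟨fun hS u hu => ?_, fun h => ?_⟩⟩
  · obtain ⟨h2, h3⟩ := hS.encard_returns hr ha hu
    exact eq_two_or_eq_three h2 ((abelianReturns_encard_le w u).trans h3)
  · exact isSturmian_of_encard_le hr ha fun u hu => le3 (h u hu)
  · by_contra hp
    obtain ⟨u, hu, hlt⟩ := hr.exists_many_returns fun hu => hp (hr.isPeriodic hu)
    exact absurd hlt (not_lt.2 (h u hu))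
  · obtain ⟨h2, h3⟩ := hS.encard_returns hr ha hu
    exact eq_two_or_eq_three (h2.trans (abelianReturns_encard_le w u)) h3
  · exact isSturmian_of_encard_le hr ha fun u hu =>
      (abelianReturns_encard_le w u).trans (le3 (h u hu))
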